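/- **Setting.** Let $\mathsf Z=\{1,\dots,Z\}$ and let $(Z_t)_{t\ge 0}$ be a Markov chain on $\mathsf Z$ with transition probability matrix $P$. Let $(\varepsilon_t),(\zeta_t),(\eta_t)$ be i.i.d. sequences that are mutually independent and independent of the chain. Let $\beta_t=\beta(Z_t,\varepsilon_t)$, $R_t=R(Z_t,\zeta_t)$, $Y_t=Y(Z_t,\eta_t)$ for $t\ge 1$, with $\beta,R,Y$ nonnegative and measurable, and let $\beta_0=1$. The income fluctuation problem with initial wealth $a_0=a>0$ and initial state $Z_0=z$ is to maximize $$\mathrm E_z\sum_{t=0}^\infty\Big(\prod_{i=0}^t\beta_i\Big)u(c_t)$$ over consumption processes $(c_t)$ adapted to the information generated by the shocks, subject to $a_{t+1}=R_{t+1}(a_t-c_t)+Y_{t+1}$ and $0\le c_t\le a_t$. The consumption function $c(a,z)$ is the function such that $c_t=c(a_t,Z_t)$ solves this problem for every initial $a>0$ and $z\in\mathsf Z$. For $X=X(Z,\varepsilon,\zeta)$ let $\mathrm E_zX$ be its mean given $Z=z$, let $D_X$ be the diagonal matrix with entries $\mathrm E_zX$, and let $\mathrm E_z\hat X$ be the mean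 of next period's value $\hat X$ given the current state $z$, so $\mathrm E_z\hat X=\sum_{\hat z}P(z,\hat z)\,\mathrm E_{\hat z}X$. Let $r(\cdot)$ be the spectral radius. Products with a factor $\beta R=0$ are $0$; in particular $\beta R^{1-\gamma}:=(\beta R)R^{-\gamma}$ is $0$ if $R=0$. **Assumptions.** 1. $u:[0,\infty)\to\mathbb R\cup\{-\infty\}$ is nondecreasing, and on $(0,\infty)$ it is finite and twice continuously differentiable with $u'>0$ and $u''<0$; moreover $u'(0)=\infty$ and $u'(\infty)<1$. 2. $\mathrm E_z\beta$, $\mathrm E_z\beta R$, $\mathrm E_zY$ and $\mathrm E_zu'(Y)$ are finite for all $z$, and $r(PD_\beta)<1$, $r(PD_{\beta R})<1$. 3. $u'$ is regularly varying with index $-\gamma<0$: $u'(\lambda x)/u'(x)\to\lambda^{-\gamma}$ as $x\to\infty$ for all $\lambda>0$. 4. There is $\delta>0$ such that $R\in\{0\}\cup[\delta,\infty)$ almost surely in every state. Let $D=D_{\beta R^{1-\gamma}}$ and $(Fx)(z)=\big(1+(PDx)(z)^{1/\gamma}\big)^{\gamma}$ for $x\in\mathbb R_+^Z$. **Proposition.**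 Suppose that either 1. $r(PD)<1$ and $u$ has constant relative risk aversion, $u'(c)=c^{-\gamma}$ for all $c>0$; or 2. $u$ has bounded relative risk aversion, that is, there are constants with $0\le\underline\gamma\le -cu''(c)/u'(c)\le\bar\gamma<\infty$ for all $c>0$, and $$\max_{z\in\mathsf Z}\mathrm E_z\hat\beta\hat R\max\{\hat R^{-\underline\gamma},\hat R^{-\bar\gamma}\}<1.$$ Then $F$ has a unique fixed point $x^*\in\mathbb R_+^Z$, and for every $z\in\mathsf Z$ $$\lim_{a\to\infty}\frac{c(a,z)}{a}=x^*(z)^{-1/\gamma}\in(0,1].$$ -/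

import Mathlib

open MeasureTheory ProbabilityTheory Filter Topology
open scoped ENNReal

noncomputable section

namespace IncomeFluctuation

/-! ### The utility function

A utility function on `[0, ∞)` with values in `ℝ ∪ {-∞}` is a map `u : ℝ → EReal`, of which only
the values on `[0, ∞)` matter. -/

/-- The marginal utility `u'`, meaningful on `(0, ∞)`. -/
def marginal (u : ℝ → EReal) : ℝ → ℝ :=
  deriv fun c => (u c).toReal

/-- The marginal utility on `[0, ∞)` with values in `[0, ∞]`, where `u'(0) = ∞`. -/
def extMarginal (u : ℝ → EReal) (c : ℝ) : ℝ≥0∞ :=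
  if 0 < c then ENNReal.ofReal (marginal u c) else ⊤

/-- `u` is finite and twice continuously differentiable on `(0, ∞)`, `u' > 0`, `u'' < 0`,
`u'(0) = ∞`, `u'(∞) < 1`. The condition `zero_le` says that `u` is nondecreasing at the origin
also, where it may be `-∞`. -/
structure IsInada (u : ℝ → EReal) : Prop where
  ne_bot : ∀ c, 0 < c → u c ≠ ⊥
  ne_top : ∀ c, 0 < c → u c ≠ ⊤
  zero_le : ∀ c, 0 < c → u 0 ≤ u c
  contDiffOn : ContDiffOn ℝ 2 (fun c => (u c).toReal) (Set.Ioi 0)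
  marginal_pos : ∀ c, 0 < c → 0 < marginal u c
  deriv_marginal_neg : ∀ c, 0 < c → deriv (marginal u) c < 0
  tendsto_zero : Tendsto (marginal u) (𝓝[>] 0) atTop
  tendsto_top : ∃ L < 1, Tendsto (marginal u) atTop (𝓝 L)

/-- The function `f : (0, ∞) → (0, ∞)` is measurable and regularly varying with index `ρ`. -/
def IsRegularlyVarying (f : ℝ → ℝ) (ρ : ℝ) : Prop :=
  (∀ x, 0 < x → 0 < f x) ∧ Measurable (fun x : Set.Ioi (0 : ℝ) => f x) ∧
    ∀ l, 0 < l → Tendsto (fun x => f (l * x) / f x) atTop (𝓝 (l ^ ρ))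

/-! ### The environment -/

/-- The exogenous data: a transition probability matrix `P` on `N` states, the laws of the
innovations `ε`, `ζ`, `η`, and the nonnegative measurable functions `β(z, ε)`, `R(z, ζ)`,
`Y(z, η)`. -/
structure Environment (N : ℕ) (E F G : Type*)
    [MeasurableSpace E] [MeasurableSpace F] [MeasurableSpace G] where
  P : Matrix (Fin N) (Fin N) ℝ
  P_nonneg : ∀ z z', 0 ≤ P z z'
  P_sum : ∀ z, ∑ z', P z z' = 1
  lawε : Measure E
  lawζ : Measure F
  lawη : Measure G
  prob_ε : IsProbabilityMeasure lawε
  prob_ζ : IsProbabilityMeasure lawζ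
  prob_η : IsProbabilityMeasure lawη
  β : Fin N → E → ℝ
  R : Fin N → F → ℝ
  Y : Fin N → G → ℝ
  measurable_β : ∀ z, Measurable (β z)
  measurable_R : ∀ z, Measurable (R z)
  measurable_Y : ∀ z, Measurable (Y z)
  β_nonneg : ∀ z e, 0 ≤ β z e
  R_nonneg : ∀ z f, 0 ≤ R z f
  Y_nonneg : ∀ z g, 0 ≤ Y z g

/-- What is realized in one period: the Markov state and the three innovations. -/
abbrev Shock (N : ℕ) (E F G : Type*) := Fin N × E × F × G

variable {N : ℕ} {E F G : Type*} [MeasurableSpace E] [MeasurableSpace F] [MeasurableSpace G]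

namespace Environment

attribute [instance] prob_ε prob_ζ prob_η

variable (M : Environment N E F G)

/-- The law of the next Markov state if the current state is `z`. -/
def nextState (z : Fin N) : Measure (Fin N) :=
  ∑ z', ENNReal.ofReal (M.P z z') • Measure.dirac z'

instance (z : Fin N) : IsProbabilityMeasure (M.nextState z) := by
  constructor
  simp only [nextState, Measure.coe_finsetSum, Finset.sum_apply, Measure.smul_apply,
    measure_univ, smul_eq_mul, mul_one]
  rw [← ENNReal.ofReal_sum_of_nonneg fun z' _ => M.P_nonneg z z', M.P_sum, ENNReal.ofReal_one]

/-- The law of next period's shock if the current state is `z`: the innovations are mutually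
independent and independent of the Markov state. -/
def step : Kernel (Fin N) (Shock N E F G) :=
  Kernel.ofFunOfCountable fun z =>
    (M.nextState z).prod (M.lawε.prod (M.lawζ.prod M.lawη))

instance : IsMarkovKernel M.step :=
  ⟨fun z => inferInstanceAs (IsProbabilityMeasure
    ((M.nextState z).prod (M.lawε.prod (M.lawζ.prod M.lawη))))⟩

/-- The law `ℙ_z` of the sequence of shocks of the periods `1, 2, …` if `Z₀ = z`. In a path
`ω : ℕ → Shock N E F G`, the entry `ω t` is the shock of period `t + 1`. -/
def law (z : Fin N) : Measure (ℕ → Shock N E F G) :=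
  Kernel.trajMeasure (X := fun _ => Shock N E F G) (M.step z) fun n =>
    M.step.comap (fun h : (i : Finset.Iic n) → Shock N E F G =>
      (h ⟨n, Finset.mem_Iic.2 le_rfl⟩).1) (by fun_prop)

/-! ### Expectations and spectral radii -/

/-- `E_z X = E[X | Z = z]` for a variable `X` that is a function of `z`, `ε`, `ζ`. -/
def mean (X : Fin N → E → F → ℝ) (z : Fin N) : ℝ :=
  ∫ p : E × F, X z p.1 p.2 ∂(M.lawε.prod M.lawζ)

/-- `E_z X̂ = E[X(Ẑ, ε̂, ζ̂) | Z = z]`, where the hat denotes the next period. -/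
def nextMean (X : Fin N → E → F → ℝ) (z : Fin N) : ℝ :=
  ∑ z', M.P z z' * M.mean X z'

/-- The matrix `P D_X`, where `D_X` is diagonal with entries `E_z X`. -/
def PD (X : Fin N → E → F → ℝ) : Matrix (Fin N) (Fin N) ℝ :=
  M.P * Matrix.diagonal (M.mean X)

/-- The matrix `P D` with `D = D_{β R^{1-γ}}`, where `β R^{1-γ}` is read as `(β R) R^{-γ}`
and vanishes for `R = 0`. -/
def K (γ : ℝ) : Matrix (Fin N) (Fin N) ℝ :=
  M.PD fun z e f => M.β z e * M.R z f * M.R z f ^ (-γ)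

/-- `(F x)(z) = (1 + (P D x)(z)^{1/γ})^γ`. -/
def fixMap (γ : ℝ) (x : Fin N → ℝ) (z : Fin N) : ℝ :=
  (1 + ((M.K γ).mulVec x z) ^ (1 / γ)) ^ γ

end Environment

/-- The spectral radius of a real square matrix: the largest modulus of its complex
eigenvalues. -/
def specRad (A : Matrix (Fin N) (Fin N) ℝ) : ℝ≥0∞ :=
  spectralRadius ℂ (A.map ((↑) : ℝ → ℂ))

/-! ### The income fluctuation problem -/

/-- A consumption process: `p t ω` is the consumption of period `t`. -/
abbrev Plan (N : ℕ) (E F G : Type*) := ℕ → (ℕ → Shock N E F G) → ℝ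

/-- The information of period `t`: the σ-algebra generated by the shocks of the periods
`1, …, t`. -/
abbrev info (N : ℕ) (E F G : Type*) [MeasurableSpace E] [MeasurableSpace F] [MeasurableSpace G]
    (t : ℕ) : MeasurableSpace (ℕ → Shock N E F G) :=
  MeasurableSpace.comap (fun ω (i : Fin t) => ω i) inferInstance

/-- The Markov chain `Z_t` started at `Z₀ = z`. -/
def state (z : Fin N) (ω : ℕ → Shock N E F G) : ℕ → Fin N
  | 0 => z
  | t + 1 => (ω t).1

namespace Environment

variable (M : Environment N E F G)

/-- `β_{t+1}` as a function of the shock of period `t + 1`. -/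
def discount (s : Shock N E F G) : ℝ := M.β s.1 s.2.1

/-- `R_{t+1}` as a function of the shock of period `t + 1`. -/
def ret (s : Shock N E F G) : ℝ := M.R s.1 s.2.2.1

/-- `Y_{t+1}` as a function of the shock of period `t + 1`. -/
def income (s : Shock N E F G) : ℝ := M.Y s.1 s.2.2.2

/-- `∏_{i=0}^t β_i` with `β₀ = 1`. -/
def cumDiscount (t : ℕ) (ω : ℕ → Shock N E F G) : ℝ :=
  ∏ i ∈ Finset.range t, M.discount (ω i)

/-- The wealth `a_t` under the consumption process `p`: `a₀ = a` and
`a_{t+1} = R_{t+1} (a_t - c_t) + Y_{t+1}`. -/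
def wealth (a : ℝ) (p : Plan N E F G) : ℕ → (ℕ → Shock N E F G) → ℝ
  | 0, _ => a
  | t + 1, ω => M.ret (ω t) * (wealth a p t ω - p t ω) + M.income (ω t)

/-- Adapted consumption processes with `0 ≤ c_t ≤ a_t`. -/
def IsFeasible (a : ℝ) (p : Plan N E F G) : Prop :=
  ∀ t, Measurable[info N E F G t] (p t) ∧ ∀ ω, 0 ≤ p t ω ∧ p t ω ≤ M.wealth a p t ω

/-- The objective `E_z ∑_t (∏_{i ≤ t} β_i) u(c_t)` as the difference of the contributions of the
positive and of the negative part of `u`. -/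
def value (u : ℝ → EReal) (z : Fin N) (p : Plan N E F G) : EReal :=
  ((∫⁻ ω, ∑' t, ENNReal.ofReal (M.cumDiscount t ω) * (u (p t ω)).toENNReal ∂(M.law z) : ℝ≥0∞) :
      EReal) -
    ((∫⁻ ω, ∑' t, ENNReal.ofReal (M.cumDiscount t ω) * (-u (p t ω)).toENNReal ∂(M.law z) : ℝ≥0∞) :
      EReal)

/-- `p` solves the income fluctuation problem with initial wealth `a` and initial state `z`. -/
def IsSolution (u : ℝ → EReal) (a : ℝ) (z : Fin N) (p : Plan N E F G) : Prop :=
  M.IsFeasible a p ∧ ∀ q, M.IsFeasible a q → M.value u z q ≤ M.value u z p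

/-- The wealth `a_t` if consumption is `c(a_t, Z_t)` in every period. -/
def policyWealth (c : ℝ → Fin N → ℝ) (a : ℝ) (z : Fin N) (ω : ℕ → Shock N E F G) : ℕ → ℝ
  | 0 => a
  | t + 1 => M.ret (ω t) * (policyWealth c a z ω t - c (policyWealth c a z ω t) (state z ω t)) +
      M.income (ω t)

/-- The consumption process `c_t = c(a_t, Z_t)`. -/
def policyPlan (c : ℝ → Fin N → ℝ) (a : ℝ) (z : Fin N) : Plan N E F G :=
  fun t ω => c (M.policyWealth c a z ω t) (state z ω t)

/-- `c` is the consumption function: from every initial wealth `a > 0` and every initial state,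
consuming `c(a_t, Z_t)` in every period solves the income fluctuation problem. -/
def IsConsumptionFunction (u : ℝ → EReal) (c : ℝ → Fin N → ℝ) : Prop :=
  ∀ a, 0 < a → ∀ z, M.IsSolution u a z (M.policyPlan c a z)

/-! ### The assumptions on the environment -/

/-- Finite moments `E_z β`, `E_z β R`, `E_z Y`, `E_z u'(Y)` for all `z`, and
`r(P D_β) < 1`, `r(P D_{βR}) < 1`. -/
structure IsSpectral (u : ℝ → EReal) : Prop where
  integrable_β : ∀ z, Integrable (M.β z) M.lawε
  integrable_βR : ∀ z,
    Integrable (fun p : E × F => M.β z p.1 * M.R z p.2) (M.lawε.prod M.lawζ)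
  specRad_β : specRad (M.PD fun z e _ => M.β z e) < 1
  specRad_βR : specRad (M.PD fun z e f => M.β z e * M.R z f) < 1
  integrable_Y : ∀ z, Integrable (M.Y z) M.lawη
  lintegral_marginal : ∀ z, ∫⁻ g, extMarginal u (M.Y z g) ∂M.lawη < ⊤

/-- There is `δ > 0` with `R ∈ {0} ∪ [δ, ∞)` almost surely. -/
def ReturnGap : Prop :=
  ∃ δ : ℝ, 0 < δ ∧ ∀ z, ∀ᵐ f ∂M.lawζ, M.R z f = 0 ∨ δ ≤ M.R z f

end Environment

end IncomeFluctuation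

end

/-! Put v = x^(1/γ) and K = P D. Then F x = x becomes v = 1 + (K v^γ)^(1/γ), the fixed point
equation of `rootMap`, and the claim becomes c(a, z)/a → 1/v(z). The map `rootMap` is monotone, and
`rootMap` minus 1 is homogeneous of degree one. If K w ≤ θ w with w ≥ 1 and θ < 1, a multiple of
w^(1/γ) is a supersolution, so the iterates from 1 increase to a fixed point (`exists_rootMap_eq`).
Homogeneity then draws the iterates from every starting vector ≥ 1 to the same limit
(`tendsto_iterate_rootMap`), which also gives uniqueness.

The economic input is the Euler equation: u'(c(a, z)) is at least the expectation of β R u'(c) in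
the next period, with equality if c(a, z) < a. Nothing is known about c except that its plans are
optimal, so both halves come from perturbing a plan. Saving h for one period gives
`lintegral_nextMarginal_le`. For `le_lintegral_nextMarginal`, h more is consumed today; it is paid
back next period where consumption then allows it, and elsewhere it is rolled over, consumption
being cut only when wealth runs short. Wealth never falls below current income, so a unit of rolled
over debt costs at most a discounted sum of terms β R u'(Y), whose mean is finite because r(P
D_{βR}) < 1 and E u'(Y) < ∞.

Suppose that c(a, z) is asymptotically at most, or at least, a/v(z) in every state. Dividing the
Euler equation by u'(a) and using regular variation as a → ∞ replaces v by `rootMap` v. For upper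
bounds Fatou's lemma is enough (`eventually_mul_le`). For lower bounds dominated convergence is
used, and the gap in R supplies the dominating function and keeps next period's wealth large
(`eventually_le_mul`).

The upper bounds start from c ≤ a. The lower ones need some bound c ≥ m(z) a to start from; by a
comparison argument (`mul_le`) it is enough that m(z) a is a supersolution of the Euler equation.
With constant relative risk aversion m is a small multiple of w^(-1/γ), with bounded risk aversion a
small constant. Iterating both bounds squeezes c(a, z)/a to 1/v(z). -/

noncomputable section

namespace IncomeFluctuation

/-! ### Concavity of utility and bounds in terms of marginal utility -/

namespace IsInada

variable {u : ℝ → EReal} (hu : IsInada u)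
include hu

lemma hasDerivAt {x : ℝ} (hx : 0 < x) :
    HasDerivAt (fun c => (u c).toReal) (marginal u x) x :=
  ((hu.contDiffOn.contDiffAt (Ioi_mem_nhds hx)).differentiableAt (by norm_num)).hasDerivAt

lemma differentiableAt_marginal {x : ℝ} (hx : 0 < x) : DifferentiableAt ℝ (marginal u) x := by
  have h : ContDiffOn ℝ 1 (marginal u) (Set.Ioi 0) :=
    hu.contDiffOn.deriv_of_isOpen isOpen_Ioi (by norm_num)
  exact (h.contDiffAt (Ioi_mem_nhds hx)).differentiableAt (by norm_num)

lemma continuousAt_marginal {x : ℝ} (hx : 0 < x) : ContinuousAt (marginal u) x :=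
  (hu.differentiableAt_marginal hx).continuousAt

lemma strictAntiOn_marginal : StrictAntiOn (marginal u) (Set.Ioi 0) := by
  refine strictAntiOn_of_deriv_neg (convex_Ioi 0)
    (fun _ hx => (hu.continuousAt_marginal hx).continuousWithinAt) fun x hx => ?_
  rw [interior_Ioi] at hx
  exact hu.deriv_marginal_neg x hx

lemma marginal_le {x y : ℝ} (hx : 0 < x) (hxy : x ≤ y) : marginal u y ≤ marginal u x :=
  hu.strictAntiOn_marginal.antitoneOn hx (hx.trans_le hxy) hxy

lemma lt_of_marginal_lt {x y : ℝ} (hy : 0 < y) (h : marginal u y < marginal u x) :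
    x < y := by
  by_contra! hle
  exact absurd (hu.marginal_le hy hle) (not_le.2 h)

/-- A concave function lies below its tangents. -/
lemma toReal_le_add {x y : ℝ} (hx : 0 < x) (hy : 0 < y) :
    (u y).toReal ≤ (u x).toReal + marginal u x * (y - x) := by
  have hcont : ContinuousOn (fun c => (u c).toReal) (Set.Ioi 0) := hu.contDiffOn.continuousOn
  have hconc : ConcaveOn ℝ (Set.Ioi 0) (fun c => (u c).toReal) := by
    refine AntitoneOn.concaveOn_of_deriv (convex_Ioi 0) hcont ?_ ?_
    · rw [interior_Ioi]
      exact fun x hx => (hu.hasDerivAt hx).differentiableAt.differentiableWithinAt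
    · rw [interior_Ioi]
      exact hu.strictAntiOn_marginal.antitoneOn
  rcases lt_trichotomy x y with h | h | h
  · have := hconc.slope_le_of_hasDerivAt hx hy h (hu.hasDerivAt hx)
    rw [slope_def_field, div_le_iff₀ (by linarith)] at this
    linarith
  · simp [h]
  · have := hconc.le_slope_of_hasDerivAt hy hx h (hu.hasDerivAt hx)
    rw [slope_def_field, le_div_iff₀ (by linarith)] at this
    linarith

lemma coe_toReal {x : ℝ} (hx : 0 < x) : (((u x).toReal : ℝ) : EReal) = u x :=
  EReal.coe_toReal (hu.ne_top x hx) (hu.ne_bot x hx)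

lemma toENNReal_eq {x : ℝ} (hx : 0 < x) :
    (u x).toENNReal = ENNReal.ofReal (u x).toReal := by
  rw [← hu.coe_toReal hx, EReal.toReal_coe, EReal.toENNReal_of_ne_top (by simp)]; simp

lemma toENNReal_neg_eq {x : ℝ} (hx : 0 < x) :
    (-u x).toENNReal = ENNReal.ofReal (-(u x).toReal) := by
  rw [← hu.coe_toReal hx, EReal.toReal_coe, ← EReal.coe_neg, EReal.toENNReal_of_ne_top (by simp)]
  simp

lemma mono {x y : ℝ} (hx : 0 ≤ x) (hxy : x ≤ y) : u x ≤ u y := by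
  rcases hx.eq_or_lt with rfl | hx
  · rcases hxy.eq_or_lt with rfl | hy
    · exact le_rfl
    · exact hu.zero_le y hy
  · have hy := hx.trans_le hxy
    rw [← hu.coe_toReal hx, ← hu.coe_toReal hy, EReal.coe_le_coe_iff]
    have h1 := hu.toReal_le_add hy hx
    have h2 := mul_nonneg (hu.marginal_pos y hy).le (sub_nonneg.2 hxy)
    nlinarith

/-- Only the values of `u` on [0, ∞) are constrained. Truncating the argument at 0 makes the
function monotone on all of ℝ, hence measurable. -/
lemma measurable_comp_max : Measurable fun x => u (max x 0) :=
  Monotone.measurable fun _ _ h => hu.mono (le_max_right _ _) (max_le_max_right _ h)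

-- The inequality p + d ≤ q with every positive and negative part on the side where its sign is
-- plus. Utility may be -∞ and expected sums may be infinite, so differences have to be avoided
-- until finiteness is known.
omit hu in
lemma ofReal_add_le {p q d : ℝ} (hd : 0 ≤ d) (h : p + d ≤ q) :
    ENNReal.ofReal p + ENNReal.ofReal (-q) + ENNReal.ofReal d ≤
      ENNReal.ofReal q + ENNReal.ofReal (-p) := by
  rw [ENNReal.ofReal, ENNReal.ofReal, ENNReal.ofReal, ENNReal.ofReal, ENNReal.ofReal]
  norm_cast
  rw [← NNReal.coe_le_coe]
  push_cast [Real.coe_toNNReal']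
  rcases max_cases q 0 with h1 | h1 <;> rcases max_cases (-p) 0 with h2 | h2 <;>
    rcases max_cases p 0 with h3 | h3 <;> rcases max_cases (-q) 0 with h4 | h4 <;>
    rcases max_cases d 0 with h5 | h5 <;> linarith

omit hu in
lemma ofReal_le_add {p q d : ℝ} (hd : 0 ≤ d) (h : q ≤ p + d) :
    ENNReal.ofReal q + ENNReal.ofReal (-p) ≤
      ENNReal.ofReal p + ENNReal.ofReal (-q) + ENNReal.ofReal d := by
  rw [ENNReal.ofReal, ENNReal.ofReal, ENNReal.ofReal, ENNReal.ofReal, ENNReal.ofReal]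
  norm_cast
  rw [← NNReal.coe_le_coe]
  push_cast [Real.coe_toNNReal']
  rcases max_cases q 0 with h1 | h1 <;> rcases max_cases (-p) 0 with h2 | h2 <;>
    rcases max_cases p 0 with h3 | h3 <;> rcases max_cases (-q) 0 with h4 | h4 <;>
    rcases max_cases d 0 with h5 | h5 <;> linarith

/-- Raising consumption from `y` to `x` gains at least `u'(x) (x - y)`, stated with the positive
and the negative part of utility kept apart. -/
lemma gain {x y : ℝ} (hy : 0 ≤ y) (hx : 0 < x) (hyx : y ≤ x) :
    (u y).toENNReal + (-u x).toENNReal + ENNReal.ofReal (marginal u x * (x - y)) ≤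
      (u x).toENNReal + (-u y).toENNReal := by
  have hf := hu.marginal_pos x hx
  rcases hy.eq_or_lt with rfl | hy
  · by_cases hbot : u 0 = ⊥
    · simp [hbot]
    have hle : u 0 ≤ u x := hu.zero_le x hx
    have htop : u 0 ≠ ⊤ := fun h => hu.ne_top x hx (top_le_iff.1 (h ▸ hle))
    obtain ⟨r, hr⟩ : ∃ r : ℝ, u 0 = r := ⟨_, (EReal.coe_toReal htop hbot).symm⟩
    rw [hu.toENNReal_eq hx, hu.toENNReal_neg_eq hx, hr, EReal.toENNReal_of_ne_top (by simp),
      ← EReal.coe_neg, EReal.toENNReal_of_ne_top (by simp), EReal.toReal_coe, EReal.toReal_coe]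
    refine ofReal_add_le (by nlinarith) ?_
    have hlim : Tendsto (fun t => (u x).toReal - marginal u x * (x - t)) (𝓝[>] 0)
        (𝓝 ((u x).toReal - marginal u x * (x - 0))) := by
      refine Tendsto.mono_left (Continuous.tendsto (by fun_prop) _) nhdsWithin_le_nhds
    have : r ≤ (u x).toReal - marginal u x * (x - 0) := by
      refine ge_of_tendsto hlim ?_
      filter_upwards [self_mem_nhdsWithin] with t ht
      have h1 : r ≤ (u t).toReal := by
        have := hu.zero_le t ht
        rwa [hr, ← hu.coe_toReal ht, EReal.coe_le_coe_iff] at this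
      have h2 := hu.toReal_le_add hx ht
      linarith
    linarith
  · rw [hu.toENNReal_eq hx, hu.toENNReal_neg_eq hx, hu.toENNReal_eq hy, hu.toENNReal_neg_eq hy]
    refine ofReal_add_le (mul_nonneg hf.le (sub_nonneg.2 hyx)) ?_
    have := hu.toReal_le_add hx hy
    linarith

/-- Lowering consumption from `y` to `x` loses at most `u'(x) (y - x)`. -/
lemma loss {x y : ℝ} (hx : 0 < x) (hxy : x ≤ y) :
    (u y).toENNReal + (-u x).toENNReal ≤
      (u x).toENNReal + (-u y).toENNReal + ENNReal.ofReal (marginal u x * (y - x)) := by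
  have hf := hu.marginal_pos x hx
  have hy := hx.trans_le hxy
  rw [hu.toENNReal_eq hx, hu.toENNReal_neg_eq hx, hu.toENNReal_eq hy, hu.toENNReal_neg_eq hy]
  exact ofReal_le_add (mul_nonneg hf.le (sub_nonneg.2 hxy)) (hu.toReal_le_add hx hy)

/-- The tangent at 1 gives affine growth, so finite expected discounted wealth will bound the
positive part of the objective. -/
lemma toENNReal_le {x : ℝ} (hx : 0 ≤ x) :
    (u x).toENNReal ≤ ENNReal.ofReal (|(u 1).toReal| + marginal u 1 * x) := by
  have h1 := hu.marginal_pos 1 one_pos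
  have hle : ∀ y : ℝ, 0 < y →
      (u y).toENNReal ≤ ENNReal.ofReal (|(u 1).toReal| + marginal u 1 * y) := by
    intro y hy
    rw [hu.toENNReal_eq hy]
    refine ENNReal.ofReal_le_ofReal ?_
    have := hu.toReal_le_add one_pos hy
    have := le_abs_self (u 1).toReal
    nlinarith
  rcases hx.eq_or_lt with rfl | hx
  · have hlim : Tendsto (fun t => ENNReal.ofReal (|(u 1).toReal| + marginal u 1 * t)) (𝓝[>] 0)
        (𝓝 (ENNReal.ofReal (|(u 1).toReal| + marginal u 1 * 0))) := by
      refine ENNReal.tendsto_ofReal (Tendsto.mono_left (Continuous.tendsto (by fun_prop) _)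
        nhdsWithin_le_nhds)
    refine ge_of_tendsto hlim ?_
    filter_upwards [self_mem_nhdsWithin] with t ht
    exact (EReal.toENNReal_le_toENNReal (hu.zero_le t ht)).trans (hle t ht)
  · exact hle x hx

/-- From the tangent at x evaluated at 1, u(1) ≤ u(x) + u'(x)(1 - x). Through this bound E u'(Y) < ∞
controls the negative part of the objective. -/
lemma toENNReal_neg_le {x : ℝ} (hx : 0 < x) :
    (-u x).toENNReal ≤ ENNReal.ofReal |(u 1).toReal| + extMarginal u x := by
  have h1 := hu.marginal_pos x hx
  rw [hu.toENNReal_neg_eq hx, extMarginal, if_pos hx, ← ENNReal.ofReal_add (abs_nonneg _) h1.le]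
  refine ENNReal.ofReal_le_ofReal ?_
  have := hu.toReal_le_add hx one_pos
  have := neg_abs_le (u 1).toReal
  nlinarith

lemma measurable_extMarginal : Measurable (extMarginal u) := by
  refine Antitone.measurable fun x y hxy => ?_
  rw [extMarginal, extMarginal]
  by_cases hx : 0 < x
  · rw [if_pos hx, if_pos (hx.trans_le hxy)]
    exact ENNReal.ofReal_le_ofReal (hu.marginal_le hx hxy)
  · simp [hx]

end IsInada

end IncomeFluctuation

/-! ### Information, the Markov property and discounted sums along a path -/

namespace IncomeFluctuation

variable {N : ℕ} {E F G : Type*} [MeasurableSpace E] [MeasurableSpace F] [MeasurableSpace G]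

lemma info_le (t : ℕ) : info N E F G t ≤ MeasurableSpace.pi := by
  refine Measurable.comap_le ?_
  fun_prop

lemma measurable_info_eval {i t : ℕ} (h : i < t) :
    Measurable[info N E F G t] fun ω : ℕ → Shock N E F G => ω i := by
  have h1 : Measurable fun y : Fin t → Shock N E F G => y ⟨i, h⟩ := measurable_pi_apply _
  exact h1.comp (comap_measurable fun (ω : ℕ → Shock N E F G) (i : Fin t) => ω i)

lemma info_mono {s t : ℕ} (h : s ≤ t) : info N E F G s ≤ info N E F G t := by
  refine Measurable.comap_le ?_
  exact @measurable_pi_lambda _ _ _ (info N E F G t) _ _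
    fun i => measurable_info_eval (i.2.trans_le h)

lemma measurable_state (z : Fin N) (t : ℕ) :
    Measurable[info N E F G t] fun ω : ℕ → Shock N E F G => state z ω t := by
  cases t with
  | zero => exact @measurable_const _ _ _ (info N E F G 0) z
  | succ t => exact measurable_fst.comp (measurable_info_eval t.lt_succ_self)

namespace Environment

variable (M : Environment N E F G)

lemma measurable_discount : Measurable M.discount :=
  measurable_from_prod_countable_right fun z => (M.measurable_β z).comp measurable_fst

lemma measurable_ret : Measurable M.ret :=
  measurable_from_prod_countable_right fun z =>
    (M.measurable_R z).comp (measurable_fst.comp measurable_snd)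

lemma measurable_income : Measurable M.income :=
  measurable_from_prod_countable_right fun z =>
    (M.measurable_Y z).comp (measurable_snd.comp measurable_snd)

lemma discount_nonneg (s : Shock N E F G) : 0 ≤ M.discount s := M.β_nonneg _ _

lemma ret_nonneg (s : Shock N E F G) : 0 ≤ M.ret s := M.R_nonneg _ _

lemma income_nonneg (s : Shock N E F G) : 0 ≤ M.income s := M.Y_nonneg _ _

lemma cumDiscount_nonneg (t : ℕ) (ω : ℕ → Shock N E F G) : 0 ≤ M.cumDiscount t ω :=
  Finset.prod_nonneg fun _ _ => M.discount_nonneg _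

lemma measurable_cumDiscount (t : ℕ) : Measurable[info N E F G t] (M.cumDiscount t) :=
  Finset.measurable_fun_prod _ fun _ hi =>
    M.measurable_discount.comp (measurable_info_eval (Finset.mem_range.1 hi))

lemma lintegral_step (z : Fin N) {g : Shock N E F G → ℝ≥0∞} (hg : Measurable g) :
    ∫⁻ s, g s ∂M.step z = ∑ z', ENNReal.ofReal (M.P z z') *
      ∫⁻ p, g (z', p) ∂(M.lawε.prod (M.lawζ.prod M.lawη)) := by
  change ∫⁻ s, g s ∂((M.nextState z).prod (M.lawε.prod (M.lawζ.prod M.lawη))) = _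
  rw [lintegral_prod _ hg.aemeasurable, nextState, lintegral_finsetSum_measure]
  refine Finset.sum_congr rfl fun z' _ => ?_
  rw [lintegral_smul_measure, lintegral_dirac, smul_eq_mul]

instance (z : Fin N) : IsProbabilityMeasure (M.law z) := by
  unfold law; infer_instance

lemma map_eval_zero_law (z : Fin N) : (M.law z).map (fun ω => ω 0) = M.step z := by
  have h : (fun ω : ℕ → Shock N E F G => ω 0) =
      (MeasurableEquiv.piUnique (fun _ : Finset.Iic 0 => Shock N E F G)) ∘
        (Preorder.frestrictLe 0) := rfl
  rw [h, ← Measure.map_map (by fun_prop) (by fun_prop), law, Kernel.trajMeasure,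
    Measure.map_comp _ _ (by fun_prop), Kernel.traj_map_frestrictLe, Kernel.partialTraj_self,
    Measure.id_comp, MeasurableEquiv.map_map_symm]

lemma lintegral_law_zero (z : Fin N) {g : Shock N E F G → ℝ≥0∞} (hg : Measurable g) :
    ∫⁻ ω, g (ω 0) ∂M.law z = ∫⁻ s, g s ∂M.step z := by
  rw [← M.map_eval_zero_law z, lintegral_map hg (measurable_pi_apply 0)]

/-- The Markov property: given the information of period `t`, the shock of the next period has the
law `M.step Z_t`. -/
lemma lintegral_law_mul (z : Fin N) {t : ℕ} {H : (ℕ → Shock N E F G) → ℝ≥0∞}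
    (hH : Measurable[info N E F G t] H) {g : Shock N E F G → ℝ≥0∞} (hg : Measurable g) :
    ∫⁻ ω, H ω * g (ω t) ∂M.law z = ∫⁻ ω, H ω * ∫⁻ s, g s ∂M.step (state z ω t) ∂M.law z := by
  -- A function known in period t factors through the entries 0, …, t - 1 of the path; for t = 0 it
  -- is constant.
  obtain ⟨h, hh, rfl⟩ := hH.exists_eq_measurable_comp
  cases t with
  | zero =>
    have hconst : ∀ ω : ℕ → Shock N E F G,
        (h ∘ fun ω (i : Fin 0) => ω i) ω = h (fun i => i.elim0) := fun ω => by
      simp only [Function.comp_apply]; congr 1; funext i; exact i.elim0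
    simp_rw [hconst, state]
    rw [lintegral_const_mul _ (by fun_prop), M.lintegral_law_zero z hg,
      lintegral_const, measure_univ, mul_one]
  | succ n =>
    -- The entries before n + 1 are indexed by `Iic n`. Their joint law with entry n + 1 is a
    -- composition product with a kernel that depends on the state in entry n only, which is the
    -- Markov state of period n + 1.
    set φ : ((i : Finset.Iic n) → Shock N E F G) → (Fin (n + 1) → Shock N E F G) :=
      fun y i => y ⟨i, Finset.mem_Iic.2 (Nat.lt_succ_iff.1 i.2)⟩
    have hφ : Measurable φ := by fun_prop
    have hmap := Kernel.map_frestrictLe_trajMeasure_compProd_eq_map_trajMeasure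
      (X := fun _ => Shock N E F G) (μ₀ := M.step z) (κ := fun n =>
        M.step.comap (fun h : (i : Finset.Iic n) → Shock N E F G =>
          (h ⟨n, Finset.mem_Iic.2 le_rfl⟩).1) (by fun_prop)) (a := n)
    have hm : Measurable fun q : ((i : Finset.Iic n) → Shock N E F G) × Shock N E F G =>
        h (φ q.1) * g q.2 := by fun_prop
    have h1 := lintegral_map (μ := M.law z) hm
      (g := fun x => (Preorder.frestrictLe n x, x (n + 1))) (by fun_prop)
    have h2 : ∫⁻ ω, (h ∘ fun ω (i : Fin (n + 1)) => ω i) ω * g (ω (n + 1)) ∂M.law z =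
        ∫⁻ q, h (φ q.1) * g q.2
          ∂((M.law z).map fun x => (Preorder.frestrictLe n x, x (n + 1))) := h1.symm
    rw [h2]
    have h3 : (M.law z).map (fun x => (Preorder.frestrictLe n x, x (n + 1))) = _ := hmap.symm
    rw [h3, Measure.lintegral_compProd hm]
    have hs : Measurable fun z' : Fin N => ∫⁻ s, g s ∂M.step z' := measurable_of_finite _
    have h4 : ∀ y : (i : Finset.Iic n) → Shock N E F G,
        ∫⁻ s, h (φ y) * g s ∂(M.step.comap (fun h : (i : Finset.Iic n) → Shock N E F G =>
          (h ⟨n, Finset.mem_Iic.2 le_rfl⟩).1) (by fun_prop) y) =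
          h (φ y) * ∫⁻ s, g s ∂M.step (y ⟨n, Finset.mem_Iic.2 le_rfl⟩).1 := fun y => by
      rw [lintegral_const_mul _ hg, Kernel.comap_apply]
    simp_rw [h4]
    rw [lintegral_map (by fun_prop) (by fun_prop)]
    rfl

/-- A property of one-period shocks that holds almost surely in every state holds almost surely in
every period. -/
lemma ae_law_of_ae_step (z : Fin N) {S : Set (Shock N E F G)} (hS : MeasurableSet S)
    (h : ∀ z, M.step z Sᶜ = 0) : ∀ᵐ ω ∂M.law z, ∀ t, ω t ∈ S := by
  rw [ae_all_iff]
  intro t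
  have := M.lintegral_law_mul z (t := t) (H := fun _ => 1) (@measurable_const _ _ _ (_) _)
    (g := Sᶜ.indicator 1) (measurable_one.indicator hS.compl)
  simp only [one_mul, lintegral_indicator_one hS.compl, h, lintegral_zero] at this
  have hm : Measurable fun ω : ℕ → Shock N E F G => Sᶜ.indicator (1 : Shock N E F G → ℝ≥0∞) (ω t) :=
    (measurable_one.indicator hS.compl).comp (measurable_pi_apply t)
  rw [lintegral_eq_zero_iff hm] at this
  filter_upwards [this] with ω hω
  by_contra hc
  simp [Set.indicator, hc] at hω

/-- If `E_z k(s) w(Z) ≤ θ w(z)`, then the expected product of `t` factors `k`, weighted by `w`,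
is at most `θ ^ t w(z)`. -/
lemma lintegral_prod_mul_le {k : Shock N E F G → ℝ≥0∞} (hk : Measurable k) {w : Fin N → ℝ≥0∞}
    {θ : ℝ≥0∞} (hw : ∀ z, ∫⁻ s, k s * w s.1 ∂M.step z ≤ θ * w z) (z : Fin N) (t : ℕ) :
    ∫⁻ ω, (∏ i ∈ Finset.range t, k (ω i)) * w (state z ω t) ∂M.law z ≤ θ ^ t * w z := by
  induction t with
  | zero => simp [state]
  | succ t ih =>
    have hwm : Measurable w := measurable_of_finite _
    have hprod : Measurable[info N E F G t] fun ω : ℕ → Shock N E F G =>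
        ∏ i ∈ Finset.range t, k (ω i) :=
      Finset.measurable_fun_prod _ fun _ hi =>
        hk.comp (measurable_info_eval (Finset.mem_range.1 hi))
    calc ∫⁻ ω, (∏ i ∈ Finset.range (t + 1), k (ω i)) * w (state z ω (t + 1)) ∂M.law z
        = ∫⁻ ω, (∏ i ∈ Finset.range t, k (ω i)) * (k (ω t) * w (ω t).1) ∂M.law z := by
          simp_rw [Finset.prod_range_succ, state, mul_assoc]
      _ = ∫⁻ ω, (∏ i ∈ Finset.range t, k (ω i)) *
            ∫⁻ s, k s * w s.1 ∂M.step (state z ω t) ∂M.law z :=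
          M.lintegral_law_mul z hprod (hk.mul (hwm.comp measurable_fst))
      _ ≤ ∫⁻ ω, θ * ((∏ i ∈ Finset.range t, k (ω i)) * w (state z ω t)) ∂M.law z := by
          refine lintegral_mono fun ω => ?_
          rw [mul_left_comm]
          gcongr
          exact hw _
      _ ≤ θ ^ (t + 1) * w z := by
          rw [lintegral_const_mul, pow_succ', mul_assoc]
          · gcongr
          · exact ((hprod.mono (info_le t) le_rfl)).mul
              (hwm.comp ((measurable_state z t).mono (info_le t) le_rfl))

/-- The discounted sum of a one-period quantity with bounded mean is integrable. -/
lemma lintegral_tsum_prod_mul_le {k : Shock N E F G → ℝ≥0∞} (hk : Measurable k)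
    {w : Fin N → ℝ≥0∞} {θ : ℝ≥0∞} (hw : ∀ z, ∫⁻ s, k s * w s.1 ∂M.step z ≤ θ * w z)
    {g : Shock N E F G → ℝ≥0∞} (hg : Measurable g) {C : ℝ≥0∞}
    (hC : ∀ z, ∫⁻ s, g s ∂M.step z ≤ C * w z) (z : Fin N) :
    ∫⁻ ω, ∑' t, (∏ i ∈ Finset.range t, k (ω i)) * g (ω t) ∂M.law z ≤ C * (1 - θ)⁻¹ * w z := by
  have hwm : Measurable w := measurable_of_finite _
  have hprod : ∀ t, Measurable[info N E F G t] fun ω : ℕ → Shock N E F G =>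
      ∏ i ∈ Finset.range t, k (ω i) := fun t =>
    Finset.measurable_fun_prod _ fun _ hi =>
      hk.comp (measurable_info_eval (Finset.mem_range.1 hi))
  have hprod' := fun t => (hprod t).mono (info_le t) le_rfl
  rw [lintegral_tsum fun t => by have := hprod' t; fun_prop]
  calc ∑' t, ∫⁻ ω, (∏ i ∈ Finset.range t, k (ω i)) * g (ω t) ∂M.law z
      ≤ ∑' t, C * (θ ^ t * w z) := by
        refine ENNReal.tsum_le_tsum fun t => ?_
        rw [M.lintegral_law_mul z (hprod t) hg]
        calc _ ≤ ∫⁻ ω, C * ((∏ i ∈ Finset.range t, k (ω i)) * w (state z ω t)) ∂M.law z := by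
              refine lintegral_mono fun ω => ?_
              rw [mul_left_comm]
              gcongr
              exact hC _
          _ ≤ _ := by
              rw [lintegral_const_mul]
              · gcongr
                exact M.lintegral_prod_mul_le hk hw z t
              · exact (hprod' t).mul (hwm.comp ((measurable_state z t).mono (info_le t) le_rfl))
    _ = C * (1 - θ)⁻¹ * w z := by
        rw [ENNReal.tsum_mul_left, ENNReal.tsum_mul_right, ENNReal.tsum_geometric, mul_assoc]

end Environment

end IncomeFluctuation

/-! ### Nonnegative matrices and the fixed point map -/

namespace IncomeFluctuation

variable {N : ℕ}

section Weight

attribute [local instance] Matrix.linftyOpNormedRing Matrix.linftyOpNormedAlgebra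

/-- A matrix with spectral radius below one has a power whose row sums are small. -/
lemma exists_pow_mulVec_one_le (A : Matrix (Fin N) (Fin N) ℝ) (h : specRad A < 1) :
    ∃ θ : ℝ, 0 < θ ∧ θ < 1 ∧ ∃ n, 0 < n ∧
      ∀ z, ((A ^ n).mulVec fun _ => 1) z ≤ θ ^ n := by
  obtain ⟨r, hr1, hr2⟩ := exists_between h
  obtain ⟨θ, rfl⟩ : ∃ θ : NNReal, r = θ := ⟨r.toNNReal, (ENNReal.coe_toNNReal hr2.ne_top).symm⟩
  have hθ0 : 0 < θ := by
    have := bot_le.trans_lt hr1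
    simpa using this
  have hθ1 : θ < 1 := by simpa using hr2
  -- Gelfand's formula for the ℓ∞ operator norm of the complexified matrix: for some n > 0 the norm
  -- of the n-th power is at most θ^n, and this norm bounds the row sums.
  have hG := spectrum.pow_nnnorm_pow_one_div_tendsto_nhds_spectralRadius
    (A.map ((↑) : ℝ → ℂ))
  obtain ⟨n, hn, hn0⟩ := ((hG.eventually_lt_const hr1).and (eventually_gt_atTop 0)).exists
  refine ⟨θ, hθ0, by exact_mod_cast hθ1, n, hn0, fun z => ?_⟩
  have hn' : ‖(A.map ((↑) : ℝ → ℂ)) ^ n‖₊ ≤ θ ^ n := by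
    have h1 := ENNReal.rpow_le_rpow hn.le (Nat.cast_nonneg n : (0 : ℝ) ≤ n)
    rw [← ENNReal.rpow_mul, one_div_mul_cancel (by positivity), ENNReal.rpow_one,
      ENNReal.rpow_natCast] at h1
    exact_mod_cast h1
  have hmap : (A.map ((↑) : ℝ → ℂ)) ^ n = (A ^ n).map ((↑) : ℝ → ℂ) :=
    ((Complex.ofRealHom.mapMatrix (m := Fin N)).map_pow A n).symm
  have hle := Matrix.linfty_opNorm_mulVec ((A.map ((↑) : ℝ → ℂ)) ^ n) (fun _ => (1 : ℂ))
  have hz := norm_le_pi_norm (((A.map ((↑) : ℝ → ℂ)) ^ n).mulVec (fun _ => (1 : ℂ))) z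
  have h1 : ‖(fun _ : Fin N => (1 : ℂ))‖ ≤ 1 :=
    (pi_norm_le_iff_of_nonneg zero_le_one).2 fun _ => by simp
  have heq : ((A.map ((↑) : ℝ → ℂ)) ^ n).mulVec (fun _ => (1 : ℂ)) z =
      (((A ^ n).mulVec fun _ => 1) z : ℝ) := by
    rw [hmap]
    simp [Matrix.mulVec, dotProduct]
  calc ((A ^ n).mulVec fun _ => 1) z ≤ |((A ^ n).mulVec fun _ => 1) z| := le_abs_self _
    _ = ‖((A.map ((↑) : ℝ → ℂ)) ^ n).mulVec (fun _ => (1 : ℂ)) z‖ := by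
        rw [heq, Complex.norm_real, Real.norm_eq_abs]
    _ ≤ ‖(A.map ((↑) : ℝ → ℂ)) ^ n‖ * 1 := hz.trans (hle.trans (by gcongr))
    _ ≤ θ ^ n := by rw [mul_one]; exact_mod_cast hn'

end Weight

lemma mulVec_mono {A : Matrix (Fin N) (Fin N) ℝ} (hA : ∀ i j, 0 ≤ A i j) {x y : Fin N → ℝ}
    (h : ∀ z, x z ≤ y z) (z : Fin N) : A.mulVec x z ≤ A.mulVec y z := by
  unfold Matrix.mulVec dotProduct
  exact Finset.sum_le_sum fun j _ => mul_le_mul_of_nonneg_left (h j) (hA z j)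

lemma mulVec_nonneg {A : Matrix (Fin N) (Fin N) ℝ} (hA : ∀ i j, 0 ≤ A i j) {x : Fin N → ℝ}
    (h : ∀ z, 0 ≤ x z) (z : Fin N) : 0 ≤ A.mulVec x z := by
  unfold Matrix.mulVec dotProduct
  exact Finset.sum_nonneg fun j _ => mul_nonneg (hA z j) (h j)

/-- A nonnegative matrix with spectral radius below one contracts a weighted supremum norm. -/
lemma exists_weight {A : Matrix (Fin N) (Fin N) ℝ} (hA : ∀ i j, 0 ≤ A i j) (h : specRad A < 1) :
    ∃ (w : Fin N → ℝ) (θ : ℝ), (∀ z, 1 ≤ w z) ∧ 0 < θ ∧ θ < 1 ∧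
      ∀ z, A.mulVec w z ≤ θ * w z := by
  obtain ⟨θ, hθ0, hθ1, m, hm0, hm⟩ := exists_pow_mulVec_one_le A h
  have hpow : ∀ k z, 0 ≤ ((A ^ k).mulVec fun _ => 1) z := by
    intro k
    induction k with
    | zero => intro z; simp
    | succ k ih =>
      intro z
      rw [pow_succ', ← Matrix.mulVec_mulVec]
      exact mulVec_nonneg hA ih z
  -- A truncated Neumann series: the sum of θ^(-k) A^k 1 over k < m. Applying A shifts the series,
  -- so A w = θ (w + θ^(-m) A^m 1 - 1), which is at most θ w because A^m 1 ≤ θ^m.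
  set w : ℕ → Fin N → ℝ := fun m => ∑ k ∈ Finset.range m, (θ⁻¹) ^ k • (A ^ k).mulVec fun _ => 1
  have hrec : ∀ m, A.mulVec (w m) =
      θ • (w m + (θ⁻¹) ^ m • ((A ^ m).mulVec fun _ => 1) - fun _ => 1) := by
    intro m
    induction m with
    | zero =>
      simp only [w, Finset.range_zero, Finset.sum_empty, Matrix.mulVec_zero]
      ext z; simp
    | succ m ih =>
      simp only [w] at ih ⊢
      rw [Finset.sum_range_succ, Matrix.mulVec_add, ih, Matrix.mulVec_smul, Matrix.mulVec_mulVec,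
        ← pow_succ']
      ext z
      simp only [Pi.add_apply, Pi.smul_apply, Pi.sub_apply, smul_eq_mul, pow_succ]
      field_simp
      ring
  refine ⟨w m, θ, fun z => ?_, hθ0, hθ1, fun z => ?_⟩
  · simp only [w, Finset.sum_apply, Pi.smul_apply, smul_eq_mul]
    calc (1 : ℝ) = (θ⁻¹) ^ 0 * ((A ^ 0).mulVec fun _ => 1) z := by simp
      _ ≤ _ := Finset.single_le_sum (f := fun k => (θ⁻¹) ^ k * ((A ^ k).mulVec fun _ => 1) z)
          (fun k _ => mul_nonneg (by positivity) (hpow k z)) (Finset.mem_range.2 hm0)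
  · rw [hrec]
    simp only [Pi.add_apply, Pi.smul_apply, Pi.sub_apply, smul_eq_mul]
    have : (θ⁻¹) ^ m * ((A ^ m).mulVec fun _ => 1) z ≤ 1 := by
      rw [inv_pow, inv_mul_le_iff₀ (by positivity), mul_one]
      exact hm z
    gcongr
    linarith

/-- The map `v ↦ 1 + (A v ^ γ) ^ (1 / γ)`, conjugate to `x ↦ (1 + (A x) ^ (1 / γ)) ^ γ`. -/
def rootMap (A : Matrix (Fin N) (Fin N) ℝ) (γ : ℝ) (v : Fin N → ℝ) (z : Fin N) : ℝ :=
  1 + (A.mulVec (fun j => v j ^ γ) z) ^ (1 / γ)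

section RootMap

variable {A : Matrix (Fin N) (Fin N) ℝ} {γ : ℝ}

lemma mulVec_rpow_nonneg (hA : ∀ i j, 0 ≤ A i j) {v : Fin N → ℝ} (hv : ∀ z, 0 ≤ v z)
    (z : Fin N) : 0 ≤ A.mulVec (fun j => v j ^ γ) z :=
  mulVec_nonneg hA (fun j => Real.rpow_nonneg (hv j) _) z

lemma one_le_rootMap (hA : ∀ i j, 0 ≤ A i j) {v : Fin N → ℝ} (hv : ∀ z, 0 ≤ v z) (z : Fin N) :
    1 ≤ rootMap A γ v z :=
  le_add_of_nonneg_right (Real.rpow_nonneg (mulVec_rpow_nonneg hA hv z) _)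

lemma rootMap_mono (hA : ∀ i j, 0 ≤ A i j) (hγ : 0 < γ) {v w : Fin N → ℝ} (hv : ∀ z, 0 ≤ v z)
    (h : ∀ z, v z ≤ w z) (z : Fin N) : rootMap A γ v z ≤ rootMap A γ w z := by
  unfold rootMap
  gcongr
  · exact mulVec_rpow_nonneg hA hv z
  · exact mulVec_mono hA (fun j => Real.rpow_le_rpow (hv j) (h j) hγ.le) z

/-- The powers γ and 1/γ cancel on scalars, so `rootMap` minus 1 is homogeneous of degree one. This
yields the supersolution, the contraction towards the fixed point, and the room for small
perturbations of v in the asymptotic bounds. -/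
lemma rootMap_smul (hA : ∀ i j, 0 ≤ A i j) (hγ : 0 < γ) {v : Fin N → ℝ} (hv : ∀ z, 0 ≤ v z)
    {μ : ℝ} (hμ : 0 ≤ μ) (z : Fin N) :
    rootMap A γ (fun j => μ * v j) z = 1 + μ * (rootMap A γ v z - 1) := by
  have h : (fun j => (μ * v j) ^ γ) = μ ^ γ • fun j => v j ^ γ := by
    ext j; simp [Real.mul_rpow hμ (hv j)]
  unfold rootMap
  rw [h, Matrix.mulVec_smul, Pi.smul_apply, smul_eq_mul,
    Real.mul_rpow (Real.rpow_nonneg hμ _) (mulVec_rpow_nonneg hA hv z), ← Real.rpow_mul hμ,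
    mul_one_div_cancel hγ.ne', Real.rpow_one]
  ring

lemma continuous_rootMap (hγ : 0 < γ) : Continuous (rootMap A γ) := by
  refine continuous_pi fun z => continuous_const.add ?_
  have h : Continuous fun v : Fin N → ℝ => A.mulVec (fun j => v j ^ γ) z := by
    unfold Matrix.mulVec dotProduct
    refine continuous_finsetSum _ fun j _ => continuous_const.mul ?_
    exact (continuous_apply j).rpow_const fun _ => Or.inr hγ.le
  exact h.rpow_const fun _ => Or.inr (by positivity)

lemma iterate_rootMap_mono (hA : ∀ i j, 0 ≤ A i j) (hγ : 0 < γ) (n : ℕ) {v w : Fin N → ℝ}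
    (hv : ∀ z, 0 ≤ v z) (h : ∀ z, v z ≤ w z) :
    ∀ z, 0 ≤ (rootMap A γ)^[n] v z ∧ (rootMap A γ)^[n] v z ≤ (rootMap A γ)^[n] w z := by
  induction n with
  | zero => exact fun z => ⟨hv z, h z⟩
  | succ n ih =>
    intro z
    simp only [Function.iterate_succ_apply']
    exact ⟨zero_le_one.trans (one_le_rootMap hA (fun j => (ih j).1) z),
      rootMap_mono hA hγ (fun j => (ih j).1) (fun j => (ih j).2) z⟩

/-- `rootMap A γ` has a fixed point to which its iterates from `1` converge. -/
lemma exists_rootMap_eq (hA : ∀ i j, 0 ≤ A i j) (hγ : 0 < γ) {w : Fin N → ℝ} {θ : ℝ}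
    (hw : ∀ z, 1 ≤ w z) (hθ0 : 0 < θ) (hθ1 : θ < 1) (hAw : ∀ z, A.mulVec w z ≤ θ * w z) :
    ∃ v : Fin N → ℝ, (∀ z, 1 ≤ v z) ∧ rootMap A γ v = v ∧
      Tendsto (fun n => (rootMap A γ)^[n] fun _ => 1) atTop (𝓝 v) := by
  set κ := θ ^ (1 / γ)
  have hκ0 : 0 ≤ κ := by positivity
  have hκ1 : κ < 1 := Real.rpow_lt_one hθ0.le hθ1 (by positivity)
  -- With this L the vector L w^(1/γ) is a supersolution: it is mapped below 1 + L κ w^(1/γ), and 1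
  -- = L (1 - κ) ≤ L (1 - κ) w^(1/γ).
  set L := (1 - κ)⁻¹
  have hL : L * (1 - κ) = 1 := inv_mul_cancel₀ (by linarith)
  have hL1 : 1 ≤ L := (one_le_inv₀ (by linarith)).2 (by linarith)
  have hwr : ∀ z, 1 ≤ w z ^ (1 / γ) := fun z => Real.one_le_rpow (hw z) (by positivity)
  have hw0 : ∀ z, 0 ≤ w z := fun z => zero_le_one.trans (hw z)
  have hsub : ∀ z, rootMap A γ (fun j => L * w j ^ (1 / γ)) z ≤ L * w z ^ (1 / γ) := by
    intro z
    rw [rootMap_smul hA hγ (fun j => Real.rpow_nonneg (hw0 j) _) (by linarith)]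
    have h1 : rootMap A γ (fun j => w j ^ (1 / γ)) z - 1 ≤ κ * w z ^ (1 / γ) := by
      unfold rootMap
      have : (fun j => (w j ^ (1 / γ)) ^ γ) = w := by
        ext j
        rw [← Real.rpow_mul (hw0 j), one_div_mul_cancel hγ.ne', Real.rpow_one]
      rw [this, ← Real.mul_rpow hθ0.le (hw0 z), add_sub_cancel_left]
      exact Real.rpow_le_rpow (mulVec_nonneg hA hw0 z) (hAw z) (by positivity)
    have h2 := mul_le_mul_of_nonneg_left h1 (zero_le_one.trans hL1)
    have h3 := hwr z
    nlinarith
  set v : ℕ → Fin N → ℝ := fun n => (rootMap A γ)^[n] fun _ => 1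
  have hv0 : ∀ n z, 0 ≤ v n z := fun n z =>
    (iterate_rootMap_mono hA hγ n (fun _ => zero_le_one) (fun _ => le_rfl) z).1
  have hmono : Monotone v := by
    refine monotone_nat_of_le_succ fun n z => ?_
    have := (iterate_rootMap_mono hA hγ n (fun _ => zero_le_one)
      (w := rootMap A γ fun _ => 1) (one_le_rootMap hA fun _ => zero_le_one) z).2
    rwa [← Function.iterate_succ_apply] at this
  have hbdd : ∀ n z, v n z ≤ L * w z ^ (1 / γ) := by
    intro n
    induction n with
    | zero => intro z; have := hwr z; simp only [v, Function.iterate_zero, id]; nlinarith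
    | succ n ih =>
      intro z
      simp only [v, Function.iterate_succ_apply']
      exact (rootMap_mono hA hγ (hv0 n) ih z).trans (hsub z)
  have hbdd' : BddAbove (Set.range v) :=
    ⟨fun z => L * w z ^ (1 / γ), by rintro _ ⟨n, rfl⟩; exact hbdd n⟩
  have hlim : Tendsto v atTop (𝓝 (⨆ n, v n)) := tendsto_atTop_ciSup hmono hbdd'
  refine ⟨⨆ n, v n, fun z => hmono.ge_of_tendsto hlim 0 z, ?_, hlim⟩
  refine tendsto_nhds_unique ?_ (hlim.comp (tendsto_add_atTop_nat 1))
  have := ((continuous_rootMap (A := A) hγ).tendsto (⨆ n, v n)).comp hlim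
  refine this.congr fun n => ?_
  simp only [v, Function.comp, Function.iterate_succ_apply']

/-- The iterates of `rootMap A γ` converge to its fixed point from everywhere. -/
lemma tendsto_iterate_rootMap (hA : ∀ i j, 0 ≤ A i j) (hγ : 0 < γ) {v : Fin N → ℝ}
    (hv : ∀ z, 1 ≤ v z) (hfix : rootMap A γ v = v)
    (hlim : Tendsto (fun n => (rootMap A γ)^[n] fun _ => 1) atTop (𝓝 v))
    {y : Fin N → ℝ} (hy : ∀ z, 1 ≤ y z) :
    Tendsto (fun n => (rootMap A γ)^[n] y) atTop (𝓝 v) := by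
  obtain ⟨X, hX1, hX⟩ : ∃ X, 1 ≤ X ∧ ∀ z, v z ≤ X :=
    ⟨1 + ∑ z, v z, le_add_of_nonneg_right (Finset.sum_nonneg fun z _ => zero_le_one.trans (hv z)),
      fun z => (Finset.single_le_sum (f := v) (fun z _ => zero_le_one.trans (hv z))
        (Finset.mem_univ z)).trans (by linarith)⟩
  obtain ⟨D, hD0, hD⟩ : ∃ D, 0 ≤ D ∧ ∀ z, y z ≤ 1 + D :=
    ⟨∑ z, y z, Finset.sum_nonneg fun z _ => zero_le_one.trans (hy z),
      fun z => (Finset.single_le_sum (f := y) (fun z _ => zero_le_one.trans (hy z))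
        (Finset.mem_univ z)).trans (by linarith)⟩
  -- The contraction rate. The map sends (1 + d) v to v + d (v - 1), and v ≤ X means v - 1 ≤ (1 -
  -- 1/X) v, so the relative excess d over the fixed point shrinks by κ.
  set κ := 1 - X⁻¹
  have hXinv : X⁻¹ ≤ 1 := inv_le_one_of_one_le₀ hX1
  have hκ0 : 0 ≤ κ := by simp only [κ]; linarith
  have hκ1 : κ < 1 := by have : 0 < X⁻¹ := by positivity
                         simp only [κ]; linarith
  have hv0 : ∀ z, 0 ≤ v z := fun z => zero_le_one.trans (hv z)
  have hup : ∀ n z, 0 ≤ (rootMap A γ)^[n] y z ∧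
      (rootMap A γ)^[n] y z ≤ (1 + D * κ ^ n) * v z := by
    intro n
    induction n with
    | zero =>
      intro z
      have := hy z; have := hD z; have := hv z
      simp only [Function.iterate_zero, id, pow_zero, mul_one]
      exact ⟨by linarith, by nlinarith⟩
    | succ n ih =>
      intro z
      simp only [Function.iterate_succ_apply']
      refine ⟨zero_le_one.trans (one_le_rootMap hA (fun j => (ih j).1) z), ?_⟩
      refine (rootMap_mono hA hγ (fun j => (ih j).1) (fun j => (ih j).2) z).trans ?_
      have hDn : 0 ≤ D * κ ^ n := by positivity
      rw [rootMap_smul hA hγ hv0 (by linarith), hfix]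
      have h1 : 1 ≥ X⁻¹ * v z := by
        rw [ge_iff_le, inv_mul_le_iff₀ (by linarith), mul_one]; exact hX z
      have h2 : D * κ ^ (n + 1) * v z = D * κ ^ n * (v z - X⁻¹ * v z) := by
        simp only [κ, pow_succ]; ring
      nlinarith
  rw [tendsto_pi_nhds] at hlim ⊢
  intro z
  have hupper : Tendsto (fun n => (1 + D * κ ^ n) * v z) atTop (𝓝 ((1 + D * 0) * v z)) :=
    ((tendsto_pow_atTop_nhds_zero_of_lt_one hκ0 hκ1).const_mul D |>.const_add 1).mul_const _
  simp only [mul_zero, add_zero, one_mul] at hupper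
  exact tendsto_of_tendsto_of_tendsto_of_le_of_le (hlim z) hupper
    (fun n => (iterate_rootMap_mono hA hγ n (fun _ => zero_le_one) hy z).2) fun n => (hup n z).2

end RootMap

end IncomeFluctuation

/-! ### One-period expectations as matrix products -/

namespace IncomeFluctuation

variable {N : ℕ} {E F G : Type*} [MeasurableSpace E] [MeasurableSpace F] [MeasurableSpace G]

namespace Environment

variable (M : Environment N E F G)

/-- A function of the state and of `ε`, `ζ` as a function of the shock. -/
def shockFun (X : Fin N → E → F → ℝ) (s : Shock N E F G) : ℝ≥0∞ :=
  ENNReal.ofReal (X s.1 s.2.1 s.2.2.1)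

lemma measurable_shockFun {X : Fin N → E → F → ℝ}
    (hX : ∀ z, Measurable fun p : E × F => X z p.1 p.2) :
    Measurable (shockFun X : Shock N E F G → ℝ≥0∞) := by
  refine measurable_from_prod_countable_right fun z => ?_
  have h : Measurable fun q : E × F × G => (q.1, q.2.1) := by fun_prop
  exact ((hX z).comp h).ennreal_ofReal

/-- Given the state, `η` is independent of `(ε, ζ)`. -/
lemma lintegral_step_mul (z : Fin N) {X : Fin N → E → F → ℝ}
    (hX : ∀ z, Measurable fun p : E × F => X z p.1 p.2) {g : Fin N → G → ℝ≥0∞}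
    (hg : ∀ z, Measurable (g z)) :
    ∫⁻ s, shockFun X s * g s.1 s.2.2.2 ∂M.step z = ∑ z', ENNReal.ofReal (M.P z z') *
      ((∫⁻ p, ENNReal.ofReal (X z' p.1 p.2) ∂(M.lawε.prod M.lawζ)) *
        ∫⁻ y, g z' y ∂M.lawη) := by
  have hgm : Measurable fun s : Shock N E F G => g s.1 s.2.2.2 :=
    measurable_from_prod_countable_right fun z =>
      (hg z).comp (measurable_snd.comp measurable_snd)
  have hm : Measurable fun s : Shock N E F G => shockFun X s * g s.1 s.2.2.2 :=
    (measurable_shockFun hX).mul hgm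
  rw [M.lintegral_step z hm]
  refine Finset.sum_congr rfl fun z' _ => ?_
  congr 1
  have hXm : Measurable fun p : E × F => ENNReal.ofReal (X z' p.1 p.2) := (hX z').ennreal_ofReal
  have hgz := hg z'
  have hX1 : Measurable fun q : E × F × G => ENNReal.ofReal (X z' q.1 q.2.1) :=
    hXm.comp (by fun_prop : Measurable fun q : E × F × G => (q.1, q.2.1))
  have hg1 : Measurable fun q : E × F × G => g z' q.2.2 := by fun_prop
  simp only [shockFun]
  have hm1 : Measurable fun q : E × F × G => ENNReal.ofReal (X z' q.1 q.2.1) * g z' q.2.2 :=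
    hX1.mul hg1
  rw [lintegral_prod _ hm1.aemeasurable, lintegral_prod _ hXm.aemeasurable,
    ← lintegral_mul_const _ hXm.lintegral_prod_right']
  refine lintegral_congr fun e => ?_
  exact lintegral_prod_mul (hXm.comp (by fun_prop : Measurable fun f : F => (e, f))).aemeasurable
    hgz.aemeasurable

lemma lintegral_step_mul_lt_top (z : Fin N) {X : Fin N → E → F → ℝ}
    (hX : ∀ z, Measurable fun p : E × F => X z p.1 p.2)
    (hXi : ∀ z, Integrable (fun p : E × F => X z p.1 p.2) (M.lawε.prod M.lawζ))
    {g : Fin N → G → ℝ≥0∞} (hg : ∀ z, Measurable (g z))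
    (hgi : ∀ z, ∫⁻ y, g z y ∂M.lawη < ⊤) :
    ∫⁻ s, shockFun X s * g s.1 s.2.2.2 ∂M.step z < ⊤ := by
  rw [M.lintegral_step_mul z hX hg]
  exact ENNReal.sum_lt_top.2 fun z' _ => ENNReal.mul_lt_top ENNReal.ofReal_lt_top
    (ENNReal.mul_lt_top (hXi z').lintegral_lt_top (hgi z'))

/-- The dictionary between expectations over the next shock and the matrices `PD`. Integrability is
essential: the entries of `PD` are Bochner integrals, which default to 0 where the mean is infinite.
-/
lemma lintegral_step_weight (z : Fin N) {X : Fin N → E → F → ℝ}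
    (hX : ∀ z, Measurable fun p : E × F => X z p.1 p.2) (hX0 : ∀ z e f, 0 ≤ X z e f)
    (hXi : ∀ z, Integrable (fun p : E × F => X z p.1 p.2) (M.lawε.prod M.lawζ))
    {w : Fin N → ℝ} (hw : ∀ z, 0 ≤ w z) :
    ∫⁻ s, shockFun X s * ENNReal.ofReal (w s.1) ∂M.step z =
      ENNReal.ofReal ((M.PD X).mulVec w z) := by
  have h := M.lintegral_step_mul z hX (g := fun z _ => ENNReal.ofReal (w z))
    fun z => measurable_const
  rw [h]
  have hmean : ∀ z, 0 ≤ M.mean X z := fun z => integral_nonneg fun p => hX0 z p.1 p.2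
  simp only [PD, Matrix.mulVec, dotProduct, Matrix.mul_diagonal]
  rw [ENNReal.ofReal_sum_of_nonneg fun z' _ =>
    mul_nonneg (mul_nonneg (M.P_nonneg z z') (hmean z')) (hw z')]
  refine Finset.sum_congr rfl fun z' _ => ?_
  rw [ENNReal.ofReal_mul (mul_nonneg (M.P_nonneg z z') (hmean z')),
    ENNReal.ofReal_mul (M.P_nonneg z z'), mean,
    ofReal_integral_eq_lintegral_ofReal (hXi z') (ae_of_all _ fun p => hX0 z' p.1 p.2),
    lintegral_const, measure_univ, mul_one, mul_assoc]

lemma PD_nonneg {X : Fin N → E → F → ℝ} (hX0 : ∀ z e f, 0 ≤ X z e f) (i j : Fin N) :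
    0 ≤ M.PD X i j := by
  rw [PD, Matrix.mul_diagonal]
  exact mul_nonneg (M.P_nonneg i j) (integral_nonneg fun p => hX0 j p.1 p.2)

/-- The weights that a spectral radius below one provides, in terms of expectations. -/
lemma exists_step_weight {X : Fin N → E → F → ℝ}
    (hX : ∀ z, Measurable fun p : E × F => X z p.1 p.2) (hX0 : ∀ z e f, 0 ≤ X z e f)
    (hXi : ∀ z, Integrable (fun p : E × F => X z p.1 p.2) (M.lawε.prod M.lawζ))
    (hr : specRad (M.PD X) < 1) :
    ∃ (w : Fin N → ℝ≥0∞) (θ : ℝ≥0∞), (∀ z, 1 ≤ w z) ∧ (∀ z, w z < ⊤) ∧ θ < 1 ∧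
      ∀ z, ∫⁻ s, shockFun X s * w s.1 ∂M.step z ≤ θ * w z := by
  obtain ⟨w, θ, hw, hθ0, hθ1, hle⟩ := exists_weight (M.PD_nonneg hX0) hr
  have hw0 : ∀ z, 0 ≤ w z := fun z => zero_le_one.trans (hw z)
  refine ⟨fun z => ENNReal.ofReal (w z), ENNReal.ofReal θ, fun z => by simpa using hw z,
    fun z => ENNReal.ofReal_lt_top, by simpa using hθ1, fun z => ?_⟩
  rw [M.lintegral_step_weight z hX hX0 hXi hw0, ← ENNReal.ofReal_mul hθ0.le]
  exact ENNReal.ofReal_le_ofReal (hle z)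

/-- Expected discounted sums of integrable one-period quantities are finite. -/
lemma exists_lintegral_tsum_le {X : Fin N → E → F → ℝ}
    (hX : ∀ z, Measurable fun p : E × F => X z p.1 p.2) (hX0 : ∀ z e f, 0 ≤ X z e f)
    (hXi : ∀ z, Integrable (fun p : E × F => X z p.1 p.2) (M.lawε.prod M.lawζ))
    (hr : specRad (M.PD X) < 1) {g : Fin N → G → ℝ≥0∞} (hg : ∀ z, Measurable (g z))
    (hgi : ∀ z, ∫⁻ y, g z y ∂M.lawη < ⊤) :
    ∃ C < ⊤, ∀ z, ∫⁻ ω, ∑' t, (∏ i ∈ Finset.range t, shockFun X (ω i)) *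
      (shockFun X (ω t) * g (ω t).1 (ω t).2.2.2) ∂M.law z ≤ C := by
  obtain ⟨w, θ, hw1, hwtop, hθ, hw⟩ := M.exists_step_weight hX hX0 hXi hr
  -- Summing over the finitely many states makes the constant independent of the initial state, and
  -- w ≥ 1 turns C₀ into the multiple of w that the geometric series argument needs.
  set C₀ := ∑ z, ∫⁻ s, shockFun X s * g s.1 s.2.2.2 ∂M.step z
  have hC₀ : C₀ < ⊤ := ENNReal.sum_lt_top.2 fun z _ =>
    M.lintegral_step_mul_lt_top z hX hXi hg hgi
  have hgm : Measurable fun s : Shock N E F G => g s.1 s.2.2.2 :=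
    measurable_from_prod_countable_right fun z =>
      (hg z).comp (measurable_snd.comp measurable_snd)
  refine ⟨C₀ * (1 - θ)⁻¹ * ∑ z, w z, ENNReal.mul_lt_top (ENNReal.mul_lt_top hC₀ ?_)
    (ENNReal.sum_lt_top.2 fun z _ => hwtop z), fun z => ?_⟩
  · rw [ENNReal.inv_lt_top]
    exact tsub_pos_of_lt hθ
  · refine (M.lintegral_tsum_prod_mul_le (measurable_shockFun hX) hw
      ((measurable_shockFun hX).mul hgm) (C := C₀) (fun z => ?_) z).trans ?_
    · calc _ ≤ C₀ := Finset.single_le_sum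
            (f := fun z => ∫⁻ s, shockFun X s * g s.1 s.2.2.2 ∂M.step z)
            (fun _ _ => zero_le) (Finset.mem_univ z)
        _ ≤ C₀ * w z := le_mul_of_one_le_right' (hw1 z)
    · gcongr
      exact Finset.single_le_sum (f := w) (fun _ _ => zero_le) (Finset.mem_univ z)

end Environment

end IncomeFluctuation

/-! ### Discounted wealth and finiteness of the objective -/

namespace IncomeFluctuation

/-- A sequence with `x (t + 1) ≤ θ x t + d t`, where `θ < 1` and `d` is summable, is summable. -/
lemma tsum_lt_top_of_le_add {x d : ℕ → ℝ≥0∞} {θ : ℝ≥0∞} (hθ : θ < 1) (h0 : x 0 < ⊤)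
    (hd : ∑' t, d t < ⊤) (h : ∀ t, x (t + 1) ≤ θ * x t + d t) : ∑' t, x t < ⊤ := by
  -- The finite geometric sum satisfies T = 1 + θ T. This identity closes the induction for the
  -- bound (x 0 + ∑ d) T on partial sums without any subtraction.
  set T := ∑' n : ℕ, θ ^ n
  have hT : T = 1 + θ * T := by
    simp only [T]
    conv_lhs => rw [tsum_eq_zero_add' ENNReal.summable, pow_zero]
    simp_rw [pow_succ', ENNReal.tsum_mul_left]
  have hTtop : T < ⊤ := by
    simp only [T]
    rw [ENNReal.tsum_geometric, ENNReal.inv_lt_top]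
    exact tsub_pos_of_lt hθ
  set D := x 0 + ∑' t, d t
  have hle : ∀ n, ∑ t ∈ Finset.range n, x t ≤ D * T := by
    intro n
    induction n with
    | zero => simp
    | succ n ih =>
      calc ∑ t ∈ Finset.range (n + 1), x t
          = ∑ t ∈ Finset.range n, x (t + 1) + x 0 := Finset.sum_range_succ' _ _
        _ ≤ ∑ t ∈ Finset.range n, (θ * x t + d t) + x 0 := by gcongr; exact h _
        _ = θ * ∑ t ∈ Finset.range n, x t + ∑ t ∈ Finset.range n, d t + x 0 := by
            rw [Finset.sum_add_distrib, Finset.mul_sum]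
        _ ≤ θ * (D * T) + ∑' t, d t + x 0 := by gcongr; exact ENNReal.sum_le_tsum _
        _ = D * (1 + θ * T) := by simp only [D]; ring
        _ = D * T := by rw [← hT]
  exact (ENNReal.tsum_le_of_sum_range_le hle).trans_lt
    (ENNReal.mul_lt_top (ENNReal.add_lt_top.2 ⟨h0, hd⟩) hTtop)

variable {u : ℝ → EReal}

lemma measurable_toENNReal_comp (hu : IsInada u) {Ω : Type*} {m : MeasurableSpace Ω}
    {f : Ω → ℝ} (hf : Measurable[m] f) (h0 : ∀ ω, 0 ≤ f ω) :
    (Measurable[m] fun ω => (u (f ω)).toENNReal) ∧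
      Measurable[m] fun ω => (-u (f ω)).toENNReal := by
  have h : ∀ ω, u (f ω) = u (max (f ω) 0) := fun ω => by rw [max_eq_left (h0 ω)]
  have hm := hu.measurable_comp_max.comp hf
  simp_rw [h]
  exact ⟨measurable_ereal_toENNReal.comp hm,
    measurable_ereal_toENNReal.comp (continuous_neg.measurable.comp hm)⟩

variable {N : ℕ} {E F G : Type*} [MeasurableSpace E] [MeasurableSpace F] [MeasurableSpace G]

namespace Environment

variable {M : Environment N E F G}

lemma IsFeasible.measurable_wealth {a : ℝ} {p : Plan N E F G} (hp : M.IsFeasible a p) (t : ℕ) :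
    Measurable[info N E F G t] (M.wealth a p t) := by
  induction t with
  | zero => exact @measurable_const _ _ _ (info N E F G 0) a
  | succ t ih =>
    have h1 := M.measurable_ret.comp (measurable_info_eval (N := N) (E := E) (F := F) (G := G)
      t.lt_succ_self)
    have h2 := M.measurable_income.comp (measurable_info_eval (N := N) (E := E) (F := F) (G := G)
      t.lt_succ_self)
    have h3 := (ih.sub (hp t).1).mono (info_mono t.le_succ) le_rfl
    exact (h1.mul h3).add h2

lemma ofReal_cumDiscount (t : ℕ) (ω : ℕ → Shock N E F G) :
    ENNReal.ofReal (M.cumDiscount t ω) =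
      ∏ i ∈ Finset.range t, shockFun (fun z e _ => M.β z e) (ω i) :=
  ENNReal.ofReal_prod_of_nonneg fun _ _ => M.discount_nonneg _

lemma cumDiscount_succ (t : ℕ) (ω : ℕ → Shock N E F G) :
    M.cumDiscount (t + 1) ω = M.cumDiscount t ω * M.discount (ω t) :=
  Finset.prod_range_succ _ _

lemma measurable_β_prod (z : Fin N) : Measurable fun p : E × F => M.β z p.1 :=
  (M.measurable_β z).comp measurable_fst

lemma measurable_βR_prod (z : Fin N) : Measurable fun p : E × F => M.β z p.1 * M.R z p.2 :=
  ((M.measurable_β z).comp measurable_fst).mul ((M.measurable_R z).comp measurable_snd)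

lemma IsSpectral.integrable_β_prod (hM : M.IsSpectral u) (z : Fin N) :
    Integrable (fun p : E × F => M.β z p.1) (M.lawε.prod M.lawζ) :=
  (hM.integrable_β z).comp_fst _

/-- Expected discounted wealth is summable whatever is consumed. -/
lemma IsSpectral.tsum_wealth_lt_top (hM : M.IsSpectral u) {a : ℝ} (z : Fin N)
    {p : Plan N E F G} (hp : M.IsFeasible a p) :
    ∑' t, ∫⁻ ω, ENNReal.ofReal (M.cumDiscount t ω) * ENNReal.ofReal (M.wealth a p t ω)
      ∂M.law z < ⊤ := by
  obtain ⟨w, θ, hw1, hwtop, hθ, hw⟩ := M.exists_step_weight M.measurable_βR_prod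
    (fun z e f => mul_nonneg (M.β_nonneg z e) (M.R_nonneg z f)) hM.integrable_βR hM.specRad_βR
  have hwm : Measurable w := measurable_of_finite _
  set B : ℕ → (ℕ → Shock N E F G) → ℝ≥0∞ := fun t ω => ENNReal.ofReal (M.cumDiscount t ω)
  have hB : ∀ t, Measurable[info N E F G t] (B t) := fun t =>
    (M.measurable_cumDiscount t).ennreal_ofReal
  have hA : ∀ t, Measurable[info N E F G t] fun ω => ENNReal.ofReal (M.wealth a p t ω) := fun t =>
    (hp.measurable_wealth t).ennreal_ofReal
  set y : Shock N E F G → ℝ≥0∞ := fun s => shockFun (fun z e _ => M.β z e) s *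
    (ENNReal.ofReal (M.Y s.1 s.2.2.2) * w s.1)
  have hYw : ∀ z, Measurable fun g => ENNReal.ofReal (M.Y z g) * w z := fun z =>
    (M.measurable_Y z).ennreal_ofReal.mul measurable_const
  have hy : Measurable y := (measurable_shockFun M.measurable_β_prod).mul
    (M.measurable_income.ennreal_ofReal.mul (hwm.comp measurable_fst))
  have hd : ∑' t, ∫⁻ ω, B t ω * y (ω t) ∂M.law z < ⊤ := by
    have hm : ∀ t, Measurable fun ω => B t ω * y (ω t) := fun t =>
      ((hB t).mono (info_le t) le_rfl).mul (hy.comp (measurable_pi_apply t))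
    rw [← lintegral_tsum fun t => (hm t).aemeasurable]
    obtain ⟨C, hC, hle⟩ := M.exists_lintegral_tsum_le M.measurable_β_prod
      (fun z e _ => M.β_nonneg z e) hM.integrable_β_prod hM.specRad_β hYw (fun z => by
        rw [lintegral_mul_const _ (M.measurable_Y z).ennreal_ofReal]
        exact ENNReal.mul_lt_top (hM.integrable_Y z).lintegral_lt_top (hwtop z))
    refine lt_of_le_of_lt (le_of_eq ?_) ((hle z).trans_lt hC)
    refine lintegral_congr fun ω => tsum_congr fun t => ?_
    simp only [B, M.ofReal_cumDiscount, y]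
  have hk := measurable_shockFun (G := G) (X := fun z e f => M.β z e * M.R z f)
    M.measurable_βR_prod
  -- Weighting wealth by w(Z_t) turns r(P D_{βR}) < 1 into a drift inequality with factor θ < 1. The
  -- inhomogeneous term is discounted income, summable because r(P D_β) < 1.
  have key : ∑' t, ∫⁻ ω, B t ω * ENNReal.ofReal (M.wealth a p t ω) * w (state z ω t) ∂M.law z
      < ⊤ := by
    refine tsum_lt_top_of_le_add hθ ?_ hd fun t => ?_
    · simp only [B, cumDiscount, wealth, state]
      simp [ENNReal.mul_lt_top, hwtop]
    · have hBA : Measurable[info N E F G t] fun ω => B t ω * ENNReal.ofReal (M.wealth a p t ω) :=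
        (hB t).mul (hA t)
      have hBAw : Measurable fun ω =>
          B t ω * ENNReal.ofReal (M.wealth a p t ω) * w (state z ω t) :=
        (hBA.mono (info_le t) le_rfl).mul
          (hwm.comp ((measurable_state z t).mono (info_le t) le_rfl))
      calc ∫⁻ ω, B (t + 1) ω * ENNReal.ofReal (M.wealth a p (t + 1) ω) *
              w (state z ω (t + 1)) ∂M.law z
          ≤ ∫⁻ ω, B t ω * ENNReal.ofReal (M.wealth a p t ω) *
              (shockFun (fun z e f => M.β z e * M.R z f) (ω t) * w (ω t).1) +
              B t ω * y (ω t) ∂M.law z := by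
            refine lintegral_mono fun ω => ?_
            have hW : M.wealth a p (t + 1) ω ≤
                M.ret (ω t) * M.wealth a p t ω + M.income (ω t) := by
              have := mul_le_mul_of_nonneg_left
                (sub_le_self (M.wealth a p t ω) ((hp t).2 ω).1) (M.ret_nonneg (ω t))
              simpa [wealth] using this
            simp only [B, y, cumDiscount_succ, state]
            rw [ENNReal.ofReal_mul (M.cumDiscount_nonneg t ω)]
            calc _ ≤ ENNReal.ofReal (M.cumDiscount t ω) * ENNReal.ofReal (M.discount (ω t)) *
                  (ENNReal.ofReal (M.ret (ω t)) * ENNReal.ofReal (M.wealth a p t ω) +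
                    ENNReal.ofReal (M.income (ω t))) * w (ω t).1 := by
                  gcongr
                  rw [← ENNReal.ofReal_mul (M.ret_nonneg _)]
                  exact (ENNReal.ofReal_le_ofReal hW).trans ENNReal.ofReal_add_le
              _ = _ := by
                  have : shockFun (fun z e f => M.β z e * M.R z f) (ω t) =
                      ENNReal.ofReal (M.discount (ω t)) * ENNReal.ofReal (M.ret (ω t)) :=
                    ENNReal.ofReal_mul (M.discount_nonneg _)
                  rw [this]
                  change _ = _ + ENNReal.ofReal (M.cumDiscount t ω) *
                    (ENNReal.ofReal (M.discount (ω t)) *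
                      (ENNReal.ofReal (M.income (ω t)) * w (ω t).1))
                  ring
        _ = ∫⁻ ω, B t ω * ENNReal.ofReal (M.wealth a p t ω) *
              (shockFun (fun z e f => M.β z e * M.R z f) (ω t) * w (ω t).1) ∂M.law z +
              ∫⁻ ω, B t ω * y (ω t) ∂M.law z :=
            lintegral_add_right _ (((hB t).mono (info_le t) le_rfl).mul
              (hy.comp (measurable_pi_apply t)))
        _ ≤ _ := by
            gcongr
            rw [M.lintegral_law_mul z hBA (g := fun s =>
                shockFun (fun z e f => M.β z e * M.R z f) s * w s.1)
                (hk.mul (hwm.comp measurable_fst)), ← lintegral_const_mul _ hBAw]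
            refine lintegral_mono fun ω => ?_
            rw [mul_left_comm]
            gcongr
            exact hw _
  refine lt_of_le_of_lt (ENNReal.tsum_le_tsum fun t => lintegral_mono fun ω => ?_) key
  exact le_mul_of_one_le_right' (hw1 _)

/-- The contribution of the positive part of utility to the objective. -/
def posValue (M : Environment N E F G) (u : ℝ → EReal) (z : Fin N) (p : Plan N E F G) : ℝ≥0∞ :=
  ∫⁻ ω, ∑' t, ENNReal.ofReal (M.cumDiscount t ω) * (u (p t ω)).toENNReal ∂(M.law z)

/-- The contribution of the negative part of utility to the objective. -/
def negValue (M : Environment N E F G) (u : ℝ → EReal) (z : Fin N) (p : Plan N E F G) : ℝ≥0∞ :=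
  ∫⁻ ω, ∑' t, ENNReal.ofReal (M.cumDiscount t ω) * (-u (p t ω)).toENNReal ∂(M.law z)

lemma value_eq (z : Fin N) (p : Plan N E F G) :
    M.value u z p = (M.posValue u z p : EReal) - (M.negValue u z p : EReal) := rfl

lemma IsSpectral.tsum_cumDiscount_lt_top (hM : M.IsSpectral u) (z : Fin N) :
    ∑' t, ∫⁻ ω, ENNReal.ofReal (M.cumDiscount t ω) ∂M.law z < ⊤ := by
  obtain ⟨w, θ, hw1, hwtop, hθ, hw⟩ := M.exists_step_weight M.measurable_β_prod
    (fun z e _ => M.β_nonneg z e) hM.integrable_β_prod hM.specRad_β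
  calc _ ≤ ∑' t : ℕ, θ ^ t * w z := by
        refine ENNReal.tsum_le_tsum fun t => le_trans (lintegral_mono fun ω => ?_)
          (M.lintegral_prod_mul_le (measurable_shockFun M.measurable_β_prod) hw z t)
        rw [M.ofReal_cumDiscount]
        exact le_mul_of_one_le_right' (hw1 _)
    _ < ⊤ := by
        rw [ENNReal.tsum_mul_right, ENNReal.tsum_geometric]
        refine ENNReal.mul_lt_top ?_ (hwtop z)
        rw [ENNReal.inv_lt_top]
        exact tsub_pos_of_lt hθ

lemma measurable_ofReal_cumDiscount (t : ℕ) :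
    Measurable fun ω => ENNReal.ofReal (M.cumDiscount t ω) :=
  ((M.measurable_cumDiscount t).mono (info_le t) le_rfl).ennreal_ofReal

/-- Affine growth of utility reduces this to the summability of expected discount factors and of
expected discounted wealth. The objective of a feasible plan is therefore never ∞ - ∞. -/
lemma posValue_lt_top (hu : IsInada u) (hM : M.IsSpectral u) {a : ℝ} (z : Fin N)
    {p : Plan N E F G} (hp : M.IsFeasible a p) : M.posValue u z p < ⊤ := by
  have hB := M.measurable_ofReal_cumDiscount
  have hpm : ∀ t, Measurable fun ω => (u (p t ω)).toENNReal := fun t =>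
    (measurable_toENNReal_comp hu (((hp t).1).mono (info_le t) le_rfl) fun ω => ((hp t).2 ω).1).1
  have hWm : ∀ t, Measurable fun ω => ENNReal.ofReal (M.wealth a p t ω) := fun t =>
    ((hp.measurable_wealth t).mono (info_le t) le_rfl).ennreal_ofReal
  have hm : ∀ t, Measurable fun ω =>
      ENNReal.ofReal (M.cumDiscount t ω) * (u (p t ω)).toENNReal := fun t => (hB t).mul (hpm t)
  have hm' : ∀ t, Measurable fun ω =>
      ENNReal.ofReal (M.cumDiscount t ω) * ENNReal.ofReal (M.wealth a p t ω) :=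
    fun t => (hB t).mul (hWm t)
  rw [posValue, lintegral_tsum fun t => (hm t).aemeasurable]
  set k₀ := ENNReal.ofReal |(u 1).toReal|
  set k₁ := ENNReal.ofReal (marginal u 1)
  calc _ ≤ ∑' t, (k₀ * ∫⁻ ω, ENNReal.ofReal (M.cumDiscount t ω) ∂M.law z +
        k₁ * ∫⁻ ω, ENNReal.ofReal (M.cumDiscount t ω) * ENNReal.ofReal (M.wealth a p t ω)
          ∂M.law z) := by
        refine ENNReal.tsum_le_tsum fun t => ?_
        rw [← lintegral_const_mul _ (hB t), ← lintegral_const_mul _ (hm' t),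
          ← lintegral_add_left ((hB t).const_mul _)]
        refine lintegral_mono fun ω => ?_
        have h1 : (u (p t ω)).toENNReal ≤ k₀ + k₁ * ENNReal.ofReal (M.wealth a p t ω) := by
          refine (hu.toENNReal_le ((hp t).2 ω).1).trans (ENNReal.ofReal_add_le.trans ?_)
          rw [ENNReal.ofReal_mul (hu.marginal_pos 1 one_pos).le]
          gcongr
          exact ((hp t).2 ω).2
        calc _ ≤ ENNReal.ofReal (M.cumDiscount t ω) *
              (k₀ + k₁ * ENNReal.ofReal (M.wealth a p t ω)) := mul_le_mul_right h1 _
          _ = _ := by ring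
    _ < ⊤ := by
        rw [ENNReal.tsum_add, ENNReal.tsum_mul_left, ENNReal.tsum_mul_left]
        exact ENNReal.add_lt_top.2
          ⟨ENNReal.mul_lt_top ENNReal.ofReal_lt_top (hM.tsum_cumDiscount_lt_top z),
            ENNReal.mul_lt_top ENNReal.ofReal_lt_top (hM.tsum_wealth_lt_top z hp)⟩

/-- Wealth if the consumption is the smaller one of a target `τ` and wealth. -/
def cappedWealth (M : Environment N E F G) (a : ℝ) (τ : Plan N E F G) :
    ℕ → (ℕ → Shock N E F G) → ℝ
  | 0, _ => a
  | t + 1, ω => M.ret (ω t) * (cappedWealth M a τ t ω - min (τ t ω) (cappedWealth M a τ t ω)) +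
      M.income (ω t)

/-- The plan that consumes the smaller one of a target `τ` and wealth. -/
def capped (M : Environment N E F G) (a : ℝ) (τ : Plan N E F G) : Plan N E F G :=
  fun t ω => min (τ t ω) (M.cappedWealth a τ t ω)

lemma cappedWealth_succ (a : ℝ) (τ : Plan N E F G) (t : ℕ) (ω : ℕ → Shock N E F G) :
    M.cappedWealth a τ (t + 1) ω =
      M.ret (ω t) * (M.cappedWealth a τ t ω - M.capped a τ t ω) + M.income (ω t) := rfl

lemma wealth_capped (a : ℝ) (τ : Plan N E F G) (t : ℕ) :
    M.wealth a (M.capped a τ) t = M.cappedWealth a τ t := by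
  induction t with
  | zero => rfl
  | succ t ih => funext ω; simp only [wealth, ih]; rfl

lemma income_le_cappedWealth (a : ℝ) (τ : Plan N E F G) (t : ℕ) (ω : ℕ → Shock N E F G) :
    M.income (ω t) ≤ M.cappedWealth a τ (t + 1) ω :=
  le_add_of_nonneg_left (mul_nonneg (M.ret_nonneg _) (sub_nonneg.2 (min_le_right _ _)))

lemma cappedWealth_nonneg {a : ℝ} (ha : 0 ≤ a) (τ : Plan N E F G) (t : ℕ)
    (ω : ℕ → Shock N E F G) : 0 ≤ M.cappedWealth a τ t ω := by
  cases t with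
  | zero => exact ha
  | succ t => exact (M.income_nonneg _).trans (M.income_le_cappedWealth a τ t ω)

/-- Capping at wealth turns an arbitrary nonnegative adapted target into a feasible plan, so a
perturbation can be prescribed without first checking the budget in all later periods. -/
lemma isFeasible_capped {a : ℝ} (ha : 0 ≤ a) {τ : Plan N E F G}
    (hτ : ∀ t, Measurable[info N E F G t] (τ t)) (h0 : ∀ t ω, 0 ≤ τ t ω) :
    M.IsFeasible a (M.capped a τ) := by
  have hW : ∀ t, Measurable[info N E F G t] (M.cappedWealth a τ t) := by
    intro t
    induction t with
    | zero => exact @measurable_const _ _ _ (info N E F G 0) a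
    | succ t ih =>
      have h1 := M.measurable_ret.comp (measurable_info_eval (N := N) (E := E) (F := F) (G := G)
        t.lt_succ_self)
      have h2 := M.measurable_income.comp
        (measurable_info_eval (N := N) (E := E) (F := F) (G := G) t.lt_succ_self)
      have h3 := (ih.sub ((hτ t).min ih)).mono (info_mono t.le_succ) le_rfl
      exact (h1.mul h3).add h2
  intro t
  refine ⟨(hτ t).min (hW t), fun ω => ⟨le_min (h0 t ω) (M.cappedWealth_nonneg ha τ t ω), ?_⟩⟩
  rw [wealth_capped]
  exact min_le_right _ _

/-- Since u'(0) = ∞, finiteness of E u'(Y) excludes zero income up to a null set. -/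
lemma IsSpectral.income_pos (hM : M.IsSpectral u) (hu : IsInada u) (z : Fin N) :
    ∀ᵐ ω ∂M.law z, ∀ t, 0 < M.income (ω t) := by
  refine M.ae_law_of_ae_step z (S := {s | 0 < M.income s})
    (measurableSet_lt measurable_const M.measurable_income) fun z => ?_
  have h := M.lintegral_step_mul_lt_top z (X := fun _ _ _ => 1) (fun z => measurable_const)
    (fun z => integrable_const _) (g := fun z y => extMarginal u (M.Y z y))
    (fun z => hu.measurable_extMarginal.comp (M.measurable_Y z)) hM.lintegral_marginal
  have hm : Measurable fun s : Shock N E F G => extMarginal u (M.income s) :=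
    hu.measurable_extMarginal.comp M.measurable_income
  have h' : ∫⁻ s, extMarginal u (M.income s) ∂M.step z ≠ ⊤ := by
    simp only [shockFun, ENNReal.ofReal_one, one_mul] at h
    exact h.ne
  have hae : ∀ᵐ s ∂M.step z, s ∈ {s | 0 < M.income s} := by
    filter_upwards [ae_lt_top hm h'] with s hs
    by_contra hc
    rw [extMarginal, if_neg hc] at hs
    exact lt_irrefl _ hs
  exact hae

/-- Consuming income from period `1` on does not have the value `-∞`. -/
lemma exists_negValue_lt_top (hu : IsInada u) (hM : M.IsSpectral u) {a : ℝ} (ha : 0 < a)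
    (z : Fin N) : ∃ q, M.IsFeasible a q ∧ M.negValue u z q < ⊤ := by
  -- The cap never binds on this target: wealth is a in period 0 and at least current income later.
  set τ : Plan N E F G := fun t ω => match t with
    | 0 => a
    | t + 1 => M.income (ω t)
  have hq : M.IsFeasible a (M.capped a τ) := by
    refine M.isFeasible_capped ha.le (fun t => ?_) fun t ω => ?_
    · cases t with
      | zero => exact @measurable_const _ _ _ (info N E F G 0) a
      | succ t => exact M.measurable_income.comp (measurable_info_eval t.lt_succ_self)
    · cases t with
      | zero => exact ha.le
      | succ t => exact M.income_nonneg _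
  have hq0 : ∀ ω, M.capped a τ 0 ω = a := fun ω => min_self _
  have hqs : ∀ t ω, M.capped a τ (t + 1) ω = M.income (ω t) := fun t ω =>
    min_eq_left (M.income_le_cappedWealth a τ t ω)
  refine ⟨_, hq, ?_⟩
  obtain ⟨C, hC, hle⟩ := M.exists_lintegral_tsum_le M.measurable_β_prod
    (fun z e _ => M.β_nonneg z e) hM.integrable_β_prod hM.specRad_β
    (g := fun z y => ENNReal.ofReal |(u 1).toReal| + extMarginal u (M.Y z y))
    (fun z => (hu.measurable_extMarginal.comp (M.measurable_Y z)).const_add _) (fun z => by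
      rw [lintegral_add_left measurable_const]
      simp [hM.lintegral_marginal z])
  calc M.negValue u z (M.capped a τ)
      ≤ ∫⁻ ω, (-u a).toENNReal + ∑' t, (∏ i ∈ Finset.range t, shockFun (fun z e _ => M.β z e)
          (ω i)) * (shockFun (fun z e _ => M.β z e) (ω t) *
            (ENNReal.ofReal |(u 1).toReal| + extMarginal u (M.Y (ω t).1 (ω t).2.2.2)))
          ∂M.law z := by
        refine lintegral_mono_ae ?_
        filter_upwards [hM.income_pos hu z] with ω hω
        rw [tsum_eq_zero_add' ENNReal.summable, hq0]
        simp only [cumDiscount, Finset.range_zero, Finset.prod_empty, ENNReal.ofReal_one, one_mul]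
        refine add_le_add le_rfl (ENNReal.tsum_le_tsum fun t => ?_)
        change ENNReal.ofReal (M.cumDiscount (t + 1) ω) * _ ≤ _
        rw [hqs, ← mul_assoc, ← Finset.prod_range_succ, ← M.ofReal_cumDiscount]
        exact mul_le_mul_right (hu.toENNReal_neg_le (hω t)) _
    _ ≤ (-u a).toENNReal + C := by
        rw [lintegral_add_left measurable_const, lintegral_const, measure_univ, mul_one]
        gcongr
        exact hle z
    _ < ⊤ := by
        rw [hu.toENNReal_neg_eq ha]
        exact ENNReal.add_lt_top.2 ⟨ENNReal.ofReal_lt_top, hC⟩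

/-- The positive part of the objective is finite, so an infinite negative part would give value -∞,
and the plan that consumes income does better. -/
lemma IsSolution.negValue_lt_top (hu : IsInada u) (hM : M.IsSpectral u) {a : ℝ} (ha : 0 < a)
    {z : Fin N} {p : Plan N E F G} (hp : M.IsSolution u a z p) : M.negValue u z p < ⊤ := by
  obtain ⟨q, hq, hlt⟩ := M.exists_negValue_lt_top hu hM ha z
  by_contra hc
  have h := hp.2 q hq
  rw [value_eq, value_eq, not_lt_top_iff.1 hc, EReal.coe_ennreal_top, EReal.sub_top, le_bot_iff,
    sub_eq_add_neg, EReal.add_eq_bot_iff] at h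
  rcases h with h | h
  · simp at h
  · rw [EReal.neg_eq_bot_iff, EReal.coe_ennreal_eq_top_iff] at h
    exact hlt.ne h

/-- If, period by period, replacing a solution `p` by `q` gains at least `g` and loses at most `l`,
then the expected gain is at most the expected loss. -/
lemma IsSolution.lintegral_gain_le (hu : IsInada u) (hM : M.IsSpectral u) {a : ℝ} (ha : 0 < a)
    {z : Fin N} {p q : Plan N E F G} (hp : M.IsSolution u a z p) (hq : M.IsFeasible a q)
    {g l : ℕ → (ℕ → Shock N E F G) → ℝ≥0∞} (hg : ∀ t, Measurable (g t))
    (hl : ∀ t, Measurable (l t))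
    (h : ∀ᵐ ω ∂M.law z, ∀ t, ENNReal.ofReal (M.cumDiscount t ω) * (u (p t ω)).toENNReal +
      ENNReal.ofReal (M.cumDiscount t ω) * (-u (q t ω)).toENNReal + g t ω ≤
        ENNReal.ofReal (M.cumDiscount t ω) * (u (q t ω)).toENNReal +
      ENNReal.ofReal (M.cumDiscount t ω) * (-u (p t ω)).toENNReal + l t ω) :
    ∫⁻ ω, ∑' t, g t ω ∂M.law z ≤ ∫⁻ ω, ∑' t, l t ω ∂M.law z := by
  have hB := M.measurable_ofReal_cumDiscount
  have hpm := fun t => measurable_toENNReal_comp hu ((hp.1 t).1.mono (info_le t) le_rfl)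
    fun ω => ((hp.1 t).2 ω).1
  have hqm := fun t => measurable_toENNReal_comp hu ((hq t).1.mono (info_le t) le_rfl)
    fun ω => ((hq t).2 ω).1
  -- Summing and integrating the pathwise inequality needs no integrability in this additive form.
  -- Optimality and finiteness enter only afterwards.
  have hs : M.posValue u z p + M.negValue u z q + ∫⁻ ω, ∑' t, g t ω ∂M.law z ≤
      M.posValue u z q + M.negValue u z p + ∫⁻ ω, ∑' t, l t ω ∂M.law z := by
    simp only [posValue, negValue]
    have m1 : Measurable fun ω => ∑' t, ENNReal.ofReal (M.cumDiscount t ω) *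
        (u (p t ω)).toENNReal := Measurable.tsum fun t => (hB t).mul (hpm t).1
    have m3 : Measurable fun ω => ∑' t, ENNReal.ofReal (M.cumDiscount t ω) *
        (u (q t ω)).toENNReal := Measurable.tsum fun t => (hB t).mul (hqm t).1
    have mg : Measurable fun ω => ∑' t, g t ω := Measurable.tsum hg
    have ml : Measurable fun ω => ∑' t, l t ω := Measurable.tsum hl
    rw [← lintegral_add_left m1, ← lintegral_add_right _ mg, ← lintegral_add_left m3,
      ← lintegral_add_right _ ml]
    refine lintegral_mono_ae ?_
    filter_upwards [h] with ω hω
    rw [← ENNReal.tsum_add, ← ENNReal.tsum_add, ← ENNReal.tsum_add, ← ENNReal.tsum_add]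
    exact ENNReal.tsum_le_tsum hω
  have hPp := M.posValue_lt_top hu hM z hp.1
  have hPq := M.posValue_lt_top hu hM z hq
  have hNp := hp.negValue_lt_top hu hM ha
  have hval := hp.2 q hq
  rw [value_eq, value_eq] at hval
  generalize M.posValue u z p = Pp at *
  generalize M.posValue u z q = Pq at *
  generalize M.negValue u z p = Np at *
  generalize M.negValue u z q = Nq at *
  generalize ∫⁻ ω, ∑' t, g t ω ∂M.law z = Ig at *
  generalize ∫⁻ ω, ∑' t, l t ω ∂M.law z = Il at *
  -- If the perturbed plan has value -∞, the summed inequality has `⊤` on the left while all utility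
  -- terms on the right are finite, so the loss itself is infinite.
  by_cases hNq : Nq = ⊤
  · have : Il = ⊤ := by
      by_contra hIl
      rw [hNq] at hs
      simp only [add_top, top_add, top_le_iff] at hs
      exact ENNReal.add_ne_top.2 ⟨ENNReal.add_ne_top.2 ⟨hPq.ne, hNp.ne⟩, hIl⟩ hs
    simp [this]
  lift Pp to NNReal using hPp.ne
  lift Pq to NNReal using hPq.ne
  lift Np to NNReal using hNp.ne
  lift Nq to NNReal using hNq
  have hle : Pq + Np ≤ Pp + Nq := by
    have h1 : ((Pq : ℝ) : EReal) - ((Nq : ℝ) : EReal) ≤ ((Pp : ℝ) : EReal) - ((Np : ℝ) : EReal) :=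
      hval
    rw [← EReal.coe_sub, ← EReal.coe_sub, EReal.coe_le_coe_iff] at h1
    rw [← NNReal.coe_le_coe]
    push_cast
    linarith
  have hle' : (Pq : ℝ≥0∞) + Np ≤ Pp + Nq := by exact_mod_cast hle
  have : (Pp : ℝ≥0∞) + Nq + Ig ≤ Pp + Nq + Il := hs.trans (by gcongr)
  exact (ENNReal.add_le_add_iff_left (by simp)).1 this

end Environment

end IncomeFluctuation

/-! ### Borrowing and saving perturbations of an optimal plan -/

namespace IncomeFluctuation

variable {N : ℕ} {E F G : Type*} [MeasurableSpace E] [MeasurableSpace F] [MeasurableSpace G]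

namespace Environment

variable {M : Environment N E F G} {u : ℝ → EReal} {a h : ℝ} {z : Fin N} {p : Plan N E F G}
  {S : Set (ℕ → Shock N E F G)}

open Classical in
/-- The perturbation of a plan `p` that consumes `h` more in period `0` and, on the event `S`,
pays it back with interest in period `1`. -/
def shifted (M : Environment N E F G) (p : Plan N E F G) (h : ℝ)
    (S : Set (ℕ → Shock N E F G)) : Plan N E F G
  | 0, ω => p 0 ω + h
  | 1, ω => if ω ∈ S then p 1 ω - M.ret (ω 0) * h else p 1 ω
  | t + 2, ω => p (t + 2) ω

lemma isFeasible_capped_shifted (ha : 0 ≤ a) (hp : M.IsFeasible a p) (h0 : ∀ ω, 0 ≤ p 0 ω + h)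
    (hS : MeasurableSet[info N E F G 1] S) (hS0 : ∀ ω ∈ S, M.ret (ω 0) * h ≤ p 1 ω) :
    M.IsFeasible a (M.capped a (M.shifted p h S)) := by
  refine isFeasible_capped ha (fun t => ?_) fun t ω => ?_
  · match t with
    | 0 => exact (hp 0).1.add_const h
    | 1 =>
      have h1 := M.measurable_ret.comp (measurable_info_eval (N := N) (E := E) (F := F) (G := G)
        zero_lt_one)
      exact Measurable.ite hS ((hp 1).1.sub (h1.mul_const h)) (hp 1).1
    | t + 2 => exact (hp (t + 2)).1
  · match t with
    | 0 => exact h0 ω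
    | 1 =>
      by_cases hω : ω ∈ S
      · simpa [shifted, hω] using hS0 ω hω
      · simpa [shifted, hω] using ((hp 1).2 ω).1
    | t + 2 => exact ((hp (t + 2)).2 ω).1

lemma capped_shifted_zero {ω : ℕ → Shock N E F G} (h0 : p 0 ω + h ≤ a) :
    M.capped a (M.shifted p h S) 0 ω = p 0 ω + h :=
  min_eq_left h0

lemma cappedWealth_shifted_one {ω : ℕ → Shock N E F G} (h0 : p 0 ω + h ≤ a) :
    M.cappedWealth a (M.shifted p h S) 1 ω = M.wealth a p 1 ω - M.ret (ω 0) * h := by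
  rw [cappedWealth_succ, capped_shifted_zero h0]
  simp only [cappedWealth, wealth]
  ring

lemma capped_shifted_one_of_mem (hp : M.IsFeasible a p) {ω : ℕ → Shock N E F G}
    (h0 : p 0 ω + h ≤ a) (hω : ω ∈ S) :
    M.capped a (M.shifted p h S) 1 ω = p 1 ω - M.ret (ω 0) * h := by
  rw [capped, cappedWealth_shifted_one h0]
  simp only [shifted, if_pos hω]
  exact min_eq_left (sub_le_sub_right ((hp 1).2 ω).2 _)

/-- Wealth and consumption of period 1 are both lowered by R h, so what is saved in period 1 is
unchanged and the two plans agree from period 2 on. -/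
lemma cappedWealth_shifted_of_mem (hp : M.IsFeasible a p) {ω : ℕ → Shock N E F G}
    (h0 : p 0 ω + h ≤ a) (hω : ω ∈ S) (t : ℕ) :
    M.cappedWealth a (M.shifted p h S) (t + 2) ω = M.wealth a p (t + 2) ω := by
  induction t with
  | zero =>
    rw [zero_add, cappedWealth_succ, cappedWealth_shifted_one h0,
      capped_shifted_one_of_mem hp h0 hω, sub_sub_sub_cancel_right]
    rfl
  | succ t ih =>
    rw [cappedWealth_succ, capped, ih, wealth]
    congr 3
    exact min_eq_left ((hp (t + 2)).2 ω).2

lemma capped_shifted_of_mem (hp : M.IsFeasible a p) {ω : ℕ → Shock N E F G}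
    (h0 : p 0 ω + h ≤ a) (hω : ω ∈ S) (t : ℕ) :
    M.capped a (M.shifted p h S) (t + 2) ω = p (t + 2) ω := by
  rw [capped, cappedWealth_shifted_of_mem hp h0 hω]
  exact min_eq_left ((hp (t + 2)).2 ω).2

lemma capped_shifted_of_notMem {ω : ℕ → Shock N E F G} (hω : ω ∉ S) (t : ℕ) :
    M.capped a (M.shifted p h S) (t + 1) ω =
      min (p (t + 1) ω) (M.cappedWealth a (M.shifted p h S) (t + 1) ω) := by
  cases t with
  | zero => simp only [capped, shifted, zero_add, if_neg hω]
  | succ t => rfl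

/-- Consuming the smaller one of the old consumption and the new wealth never widens the gap in
savings beyond the gap in wealth, so the debt grows at most by the gross returns. -/
lemma cappedWealth_shifted_of_notMem (hp : M.IsFeasible a p) {ω : ℕ → Shock N E F G}
    (h0 : p 0 ω + h ≤ a) (hh : 0 ≤ h) (hω : ω ∉ S) (t : ℕ) :
    M.cappedWealth a (M.shifted p h S) (t + 1) ω ≤ M.wealth a p (t + 1) ω ∧
    M.wealth a p (t + 1) ω - M.cappedWealth a (M.shifted p h S) (t + 1) ω ≤
      (∏ i ∈ Finset.range (t + 1), M.ret (ω i)) * h := by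
  induction t with
  | zero =>
    rw [zero_add, cappedWealth_shifted_one h0]
    have := mul_nonneg (M.ret_nonneg (ω 0)) hh
    simp [this]
  | succ t ih =>
    rw [cappedWealth_succ, capped_shifted_of_notMem hω, wealth, Finset.prod_range_succ]
    set V := M.cappedWealth a (M.shifted p h S) (t + 1) ω
    set W := M.wealth a p (t + 1) ω
    have hR := M.ret_nonneg (ω (t + 1))
    have hpW := ((hp (t + 1)).2 ω).2
    have h1 : V - min (p (t + 1) ω) V ≤ W - p (t + 1) ω := by
      rcases min_cases (p (t + 1) ω) V with hm | hm <;> linarith [ih.1]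
    have h2 : W - p (t + 1) ω - (V - min (p (t + 1) ω) V) ≤
        (∏ i ∈ Finset.range (t + 1), M.ret (ω i)) * h := by
      linarith [ih.2, min_le_left (p (t + 1) ω) V]
    constructor
    · gcongr
    · calc _ = M.ret (ω (t + 1)) * (W - p (t + 1) ω - (V - min (p (t + 1) ω) V)) := by ring
        _ ≤ M.ret (ω (t + 1)) * ((∏ i ∈ Finset.range (t + 1), M.ret (ω i)) * h) := by gcongr
        _ = _ := by ring

/-- The summands of `debtCost`. -/
def debtTerm (M : Environment N E F G) (u : ℝ → EReal) (t : ℕ) (ω : ℕ → Shock N E F G) : ℝ≥0∞ :=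
  (∏ i ∈ Finset.range t, shockFun (fun z e f => M.β z e * M.R z f) (ω i)) *
    (shockFun (fun z e f => M.β z e * M.R z f) (ω t) * extMarginal u (M.Y (ω t).1 (ω t).2.2.2))

/-- A bound for the utility cost of a unit of debt that is rolled over until it binds. -/
def debtCost (M : Environment N E F G) (u : ℝ → EReal) (ω : ℕ → Shock N E F G) : ℝ≥0∞ :=
  ∑' t, M.debtTerm u t ω

/-- Separates the discount factor, the accumulated value of one unit of debt and the marginal
utility of income, the three factors of the pathwise loss. -/
lemma debtTerm_eq (t : ℕ) (ω : ℕ → Shock N E F G) :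
    M.debtTerm u t ω = ENNReal.ofReal (M.cumDiscount (t + 1) ω) *
      ENNReal.ofReal (∏ i ∈ Finset.range (t + 1), M.ret (ω i)) *
        extMarginal u (M.income (ω t)) := by
  have h : ∀ s : Shock N E F G, shockFun (fun z e f => M.β z e * M.R z f) s =
      ENNReal.ofReal (M.discount s) * ENNReal.ofReal (M.ret s) := fun s =>
    ENNReal.ofReal_mul (M.discount_nonneg s)
  rw [debtTerm, ← mul_assoc, ← Finset.prod_range_succ, Finset.prod_congr rfl fun i _ => h (ω i),
    Finset.prod_mul_distrib, cumDiscount, ENNReal.ofReal_prod_of_nonneg fun _ _ => M.ret_nonneg _,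
    ENNReal.ofReal_prod_of_nonneg fun _ _ => M.discount_nonneg _]
  rfl

lemma measurable_debtTerm (hu : IsInada u) (t : ℕ) : Measurable (M.debtTerm u t) := by
  have hk := measurable_shockFun (G := G) (X := fun z e f => M.β z e * M.R z f)
    M.measurable_βR_prod
  have h1 : Measurable fun s : Shock N E F G => extMarginal u (M.income s) :=
    hu.measurable_extMarginal.comp M.measurable_income
  exact (Finset.measurable_fun_prod _ fun i _ => hk.comp (measurable_pi_apply i)).mul
    ((hk.comp (measurable_pi_apply t)).mul (h1.comp (measurable_pi_apply t)))

lemma measurable_debtCost (hu : IsInada u) : Measurable (M.debtCost u) :=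
  Measurable.tsum fun t => measurable_debtTerm hu t

lemma IsSpectral.exists_debtCost_le (hM : M.IsSpectral u) (hu : IsInada u) :
    ∃ C < ⊤, ∀ z, ∫⁻ ω, M.debtCost u ω ∂M.law z ≤ C :=
  M.exists_lintegral_tsum_le M.measurable_βR_prod
    (fun z e f => mul_nonneg (M.β_nonneg z e) (M.R_nonneg z f)) hM.integrable_βR hM.specRad_βR
    (g := fun z y => extMarginal u (M.Y z y))
    (fun z => hu.measurable_extMarginal.comp (M.measurable_Y z)) hM.lintegral_marginal

lemma measurable_marginal : Measurable (marginal u) := measurable_deriv _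

/-- Consuming `h` more today is not profitable, whether it is paid back tomorrow (on `S`) or rolled
over until the debt binds. -/
lemma IsSolution.marginal_le_of_borrow (hu : IsInada u) (hM : M.IsSpectral u) (ha : 0 < a)
    (hp : M.IsSolution u a z p) {c₀ : ℝ} (hc₀ : ∀ ω, p 0 ω = c₀) (hh : 0 < h) (hha : c₀ + h ≤ a)
    (hS : MeasurableSet[info N E F G 1] S) (hS0 : ∀ ω ∈ S, M.ret (ω 0) * h < p 1 ω) :
    ENNReal.ofReal (marginal u (c₀ + h)) ≤
      ∫⁻ ω, S.indicator (fun ω => ENNReal.ofReal (M.discount (ω 0) * M.ret (ω 0) *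
        marginal u (p 1 ω - M.ret (ω 0) * h))) ω + Sᶜ.indicator (M.debtCost u) ω ∂M.law z := by
  have hc₀0 : 0 ≤ c₀ := by
    obtain ⟨ω⟩ : Nonempty (ℕ → Shock N E F G) := nonempty_of_isProbabilityMeasure (M.law z)
    exact hc₀ ω ▸ ((hp.1 0).2 ω).1
  have hc0 : 0 < c₀ + h := by linarith
  have h0 : ∀ ω, p 0 ω + h ≤ a := fun ω => by rw [hc₀]; exact hha
  set q := M.capped a (M.shifted p h S) with hqdef
  have hq : M.IsFeasible a q := isFeasible_capped_shifted ha.le hp.1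
    (fun ω => by rw [hc₀]; linarith) hS fun ω hω => (hS0 ω hω).le
  have hSm : MeasurableSet S := info_le 1 _ hS
  set r : (ℕ → Shock N E F G) → ℝ≥0∞ := fun ω => ENNReal.ofReal (M.discount (ω 0) * M.ret (ω 0) *
    marginal u (p 1 ω - M.ret (ω 0) * h))
  have hr : Measurable r := by
    have h1 : Measurable fun ω : ℕ → Shock N E F G => M.ret (ω 0) :=
      M.measurable_ret.comp (measurable_pi_apply 0)
    have h2 : Measurable fun ω : ℕ → Shock N E F G => M.discount (ω 0) :=
      M.measurable_discount.comp (measurable_pi_apply 0)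
    have h3 := (hp.1 1).1.mono (info_le 1) le_rfl
    exact ((h2.mul h1).mul (measurable_marginal.comp (h3.sub (h1.mul_const h)))).ennreal_ofReal
  set g : ℕ → (ℕ → Shock N E F G) → ℝ≥0∞ := fun t _ =>
    if t = 0 then ENNReal.ofReal h * ENNReal.ofReal (marginal u (c₀ + h)) else 0
  -- On S the only loss is the repayment in period 1. Off S a cut is allowed for in every period,
  -- since it is not known when the debt binds.
  set l : ℕ → (ℕ → Shock N E F G) → ℝ≥0∞ := fun t ω => match t with
    | 0 => 0
    | t + 1 => ENNReal.ofReal h *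
      ((if t = 0 then S.indicator r ω else 0) + Sᶜ.indicator (M.debtTerm u t) ω)
  have hl : ∀ t, Measurable (l t) := by
    intro t
    match t with
    | 0 => exact measurable_const
    | t + 1 =>
      refine Measurable.const_mul (Measurable.add ?_ ?_) _
      · by_cases ht : t = 0
        · simp only [ht, if_true]; exact hr.indicator hSm
        · simp only [ht, if_false]; exact measurable_const
      · exact (measurable_debtTerm hu t).indicator hSm.compl
  have key := hp.lintegral_gain_le hu hM ha hq (g := g) (l := l) (fun t => measurable_const) hl (by
    filter_upwards [hM.income_pos hu z] with ω hY t
    match t with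
    | 0 =>
      have h1 := hu.gain hc₀0 hc0 (by linarith)
      have hq0 : q 0 ω = c₀ + h := by rw [hqdef, capped_shifted_zero (h0 ω), hc₀]
      rw [add_sub_cancel_left, mul_comm, ENNReal.ofReal_mul hh.le] at h1
      simpa [g, l, cumDiscount, hq0, hc₀] using h1
    | t + 1 =>
      simp only [g, l, Nat.succ_ne_zero, if_false, add_zero]
      by_cases hω : ω ∈ S
      · cases t with
        | zero =>
          have hq1 : q 1 ω = p 1 ω - M.ret (ω 0) * h := by
            rw [hqdef, capped_shifted_one_of_mem hp.1 (h0 ω) hω]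
          have hlt := hS0 ω hω
          have hRh : 0 ≤ M.ret (ω 0) * h := mul_nonneg (M.ret_nonneg _) hh.le
          have h1 := hu.loss (sub_pos.2 hlt) (sub_le_self _ hRh)
          have h2 := mul_le_mul_right h1 (ENNReal.ofReal (M.cumDiscount 1 ω))
          simp only [zero_add, hq1, if_true, Set.indicator_of_mem hω,
            Set.indicator_of_notMem (Set.notMem_compl_iff.2 hω), add_zero]
          rw [← mul_add, ← mul_add]
          refine h2.trans (le_of_eq ?_)
          rw [mul_add]
          congr 1
          simp only [r, cumDiscount, Finset.prod_range_one]
          rw [← ENNReal.ofReal_mul (M.discount_nonneg _), ← ENNReal.ofReal_mul hh.le]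
          congr 1
          ring
        | succ t =>
          have hqt : q (t + 1 + 1) ω = p (t + 1 + 1) ω := capped_shifted_of_mem hp.1 (h0 ω) hω t
          rw [hqt]
          exact le_self_add
      · have hqt : q (t + 1) ω = _ := capped_shifted_of_notMem hω t
        obtain ⟨hV1, hV2⟩ := cappedWealth_shifted_of_notMem hp.1 (h0 ω) hh.le hω t
        have hV3 := M.income_le_cappedWealth a (M.shifted p h S) t ω
        set V := M.cappedWealth a (M.shifted p h S) (t + 1) ω
        -- Consumption is cut only if it exceeds the wealth V. Then V is still at least income, so
        -- marginal utility is at most u'(Y), and the cut is at most the shortfall of wealth, that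
        -- is, the accumulated debt.
        rcases le_total (p (t + 1) ω) V with hle | hle
        · rw [hqt, min_eq_left hle]
          exact le_self_add
        · rw [hqt, min_eq_right hle]
          have hVpos : 0 < V := (hY t).trans_le hV3
          have h2 := mul_le_mul_right (hu.loss hVpos hle) (ENNReal.ofReal (M.cumDiscount (t + 1) ω))
          rw [← mul_add, ← mul_add]
          refine h2.trans ?_
          rw [mul_add]
          refine add_le_add le_rfl ?_
          rw [Set.indicator_of_mem (Set.mem_compl hω), debtTerm_eq, extMarginal, if_pos (hY t)]
          have hprod : 0 ≤ ∏ i ∈ Finset.range (t + 1), M.ret (ω i) :=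
            Finset.prod_nonneg fun _ _ => M.ret_nonneg _
          have hbd : marginal u V * (p (t + 1) ω - V) ≤
              marginal u (M.income (ω t)) * ((∏ i ∈ Finset.range (t + 1), M.ret (ω i)) * h) := by
            have hf := hu.marginal_pos _ hVpos
            have := hu.marginal_le (hY t) hV3
            have h3 : p (t + 1) ω - V ≤ (∏ i ∈ Finset.range (t + 1), M.ret (ω i)) * h := by
              linarith [((hp.1 (t + 1)).2 ω).2]
            exact mul_le_mul this h3 (by linarith) (hf.le.trans this)
          calc _ ≤ ENNReal.ofReal (M.cumDiscount (t + 1) ω) * ENNReal.ofReal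
                (marginal u (M.income (ω t)) *
                  ((∏ i ∈ Finset.range (t + 1), M.ret (ω i)) * h)) := by gcongr
            _ = ENNReal.ofReal h * (ENNReal.ofReal (M.cumDiscount (t + 1) ω) *
                ENNReal.ofReal (∏ i ∈ Finset.range (t + 1), M.ret (ω i)) *
                ENNReal.ofReal (marginal u (M.income (ω t)))) := by
              rw [ENNReal.ofReal_mul (hu.marginal_pos _ (hY t)).le, ENNReal.ofReal_mul hprod]
              ring
            _ ≤ _ := by gcongr; exact le_add_self)
  have hgs : ∀ ω : ℕ → Shock N E F G, ∑' t, g t ω =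
      ENNReal.ofReal h * ENNReal.ofReal (marginal u (c₀ + h)) := fun ω => by
    simp only [g]; exact tsum_ite_eq 0 _
  have hls : ∀ ω, ∑' t, l t ω =
      ENNReal.ofReal h * (S.indicator r ω + Sᶜ.indicator (M.debtCost u) ω) := fun ω => by
    rw [tsum_eq_zero_add' ENNReal.summable]
    simp only [l, zero_add]
    rw [ENNReal.tsum_mul_left, ENNReal.tsum_add, tsum_ite_eq]
    congr 2
    by_cases hω : ω ∈ S
    · simp [hω]
    · simp [hω, debtCost]
  simp_rw [hgs, hls] at key
  have hm : Measurable fun ω => S.indicator r ω + Sᶜ.indicator (M.debtCost u) ω :=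
    (hr.indicator hSm).add ((measurable_debtCost hu).indicator hSm.compl)
  rw [lintegral_const, measure_univ, mul_one, lintegral_const_mul _ hm] at key
  exact (ENNReal.mul_le_mul_iff_right (by simpa using hh) ENNReal.ofReal_ne_top).1 key

/-- Consuming `h` less today in order to consume more tomorrow is not profitable. -/
lemma IsSolution.lintegral_le_of_save (hu : IsInada u) (hM : M.IsSpectral u) (ha : 0 < a)
    (hp : M.IsSolution u a z p) {c₀ : ℝ} (hc₀ : ∀ ω, p 0 ω = c₀) (hca : c₀ ≤ a) (hh : 0 < h)
    (hhc : h < c₀) (hp1 : ∀ᵐ ω ∂M.law z, 0 < p 1 ω) :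
    ∫⁻ ω, ENNReal.ofReal (M.discount (ω 0) * M.ret (ω 0) *
        marginal u (p 1 ω + M.ret (ω 0) * h)) ∂M.law z ≤
      ENNReal.ofReal (marginal u (c₀ - h)) := by
  have h0 : ∀ ω, p 0 ω + -h ≤ a := fun ω => by rw [hc₀]; linarith
  -- Saving is borrowing with reversed sign. The proceeds can always be consumed in period 1, so the
  -- event is the whole space.
  set q := M.capped a (M.shifted p (-h) Set.univ) with hqdef
  have hRh : ∀ ω : ℕ → Shock N E F G, 0 ≤ M.ret (ω 0) * h := fun ω =>
    mul_nonneg (M.ret_nonneg _) hh.le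
  have hq : M.IsFeasible a q := isFeasible_capped_shifted ha.le hp.1
    (fun ω => by rw [hc₀]; linarith) MeasurableSet.univ fun ω _ => by
      have := ((hp.1 1).2 ω).1
      have := hRh ω
      linarith
  set r : (ℕ → Shock N E F G) → ℝ≥0∞ := fun ω => ENNReal.ofReal (M.discount (ω 0) * M.ret (ω 0) *
    marginal u (p 1 ω + M.ret (ω 0) * h))
  have hr : Measurable r := by
    have h1 : Measurable fun ω : ℕ → Shock N E F G => M.ret (ω 0) :=
      M.measurable_ret.comp (measurable_pi_apply 0)
    have h2 : Measurable fun ω : ℕ → Shock N E F G => M.discount (ω 0) :=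
      M.measurable_discount.comp (measurable_pi_apply 0)
    have h3 := (hp.1 1).1.mono (info_le 1) le_rfl
    exact ((h2.mul h1).mul (measurable_marginal.comp (h3.add (h1.mul_const h)))).ennreal_ofReal
  set g : ℕ → (ℕ → Shock N E F G) → ℝ≥0∞ := fun t ω => if t = 1 then ENNReal.ofReal h * r ω else 0
  set l : ℕ → (ℕ → Shock N E F G) → ℝ≥0∞ := fun t _ =>
    if t = 0 then ENNReal.ofReal h * ENNReal.ofReal (marginal u (c₀ - h)) else 0
  have hg : ∀ t, Measurable (g t) := fun t => by
    by_cases ht : t = 1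
    · simp only [g, ht, if_true]; exact hr.const_mul _
    · simp only [g, ht, if_false]; exact measurable_const
  have key := hp.lintegral_gain_le hu hM ha hq (g := g) (l := l) hg (fun t => measurable_const) (by
    filter_upwards [hp1] with ω hω t
    match t with
    | 0 =>
      have h1 := hu.loss (sub_pos.2 hhc) (sub_le_self _ hh.le)
      have hq0 : q 0 ω = c₀ - h := by rw [hqdef, capped_shifted_zero (h0 ω), hc₀]; ring
      rw [sub_sub_cancel, mul_comm (marginal _ _), ENNReal.ofReal_mul hh.le] at h1
      simpa [g, l, cumDiscount, hq0, hc₀] using h1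
    | 1 =>
      have hq1 : q 1 ω = p 1 ω + M.ret (ω 0) * h := by
        rw [hqdef, capped_shifted_one_of_mem hp.1 (h0 ω) (Set.mem_univ _)]; ring
      have h1 := hu.gain hω.le (add_pos_of_pos_of_nonneg hω (hRh ω))
        (le_add_of_nonneg_right (hRh ω))
      have h2 := mul_le_mul_right h1 (ENNReal.ofReal (M.cumDiscount 1 ω))
      simp only [g, l, hq1, if_true, one_ne_zero, if_false, add_zero]
      rw [← mul_add, ← mul_add]
      refine le_trans (le_of_eq ?_) h2
      conv_rhs => rw [mul_add]
      congr 1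
      simp only [r, cumDiscount, Finset.prod_range_one]
      rw [← ENNReal.ofReal_mul (M.discount_nonneg _), ← ENNReal.ofReal_mul hh.le]
      congr 1
      ring
    | t + 2 =>
      have hqt : q (t + 2) ω = p (t + 2) ω := capped_shifted_of_mem hp.1 (h0 ω) (Set.mem_univ _) t
      rw [hqt]
      simp [g, l])
  have hgs : ∀ ω : ℕ → Shock N E F G, ∑' t, g t ω = ENNReal.ofReal h * r ω := fun ω => by
    simp only [g]; exact tsum_ite_eq 1 _
  have hls : ∀ ω, ∑' t, l t ω = ENNReal.ofReal h * ENNReal.ofReal (marginal u (c₀ - h)) :=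
    fun ω => by simp only [l]; exact tsum_ite_eq 0 _
  simp_rw [hgs, hls] at key
  rw [lintegral_const, measure_univ, mul_one, lintegral_const_mul _ hr] at key
  exact (ENNReal.mul_le_mul_iff_right (by simpa using hh) ENNReal.ofReal_ne_top).1 key

end Environment

end IncomeFluctuation

/-! ### The Euler equation -/

namespace IncomeFluctuation

variable {N : ℕ} {E F G : Type*} [MeasurableSpace E] [MeasurableSpace F] [MeasurableSpace G]

namespace Environment

variable {M : Environment N E F G} {u : ℝ → EReal} {c : ℝ → Fin N → ℝ}

/-- Next period's wealth under the consumption function `c`. -/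
def nextWealth (M : Environment N E F G) (c : ℝ → Fin N → ℝ) (a : ℝ) (z : Fin N)
    (s : Shock N E F G) : ℝ :=
  M.ret s * (a - c a z) + M.income s

/-- Next period's discounted marginal value of wealth, as seen from today. -/
def nextMarginal (M : Environment N E F G) (u : ℝ → EReal) (c : ℝ → Fin N → ℝ) (a : ℝ)
    (z : Fin N) (s : Shock N E F G) : ℝ≥0∞ :=
  ENNReal.ofReal (M.discount s * M.ret s * marginal u (c (M.nextWealth c a z s) s.1))

namespace IsConsumptionFunction

variable (hc : M.IsConsumptionFunction u c)
include hc

lemma bounds {a : ℝ} (ha : 0 < a) (z : Fin N) : 0 ≤ c a z ∧ c a z ≤ a := by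
  obtain ⟨ω⟩ : Nonempty (ℕ → Shock N E F G) := nonempty_of_isProbabilityMeasure (M.law z)
  exact ((hc a ha z).1 0).2 ω

lemma income_le_nextWealth {a : ℝ} (ha : 0 < a) (z : Fin N) (s : Shock N E F G) :
    M.income s ≤ M.nextWealth c a z s :=
  le_add_of_nonneg_left (mul_nonneg (M.ret_nonneg _) (sub_nonneg.2 (hc.bounds ha z).2))

/-- Where the borrowing constraint does not bind, consumption is positive and its marginal utility
is bounded. -/
lemma exists_marginal_le_of_lt (hu : IsInada u) (hM : M.IsSpectral u) :
    ∃ C : ℝ, 0 ≤ C ∧ ∀ a, 0 < a → ∀ z, c a z < a → 0 < c a z ∧ marginal u (c a z) ≤ C := by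
  obtain ⟨C, hC, hle⟩ := hM.exists_debtCost_le hu
  refine ⟨C.toReal, ENNReal.toReal_nonneg, fun a ha z hlt => ?_⟩
  have hb : ∀ h, 0 < h → c a z + h ≤ a → marginal u (c a z + h) ≤ C.toReal := by
    intro h hh hha
    -- With S empty the debt is always rolled over, and its expected cost has a bound that depends
    -- neither on wealth nor on the state.
    have h1 := (hc a ha z).marginal_le_of_borrow hu hM ha (c₀ := c a z) (fun ω => rfl) hh hha
      (S := ∅) (@MeasurableSet.empty _ (_)) (fun ω hω => absurd hω (Set.notMem_empty ω))
    simp only [Set.indicator_empty, zero_add, Set.compl_empty, Set.indicator_univ] at h1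
    exact (ENNReal.ofReal_le_iff_le_toReal hC.ne).1 (h1.trans (hle z))
  have hev : ∀ᶠ h in 𝓝[>] (0 : ℝ), 0 < h ∧ c a z + h ≤ a := by
    filter_upwards [Ioo_mem_nhdsGT (sub_pos.2 hlt)] with h hh
    exact ⟨hh.1, by linarith [hh.2]⟩
  -- Zero consumption would give u'(h) ≤ C for all small h, contrary to u'(0) = ∞.
  have hpos : 0 < c a z := by
    refine lt_of_le_of_ne (hc.bounds ha z).1 fun h0 => ?_
    obtain ⟨h, hh, h1, h2⟩ := ((hu.tendsto_zero.eventually_gt_atTop C.toReal).and hev).exists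
    have := hb h h1 h2
    rw [← h0, zero_add] at this
    linarith
  refine ⟨hpos, ?_⟩
  have hlim : Tendsto (fun h => marginal u (c a z + h)) (𝓝[>] 0) (𝓝 (marginal u (c a z))) := by
    have h1 : Tendsto (fun h => c a z + h) (𝓝[>] 0) (𝓝 (c a z)) := by
      have : Tendsto (fun h : ℝ => c a z + h) (𝓝 0) (𝓝 (c a z + 0)) :=
        Continuous.tendsto (by fun_prop) _
      rw [add_zero] at this
      exact this.mono_left nhdsWithin_le_nhds
    exact (hu.continuousAt_marginal hpos).tendsto.comp h1
  refine le_of_tendsto hlim ?_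
  filter_upwards [hev] with h hh using hb h hh.1 hh.2

lemma pos (hu : IsInada u) (hM : M.IsSpectral u) {a : ℝ} (ha : 0 < a) (z : Fin N) :
    0 < c a z := by
  obtain ⟨C, -, hC⟩ := hc.exists_marginal_le_of_lt hu hM
  rcases (hc.bounds ha z).2.lt_or_eq with h | h
  · exact (hC a ha z h).1
  · rw [h]; exact ha

/-- Either c(a, z) = a or the bound for a slack constraint applies. This uniform comparison with
u'(a) supplies the envelope for dominated convergence and the starting bound in `mul_le`. -/
lemma exists_marginal_le (hu : IsInada u) (hM : M.IsSpectral u) :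
    ∃ C : ℝ, 0 ≤ C ∧ ∀ a, 0 < a → ∀ z, marginal u (c a z) ≤ marginal u a + C := by
  obtain ⟨C, hC0, hC⟩ := hc.exists_marginal_le_of_lt hu hM
  refine ⟨C, hC0, fun a ha z => ?_⟩
  rcases (hc.bounds ha z).2.lt_or_eq with h | h
  · linarith [(hC a ha z h).2, hu.marginal_pos a ha]
  · rw [h]; linarith

lemma policyPlan_one_pos (hu : IsInada u) (hM : M.IsSpectral u) {a : ℝ} (ha : 0 < a)
    (z : Fin N) : ∀ᵐ ω ∂M.law z, 0 < M.policyPlan c a z 1 ω := by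
  filter_upwards [hM.income_pos hu z] with ω hω
  exact hc.pos hu hM ((hω 0).trans_le (hc.income_le_nextWealth ha z (ω 0))) _

lemma measurable_nextMarginal {a : ℝ} (ha : 0 < a) (z : Fin N) :
    Measurable fun ω : ℕ → Shock N E F G => M.nextMarginal u c a z (ω 0) := by
  have h1 : Measurable fun ω : ℕ → Shock N E F G => M.ret (ω 0) :=
    M.measurable_ret.comp (measurable_pi_apply 0)
  have h2 : Measurable fun ω : ℕ → Shock N E F G => M.discount (ω 0) :=
    M.measurable_discount.comp (measurable_pi_apply 0)
  have h3 := ((hc a ha z).1 1).1.mono (info_le 1) le_rfl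
  exact ((h2.mul h1).mul (measurable_marginal.comp h3)).ennreal_ofReal

/-- One half of the Euler equation. -/
lemma lintegral_nextMarginal_le (hu : IsInada u) (hM : M.IsSpectral u) {a : ℝ} (ha : 0 < a)
    (z : Fin N) :
    ∫⁻ ω, M.nextMarginal u c a z (ω 0) ∂M.law z ≤ ENNReal.ofReal (marginal u (c a z)) := by
  have hpos := hc.pos hu hM ha z
  have hp1 := hc.policyPlan_one_pos hu hM ha z
  -- The denominator k + 2 keeps the amount saved strictly below c(a, z). Fatou's lemma along this
  -- sequence suffices for an upper bound on the integral.
  set h : ℕ → ℝ := fun k => c a z / (k + 2)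
  have hh0 : ∀ k, 0 < h k := fun k => by positivity
  have hh1 : ∀ k, h k < c a z := fun k => by
    rw [div_lt_iff₀ (by positivity)]
    have : (0 : ℝ) ≤ k := Nat.cast_nonneg k
    nlinarith
  have hh : Tendsto h atTop (𝓝 0) :=
    tendsto_const_nhds.div_atTop
      (tendsto_atTop_add_const_right _ _ tendsto_natCast_atTop_atTop)
  have hle := fun k => (hc a ha z).lintegral_le_of_save hu hM ha (c₀ := c a z) (fun ω => rfl)
    (hc.bounds ha z).2 (hh0 k) (hh1 k) hp1
  have hm : ∀ k, Measurable fun ω : ℕ → Shock N E F G =>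
      ENNReal.ofReal (M.discount (ω 0) * M.ret (ω 0) *
        marginal u (M.policyPlan c a z 1 ω + M.ret (ω 0) * h k)) := fun k => by
    have h1 : Measurable fun ω : ℕ → Shock N E F G => M.ret (ω 0) :=
      M.measurable_ret.comp (measurable_pi_apply 0)
    have h2 : Measurable fun ω : ℕ → Shock N E F G => M.discount (ω 0) :=
      M.measurable_discount.comp (measurable_pi_apply 0)
    have h3 := ((hc a ha z).1 1).1.mono (info_le 1) le_rfl
    exact ((h2.mul h1).mul (measurable_marginal.comp (h3.add (h1.mul_const _)))).ennreal_ofReal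
  have hlimr : Tendsto (fun k => ENNReal.ofReal (marginal u (c a z - h k))) atTop
      (𝓝 (ENNReal.ofReal (marginal u (c a z)))) := by
    refine ENNReal.tendsto_ofReal ((hu.continuousAt_marginal hpos).tendsto.comp ?_)
    simpa using hh.const_sub (c a z)
  calc ∫⁻ ω, M.nextMarginal u c a z (ω 0) ∂M.law z
      = ∫⁻ ω, liminf (fun k => ENNReal.ofReal (M.discount (ω 0) * M.ret (ω 0) *
          marginal u (M.policyPlan c a z 1 ω + M.ret (ω 0) * h k))) atTop ∂M.law z := by
        refine lintegral_congr_ae ?_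
        filter_upwards [hp1] with ω hω
        refine (Tendsto.liminf_eq ?_).symm
        refine ENNReal.tendsto_ofReal (Tendsto.const_mul _ ?_)
        refine (hu.continuousAt_marginal hω).tendsto.comp ?_
        simpa using (hh.const_mul (M.ret (ω 0))).const_add (M.policyPlan c a z 1 ω)
    _ ≤ liminf (fun k => ∫⁻ ω, ENNReal.ofReal (M.discount (ω 0) * M.ret (ω 0) *
          marginal u (M.policyPlan c a z 1 ω + M.ret (ω 0) * h k)) ∂M.law z) atTop :=
        lintegral_liminf_le hm
    _ ≤ liminf (fun k => ENNReal.ofReal (marginal u (c a z - h k))) atTop :=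
        liminf_le_liminf (Eventually.of_forall hle)
    _ = _ := hlimr.liminf_eq

/-- The other half of the Euler equation, where the borrowing constraint does not bind. -/
lemma le_lintegral_nextMarginal (hu : IsInada u) (hM : M.IsSpectral u) {D : ℝ}
    (hD : ∀ x, 0 < x → marginal u (x / 2) ≤ D * marginal u x) {a : ℝ} (ha : 0 < a)
    (z : Fin N) (hlt : c a z < a) :
    ENNReal.ofReal (marginal u (c a z)) ≤ ∫⁻ ω, M.nextMarginal u c a z (ω 0) ∂M.law z := by
  have hpos := hc.pos hu hM ha z
  have hp1 := hc.policyPlan_one_pos hu hM ha z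
  obtain ⟨C, hC0, hC⟩ := hc.exists_marginal_le hu hM
  have hD0 : 0 ≤ D := by
    by_contra! hneg
    have h1 := hD 1 one_pos
    have h2 := hu.marginal_pos (1 / 2) (by norm_num)
    have h3 := hu.marginal_pos 1 one_pos
    nlinarith
  set p := M.policyPlan c a z
  set h : ℕ → ℝ := fun k => (a - c a z) / (k + 1)
  have hac : 0 < a - c a z := sub_pos.2 hlt
  have hh0 : ∀ k, 0 < h k := fun k => by positivity
  have hh1 : ∀ k, c a z + h k ≤ a := fun k => by
    have : h k ≤ a - c a z := by
      rw [div_le_iff₀ (by positivity)]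
      have : (0 : ℝ) ≤ k := Nat.cast_nonneg k
      nlinarith
    linarith
  have hh : Tendsto h atTop (𝓝 0) :=
    tendsto_const_nhds.div_atTop
      (tendsto_atTop_add_const_right _ _ tendsto_natCast_atTop_atTop)
  -- Repayment is made where it costs at most half of next period's consumption. There the doubling
  -- constant D compares the marginal utility after repayment with u'(p 1). Almost every path
  -- belongs to S k for large k, so the rollover term vanishes in the limit.
  set S : ℕ → Set (ℕ → Shock N E F G) := fun k =>
    {ω | M.ret (ω 0) * h k ≤ p 1 ω / 2} ∩ {ω | 0 < p 1 ω}
  have hp1m : Measurable[info N E F G 1] (p 1) := ((hc a ha z).1 1).1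
  have hS : ∀ k, MeasurableSet[info N E F G 1] (S k) := fun k => by
    have h1 := M.measurable_ret.comp (measurable_info_eval (N := N) (E := E) (F := F) (G := G)
      zero_lt_one)
    have h2 : MeasurableSet[info N E F G 1] {ω | M.ret (ω 0) * h k ≤ p 1 ω / 2} :=
      measurableSet_le (h1.mul_const _) (hp1m.div_const 2)
    have h3 : MeasurableSet[info N E F G 1] {ω | 0 < p 1 ω} :=
      measurableSet_lt measurable_const hp1m
    exact h2.inter h3
  have hS0 : ∀ k, ∀ ω ∈ S k, M.ret (ω 0) * h k < p 1 ω := fun k ω hω => by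
    have h1 : M.ret (ω 0) * h k ≤ p 1 ω / 2 := hω.1
    have h2 : 0 < p 1 ω := hω.2
    linarith
  set r : ℕ → (ℕ → Shock N E F G) → ℝ≥0∞ := fun k ω =>
    ENNReal.ofReal (M.discount (ω 0) * M.ret (ω 0) * marginal u (p 1 ω - M.ret (ω 0) * h k))
  have hr : ∀ k, Measurable (r k) := fun k => by
    have h1 : Measurable fun ω : ℕ → Shock N E F G => M.ret (ω 0) :=
      M.measurable_ret.comp (measurable_pi_apply 0)
    have h2 : Measurable fun ω : ℕ → Shock N E F G => M.discount (ω 0) :=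
      M.measurable_discount.comp (measurable_pi_apply 0)
    exact ((h2.mul h1).mul (measurable_marginal.comp
      ((hp1m.mono (info_le 1) le_rfl).sub (h1.mul_const _)))).ennreal_ofReal
  set k₀ : Shock N E F G → ℝ≥0∞ := shockFun fun z e f => M.β z e * M.R z f
  have hk₀ : Measurable k₀ := measurable_shockFun M.measurable_βR_prod
  -- On S k the marginal utility after repayment is at most D (u'(Y) + C), and β R u'(Y) is the
  -- first summand of `debtCost`; off S k the bound is `debtCost` itself.
  set bound : (ℕ → Shock N E F G) → ℝ≥0∞ := fun ω =>
    (ENNReal.ofReal D + 1) * M.debtCost u ω + ENNReal.ofReal (D * C) * k₀ (ω 0)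
  have hbound : ∫⁻ ω, bound ω ∂M.law z ≠ ⊤ := by
    obtain ⟨C', hC', hle⟩ := hM.exists_debtCost_le hu
    have hkm : Measurable fun ω : ℕ → Shock N E F G => k₀ (ω 0) :=
      hk₀.comp (measurable_pi_apply 0)
    simp only [bound]
    rw [lintegral_add_left ((measurable_debtCost hu).const_mul _),
      lintegral_const_mul _ (measurable_debtCost hu), lintegral_const_mul _ hkm,
      M.lintegral_law_zero z hk₀]
    refine ENNReal.add_ne_top.2 ⟨ENNReal.mul_ne_top (by simp) ((hle z).trans_lt hC').ne,
      ENNReal.mul_ne_top ENNReal.ofReal_ne_top ?_⟩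
    have := M.lintegral_step_mul_lt_top z (X := fun z e f => M.β z e * M.R z f)
      M.measurable_βR_prod hM.integrable_βR
      (g := fun _ _ => 1) (fun _ => measurable_const) (fun _ => by simp)
    simpa [k₀] using this.ne
  have hdom : ∀ k, ∀ᵐ ω ∂M.law z,
      (S k).indicator (r k) ω + (S k)ᶜ.indicator (M.debtCost u) ω ≤ bound ω := fun k => by
    filter_upwards [hM.income_pos hu z] with ω hY
    by_cases hω : ω ∈ S k
    · rw [Set.indicator_of_mem hω, Set.indicator_of_notMem (Set.notMem_compl_iff.2 hω), add_zero]
      have h1 : M.ret (ω 0) * h k ≤ p 1 ω / 2 := hω.1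
      have h2 : 0 < p 1 ω := hω.2
      have hW := hc.income_le_nextWealth ha z (ω 0)
      have hf : marginal u (p 1 ω - M.ret (ω 0) * h k) ≤
          D * marginal u (M.income (ω 0)) + D * C := by
        calc _ ≤ marginal u (p 1 ω / 2) := hu.marginal_le (by linarith) (by linarith)
          _ ≤ D * marginal u (p 1 ω) := hD _ h2
          _ ≤ D * (marginal u (M.nextWealth c a z (ω 0)) + C) := by
              gcongr
              exact hC _ ((hY 0).trans_le hW) _
          _ ≤ D * (marginal u (M.income (ω 0)) + C) := by
              gcongr
              exact hu.marginal_le (hY 0) hW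
          _ = _ := by ring
      have hβR : 0 ≤ M.discount (ω 0) * M.ret (ω 0) :=
        mul_nonneg (M.discount_nonneg _) (M.ret_nonneg _)
      have hfy := (hu.marginal_pos _ (hY 0)).le
      calc r k ω ≤ ENNReal.ofReal (M.discount (ω 0) * M.ret (ω 0) *
            (D * marginal u (M.income (ω 0)) + D * C)) := by
            simp only [r]; gcongr
        _ = ENNReal.ofReal D * (k₀ (ω 0) * extMarginal u (M.income (ω 0))) +
            ENNReal.ofReal (D * C) * k₀ (ω 0) := by
            rw [extMarginal, if_pos (hY 0), ENNReal.ofReal_mul hβR,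
              ENNReal.ofReal_add (by positivity) (by positivity), ENNReal.ofReal_mul hD0]
            change ENNReal.ofReal (M.discount (ω 0) * M.ret (ω 0)) * _ = ENNReal.ofReal D *
              (ENNReal.ofReal (M.discount (ω 0) * M.ret (ω 0)) * _) + _ *
                ENNReal.ofReal (M.discount (ω 0) * M.ret (ω 0))
            ring
        _ ≤ bound ω := by
            simp only [bound]
            gcongr
            · exact le_self_add
            · calc k₀ (ω 0) * extMarginal u (M.income (ω 0)) = M.debtTerm u 0 ω := by
                    simp only [debtTerm, Finset.range_zero, Finset.prod_empty, one_mul]; rfl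
                _ ≤ _ := ENNReal.le_tsum 0
    · rw [Set.indicator_of_notMem hω, Set.indicator_of_mem (Set.mem_compl hω), zero_add]
      refine le_trans ?_ le_self_add
      exact le_mul_of_one_le_left' le_add_self
  have hlim : ∀ᵐ ω ∂M.law z, Tendsto (fun k => (S k).indicator (r k) ω +
      (S k)ᶜ.indicator (M.debtCost u) ω) atTop (𝓝 (M.nextMarginal u c a z (ω 0))) := by
    filter_upwards [hp1] with ω hω
    have hRh : Tendsto (fun k => M.ret (ω 0) * h k) atTop (𝓝 0) := by
      simpa using hh.const_mul (M.ret (ω 0))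
    have hev : ∀ᶠ k in atTop, ω ∈ S k := by
      filter_upwards [hRh.eventually_le_const (half_pos hω)] with k hk using ⟨hk, hω⟩
    have hlr : Tendsto (fun k => r k ω) atTop (𝓝 (M.nextMarginal u c a z (ω 0))) := by
      refine ENNReal.tendsto_ofReal (Tendsto.const_mul _ ?_)
      refine (hu.continuousAt_marginal hω).tendsto.comp ?_
      simpa using hRh.const_sub (p 1 ω)
    refine hlr.congr' ?_
    filter_upwards [hev] with k hk
    rw [Set.indicator_of_mem hk, Set.indicator_of_notMem (Set.notMem_compl_iff.2 hk), add_zero]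
  have hDCT := tendsto_lintegral_of_dominated_convergence bound
    (fun k => ((hr k).indicator (info_le 1 _ (hS k))).add
      ((measurable_debtCost hu).indicator (info_le 1 _ (hS k)).compl)) hdom hbound hlim
  have hliml : Tendsto (fun k => ENNReal.ofReal (marginal u (c a z + h k))) atTop
      (𝓝 (ENNReal.ofReal (marginal u (c a z)))) := by
    refine ENNReal.tendsto_ofReal ((hu.continuousAt_marginal hpos).tendsto.comp ?_)
    simpa using hh.const_add (c a z)
  exact le_of_tendsto_of_tendsto' hliml hDCT fun k =>
    (hc a ha z).marginal_le_of_borrow hu hM ha (fun ω => rfl) (hh0 k) (hh1 k) (hS k) (hS0 k)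

end IsConsumptionFunction

end Environment

end IncomeFluctuation

/-! ### Regular variation and consequences of the return gap -/

namespace IncomeFluctuation

variable {N : ℕ} {E F G : Type*} [MeasurableSpace E] [MeasurableSpace F] [MeasurableSpace G]

/-- For a regularly varying monotone function the convergence is uniform in the factor. -/
lemma IsRegularlyVarying.tendsto_div {u : ℝ → EReal} {γ : ℝ} (hu : IsInada u)
    (hRV : IsRegularlyVarying (marginal u) (-γ)) {ι : Type*} {l : Filter ι} {x y : ι → ℝ}
    {b : ℝ} (hb : 0 < b) (hx : Tendsto x l atTop) (hy : Tendsto (fun i => y i / x i) l (𝓝 b)) :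
    Tendsto (fun i => marginal u (y i) / marginal u (x i)) l (𝓝 (b ^ (-γ))) := by
  have hcont : ContinuousAt (fun t : ℝ => t ^ (-γ)) b :=
    Real.continuousAt_rpow_const _ _ (Or.inl hb.ne')
  -- As u' decreases, y may be compared with t x for one fixed t: slightly above b for the lower
  -- estimate, slightly below b for the upper one. Regular variation is used at that t only.
  refine tendsto_order.2 ⟨fun d hd => ?_, fun d hd => ?_⟩
  · have hev : ∀ᶠ t in 𝓝[>] b, d < t ^ (-γ) :=
      (hcont.tendsto.mono_left nhdsWithin_le_nhds).eventually_const_lt hd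
    obtain ⟨t, hdt, hbt⟩ := (hev.and self_mem_nhdsWithin).exists
    have ht : 0 < t := hb.trans hbt
    filter_upwards [((hRV.2.2 t ht).comp hx).eventually_const_lt hdt,
      hy.eventually_lt_const hbt, hy.eventually_const_lt hb, hx.eventually_gt_atTop 0]
      with i h1 h2 h3 h4
    refine h1.trans_le ?_
    have hyi : 0 < y i := by have := (div_pos_iff_of_pos_right h4).1 h3; exact this
    exact div_le_div_of_nonneg_right (hu.marginal_le hyi ((div_lt_iff₀ h4).1 h2).le)
      (hu.marginal_pos _ h4).le
  · have hev : ∀ᶠ t in 𝓝[<] b, t ^ (-γ) < d ∧ 0 < t :=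
      ((hcont.tendsto.mono_left nhdsWithin_le_nhds).eventually_lt_const hd).and
        (nhdsWithin_le_nhds (lt_mem_nhds hb))
    obtain ⟨t, ⟨hdt, ht⟩, hbt⟩ := (hev.and self_mem_nhdsWithin).exists
    filter_upwards [((hRV.2.2 t ht).comp hx).eventually_lt_const hdt,
      hy.eventually_const_lt hbt, hx.eventually_gt_atTop 0] with i h1 h2 h4
    refine lt_of_le_of_lt ?_ h1
    exact div_le_div_of_nonneg_right (hu.marginal_le (mul_pos ht h4) ((lt_div_iff₀ h4).1 h2).le)
      (hu.marginal_pos _ h4).le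

namespace Environment

variable {M : Environment N E F G} {u : ℝ → EReal} {c : ℝ → Fin N → ℝ} {γ : ℝ}

lemma ReturnGap.exists_ae_step (hR : M.ReturnGap) : ∃ δ : ℝ, 0 < δ ∧
    (∀ z, ∀ᵐ f ∂M.lawζ, M.R z f = 0 ∨ δ ≤ M.R z f) ∧
    ∀ z, ∀ᵐ s ∂M.step z, M.ret s = 0 ∨ δ ≤ M.ret s := by
  obtain ⟨δ, hδ, h⟩ := hR
  refine ⟨δ, hδ, h, fun z => ?_⟩
  set B : Fin N → Set F := fun z => {f | ¬(M.R z f = 0 ∨ δ ≤ M.R z f)}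
  have hB : ∀ z, MeasurableSet (B z) := fun z =>
    ((M.measurable_R z (measurableSet_singleton 0)).union
      (measurableSet_le measurable_const (M.measurable_R z))).compl
  have hX : ∀ z, Measurable fun p : E × F => (B z).indicator (1 : F → ℝ) p.2 := fun z =>
    (measurable_one.indicator (hB z)).comp measurable_snd
  have h0 := M.lintegral_step_mul z (X := fun z _ f => (B z).indicator 1 f) hX
    (g := fun _ _ => 1) fun _ => measurable_const
  have hz : ∀ z', ∫⁻ p : E × F, ENNReal.ofReal ((B z').indicator 1 p.2) ∂M.lawε.prod M.lawζ
      = 0 := fun z' => by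
    rw [lintegral_eq_zero_iff (hX z').ennreal_ofReal]
    have : ∀ᵐ p ∂M.lawε.prod M.lawζ, M.R z' p.2 = 0 ∨ δ ≤ M.R z' p.2 :=
      Measure.quasiMeasurePreserving_snd.ae (h z')
    filter_upwards [this] with p hp
    have : p.2 ∉ B z' := fun hc => hc hp
    simp [this]
  simp only [hz, zero_mul, mul_zero, Finset.sum_const_zero, mul_one] at h0
  rw [lintegral_eq_zero_iff (measurable_shockFun hX)] at h0
  filter_upwards [h0] with s hs
  by_contra hc
  have hmem : s.2.2.1 ∈ B s.1 := hc
  simp [shockFun, hmem] at hs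

lemma ReturnGap.ae_law (hR : M.ReturnGap) : ∃ δ : ℝ, 0 < δ ∧
    ∀ z, ∀ᵐ ω ∂M.law z, M.ret (ω 0) = 0 ∨ δ ≤ M.ret (ω 0) := by
  obtain ⟨δ, hδ, -, h⟩ := hR.exists_ae_step
  refine ⟨δ, hδ, fun z => ?_⟩
  have hS : MeasurableSet {s | M.ret s = 0 ∨ δ ≤ M.ret s} :=
    (M.measurable_ret (measurableSet_singleton 0)).union
      (measurableSet_le measurable_const M.measurable_ret)
  filter_upwards [M.ae_law_of_ae_step z hS h] with ω hω using hω 0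

/-- Multiplying `β R` by a function of `R` that is bounded away from zero preserves
integrability. -/
lemma IsSpectral.integrable_βR_mul (hM : M.IsSpectral u) (hR : M.ReturnGap) {g : ℝ → ℝ}
    (hg : Measurable g) (hg0 : ∀ x, 0 ≤ x → 0 ≤ g x)
    (hgb : ∀ δ, 0 < δ → ∃ B, ∀ x, δ ≤ x → g x ≤ B) (z : Fin N) :
    Integrable (fun p : E × F => M.β z p.1 * M.R z p.2 * g (M.R z p.2))
      (M.lawε.prod M.lawζ) := by
  obtain ⟨δ, hδ, h⟩ := hR
  obtain ⟨B, hB⟩ := hgb δ hδ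
  refine ((hM.integrable_βR z).mul_const B).mono' ?_ ?_
  · exact ((M.measurable_βR_prod z).mul
      (hg.comp ((M.measurable_R z).comp measurable_snd))).aestronglyMeasurable
  · have : ∀ᵐ p ∂M.lawε.prod M.lawζ, M.R z p.2 = 0 ∨ δ ≤ M.R z p.2 :=
      Measure.quasiMeasurePreserving_snd.ae (h z)
    filter_upwards [this] with p hp
    have hβR := mul_nonneg (M.β_nonneg z p.1) (M.R_nonneg z p.2)
    rw [Real.norm_of_nonneg (mul_nonneg hβR (hg0 _ (M.R_nonneg z p.2)))]
    rcases hp with hp | hp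
    · simp [hp]
    · exact mul_le_mul_of_nonneg_left (hB _ hp) hβR

lemma measurable_K_prod (z : Fin N) :
    Measurable fun p : E × F => M.β z p.1 * M.R z p.2 * M.R z p.2 ^ (-γ) :=
  (M.measurable_βR_prod z).mul (((M.measurable_R z).comp measurable_snd).pow_const _)

lemma K_prod_nonneg (z : Fin N) (e : E) (f : F) :
    0 ≤ M.β z e * M.R z f * M.R z f ^ (-γ) :=
  mul_nonneg (mul_nonneg (M.β_nonneg z e) (M.R_nonneg z f)) (Real.rpow_nonneg (M.R_nonneg z f) _)

lemma K_nonneg (i j : Fin N) : 0 ≤ M.K γ i j := M.PD_nonneg K_prod_nonneg i j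

lemma rpow_neg_le_of_le {γ δ x : ℝ} (hγ : 0 ≤ γ) (hδ : 0 < δ) (hx : δ ≤ x) :
    x ^ (-γ) ≤ δ ^ (-γ) :=
  Real.rpow_le_rpow_of_nonpos hδ hx (neg_nonpos.2 hγ)

lemma IsSpectral.integrable_K_prod (hM : M.IsSpectral u) (hR : M.ReturnGap) (hγ : 0 ≤ γ)
    (z : Fin N) :
    Integrable (fun p : E × F => M.β z p.1 * M.R z p.2 * M.R z p.2 ^ (-γ))
      (M.lawε.prod M.lawζ) :=
  hM.integrable_βR_mul hR (g := fun x => x ^ (-γ)) (measurable_id.pow_const _)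
    (fun _ hx => Real.rpow_nonneg hx _)
    (fun δ hδ => ⟨δ ^ (-γ), fun _ hx => rpow_neg_le_of_le hγ hδ hx⟩) z

/-! ### Comparison with supersolutions and improvement of asymptotic bounds -/

namespace IsConsumptionFunction

variable (hc : M.IsConsumptionFunction u c)
include hc

/-- A proportional lower bound for consumption: a supersolution of the Euler equation of the form
`m(z) a` lies below the consumption function. -/
lemma mul_le (hu : IsInada u) (hM : M.IsSpectral u) {D : ℝ}
    (hD : ∀ x, 0 < x → marginal u (x / 2) ≤ D * marginal u x) {m : Fin N → ℝ}
    (hm0 : ∀ z, 0 < m z) (hm1 : ∀ z, m z < 1)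
    (hm : ∀ a, 0 < a → ∀ z, ∫⁻ s, ENNReal.ofReal (M.discount s * M.ret s *
      marginal u (m s.1 * (M.ret s * ((1 - m z) * a)))) ∂M.step z ≤
        ENNReal.ofReal (marginal u (m z * a))) {a : ℝ} (ha : 0 < a) (z : Fin N) :
    m z * a ≤ c a z := by
  obtain ⟨w, θ, hw1, hwtop, hθ, hw⟩ := M.exists_step_weight M.measurable_βR_prod
    (fun z e f => mul_nonneg (M.β_nonneg z e) (M.R_nonneg z f)) hM.integrable_βR hM.specRad_βR
  obtain ⟨C, hC0, hC⟩ := hc.exists_marginal_le hu hM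
  set k : Shock N E F G → ℝ≥0∞ := shockFun fun z e f => M.β z e * M.R z f
  have hk : Measurable k := measurable_shockFun M.measurable_βR_prod
  -- The largest violation of the desired inequality, measured in marginal utility. It is at most C
  -- because u'(m a) ≥ u'(a), and it will be shown to vanish.
  set Φ : Fin N → ℝ≥0∞ := fun z =>
    ⨆ (a : ℝ) (_ : 0 < a), ENNReal.ofReal (marginal u (c a z) - marginal u (m z * a))
  have hΦm : Measurable Φ := measurable_of_finite _
  have hleΦ : ∀ a, 0 < a → ∀ z,
      ENNReal.ofReal (marginal u (c a z) - marginal u (m z * a)) ≤ Φ z := fun a ha z =>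
    le_iSup₂ (f := fun (a : ℝ) (_ : 0 < a) =>
      ENNReal.ofReal (marginal u (c a z) - marginal u (m z * a))) a ha
  have hΦC : ∀ z, Φ z ≤ ENNReal.ofReal C := fun z => by
    refine iSup₂_le fun a ha => ENNReal.ofReal_le_ofReal ?_
    have h1 := hC a ha z
    have h2 := hu.marginal_le (mul_pos (hm0 z) ha)
      (mul_le_of_le_one_left ha.le (hm1 z).le : m z * a ≤ a)
    linarith
  have hrec : ∀ z, Φ z ≤ ∫⁻ s, k s * Φ s.1 ∂M.step z := by
    refine fun z => iSup₂_le fun a ha => ?_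
    rcases le_or_gt (marginal u (c a z)) (marginal u (m z * a)) with hle | hlt
    · rw [ENNReal.ofReal_of_nonpos (by linarith)]; exact zero_le
    have hma : m z * a ≤ a := mul_le_of_le_one_left ha.le (hm1 z).le
    -- A violation means c < m a < a, so the constraint is slack and the Euler equation is
    -- available. It also means that more than (1 - m) a is saved, so next period's wealth is at
    -- least R (1 - m) a and the supersolution property applies.
    have hcm : c a z < m z * a := hu.lt_of_marginal_lt (mul_pos (hm0 z) ha) hlt
    rw [ENNReal.ofReal_sub _ (hu.marginal_pos _ (mul_pos (hm0 z) ha)).le, tsub_le_iff_left]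
    have hma' : 0 < (1 - m z) * a := mul_pos (by linarith [hm1 z]) ha
    set φ : Shock N E F G → ℝ≥0∞ := fun s => ENNReal.ofReal (M.discount s * M.ret s *
      marginal u (m s.1 * (M.ret s * ((1 - m z) * a))))
    have hmm : Measurable m := measurable_of_finite _
    have hφ : Measurable φ := ((M.measurable_discount.mul M.measurable_ret).mul
      (measurable_marginal.comp ((hmm.comp measurable_fst).mul
        (M.measurable_ret.mul_const _)))).ennreal_ofReal
    have hkΦ : Measurable fun s => k s * Φ s.1 := hk.mul (hΦm.comp measurable_fst)
    calc ENNReal.ofReal (marginal u (c a z))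
        ≤ ∫⁻ ω, M.nextMarginal u c a z (ω 0) ∂M.law z :=
          hc.le_lintegral_nextMarginal hu hM hD ha z (hcm.trans_le hma)
      _ ≤ ∫⁻ ω, (fun s => φ s + k s * Φ s.1) (ω 0) ∂M.law z := by
          refine lintegral_mono_ae ?_
          filter_upwards [hM.income_pos hu z] with ω hY
          set s := ω 0
          have hβR : 0 ≤ M.discount s * M.ret s :=
            mul_nonneg (M.discount_nonneg _) (M.ret_nonneg _)
          rcases (M.ret_nonneg s).eq_or_lt with hR | hR
          · simp [nextMarginal, ← hR]
          have hW := hc.income_le_nextWealth ha z s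
          have hW0 : 0 < M.nextWealth c a z s := (hY 0).trans_le hW
          have hW1 : M.ret s * ((1 - m z) * a) ≤ M.nextWealth c a z s := by
            have : M.ret s * ((1 - m z) * a) ≤ M.ret s * (a - c a z) := by
              gcongr
              linarith
            exact this.trans (le_add_of_nonneg_right (M.income_nonneg _))
          have h1 : marginal u (m s.1 * M.nextWealth c a z s) ≤
              marginal u (m s.1 * (M.ret s * ((1 - m z) * a))) :=
            hu.marginal_le (mul_pos (hm0 _) (mul_pos hR hma'))
              (mul_le_mul_of_nonneg_left hW1 (hm0 _).le)
          calc M.nextMarginal u c a z s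
              ≤ ENNReal.ofReal (M.discount s * M.ret s *
                  marginal u (m s.1 * (M.ret s * ((1 - m z) * a))) + M.discount s * M.ret s *
                  (marginal u (c (M.nextWealth c a z s) s.1) -
                    marginal u (m s.1 * M.nextWealth c a z s))) := by
                refine ENNReal.ofReal_le_ofReal ?_
                rw [← mul_add]
                exact mul_le_mul_of_nonneg_left (by linarith) hβR
            _ ≤ φ s + ENNReal.ofReal (M.discount s * M.ret s *
                  (marginal u (c (M.nextWealth c a z s) s.1) -
                    marginal u (m s.1 * M.nextWealth c a z s))) := ENNReal.ofReal_add_le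
            _ ≤ φ s + k s * Φ s.1 := by
                rw [ENNReal.ofReal_mul hβR]
                gcongr
                · exact le_rfl
                · exact hleΦ _ hW0 _
      _ = ∫⁻ s, φ s ∂M.step z + ∫⁻ s, k s * Φ s.1 ∂M.step z := by
          rw [M.lintegral_law_zero z (g := fun s => φ s + k s * Φ s.1) (hφ.add hkΦ),
            ← lintegral_add_left hφ]
      _ ≤ ENNReal.ofReal (marginal u (m z * a)) + ∫⁻ s, k s * Φ s.1 ∂M.step z := by
          gcongr
          exact hm a ha z
  -- The violation is dominated by its β R weighted expectation one period ahead; the weight w makes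
  -- this operator a contraction with factor θ, so Φ = 0.
  have hpow : ∀ n z, Φ z ≤ θ ^ n * (ENNReal.ofReal C * w z) := by
    intro n
    induction n with
    | zero =>
      intro z
      rw [pow_zero, one_mul]
      exact (hΦC z).trans (le_mul_of_one_le_right' (hw1 z))
    | succ n ih =>
      intro z
      have hwm : Measurable w := measurable_of_finite _
      calc Φ z ≤ ∫⁻ s, k s * Φ s.1 ∂M.step z := hrec z
        _ ≤ ∫⁻ s, θ ^ n * ENNReal.ofReal C * (k s * w s.1) ∂M.step z := by
            refine lintegral_mono fun s => ?_
            calc _ ≤ k s * (θ ^ n * (ENNReal.ofReal C * w s.1)) := by gcongr; exact ih _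
              _ = _ := by ring
        _ = θ ^ n * ENNReal.ofReal C * ∫⁻ s, k s * w s.1 ∂M.step z :=
            lintegral_const_mul _ (hk.mul (hwm.comp measurable_fst))
        _ ≤ θ ^ n * ENNReal.ofReal C * (θ * w z) := by gcongr; exact hw z
        _ = _ := by ring
  have hzero : Φ z ≤ 0 := by
    have hlim : Tendsto (fun n : ℕ => θ ^ n * (ENNReal.ofReal C * w z)) atTop
        (𝓝 (0 * (ENNReal.ofReal C * w z))) :=
      ENNReal.Tendsto.mul_const (ENNReal.tendsto_pow_atTop_nhds_zero_of_lt_one hθ)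
        (Or.inr (ENNReal.mul_ne_top ENNReal.ofReal_ne_top (hwtop z).ne))
    rw [zero_mul] at hlim
    exact ge_of_tendsto' hlim fun n => hpow n z
  have h1 : marginal u (c a z) ≤ marginal u (m z * a) := by
    have := (hleΦ a ha z).trans hzero
    rw [nonpos_iff_eq_zero, ENNReal.ofReal_eq_zero] at this
    linarith
  by_contra! hlt
  exact absurd (hu.strictAntiOn_marginal (hc.pos hu hM ha z) (mul_pos (hm0 z) ha) hlt)
    (not_lt.2 h1)

/-- The upper bounds `c(a, z) ≤ a / ν` for `ν < v(z)` and large `a` improve under `rootMap`. -/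
lemma eventually_mul_le (hu : IsInada u) (hM : M.IsSpectral u) (hγ : 0 < γ)
    (hRV : IsRegularlyVarying (marginal u) (-γ)) (hR : M.ReturnGap) {v : Fin N → ℝ}
    (hv : ∀ z, 1 ≤ v z) (h : ∀ z ν, 0 < ν → ν < v z → ∀ᶠ a in atTop, ν * c a z ≤ a)
    (z : Fin N) {ν : ℝ} (hν0 : 0 < ν) (hν : ν < rootMap (M.K γ) γ v z) :
    ∀ᶠ a in atTop, ν * c a z ≤ a := by
  rcases le_or_gt ν 1 with hν1 | hν1
  · filter_upwards [eventually_gt_atTop 0] with a ha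
    have := hc.bounds ha z
    nlinarith
  by_contra hcon
  have hfr : ∃ᶠ a in atTop, 0 < a ∧ a < ν * c a z := by
    have h1 : ∃ᶠ a in atTop, ¬ν * c a z ≤ a := not_eventually.1 hcon
    refine (h1.and_eventually (eventually_gt_atTop 0)).mono fun a ha => ⟨ha.2, not_le.1 ha.1⟩
  obtain ⟨a, ha, hak⟩ := exists_seq_forall_of_frequently hfr
  have hv0 : ∀ z, 0 ≤ v z := fun z => zero_le_one.trans (hv z)
  -- Shrinking v slightly keeps ν below its image under `rootMap` and makes the hypothesis available
  -- at v' < v.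
  obtain ⟨t, ht0, ht1, ht⟩ : ∃ t : ℝ, 0 < t ∧ t < 1 ∧
      ν < 1 + t * (rootMap (M.K γ) γ v z - 1) := by
    have hlim : Tendsto (fun t : ℝ => 1 + t * (rootMap (M.K γ) γ v z - 1)) (𝓝[<] 1)
        (𝓝 (1 + 1 * (rootMap (M.K γ) γ v z - 1))) :=
      (Continuous.tendsto (by fun_prop) _).mono_left nhdsWithin_le_nhds
    have hev := hlim.eventually_const_lt (by linarith : ν < _)
    obtain ⟨t, ⟨h1, h2⟩, h3⟩ := ((hev.and (nhdsWithin_le_nhds (lt_mem_nhds one_pos))).and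
      self_mem_nhdsWithin).exists
    exact ⟨t, h2, h3, h1⟩
  set v' : Fin N → ℝ := fun z => t * v z
  have hv'0 : ∀ z, 0 < v' z := fun z => mul_pos ht0 (zero_lt_one.trans_le (hv z))
  have hroot : ν < rootMap (M.K γ) γ v' z := by
    rwa [rootMap_smul K_nonneg hγ hv0 ht0.le]
  obtain ⟨A, hA0, hA⟩ : ∃ A : ℝ, 0 < A ∧ ∀ a, A ≤ a → ∀ z, v' z * c a z ≤ a := by
    have : ∀ᶠ a in atTop, ∀ z, v' z * c a z ≤ a := eventually_all.2 fun z =>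
      h z (v' z) (hv'0 z) (mul_lt_of_lt_one_left (zero_lt_one.trans_le (hv z)) ht1)
    obtain ⟨A, hA⟩ := eventually_atTop.1 this
    exact ⟨max A 1, by positivity, fun a ha => hA a ((le_max_left _ _).trans ha)⟩
  -- The constant A covers small wealth, where only c ≤ a is known. It disappears after division by
  -- a k → ∞.
  have hcA : ∀ a, 0 < a → ∀ z, c a z ≤ a / v' z + A := fun a ha z => by
    rcases le_total A a with h1 | h1
    · have : c a z ≤ a / v' z := by
        rw [le_div_iff₀ (hv'0 z), mul_comm]; exact hA a h1 z
      linarith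
    · have := (hc.bounds ha z).2
      have : 0 < a / v' z := div_pos ha (hv'0 z)
      linarith
  -- Consuming more than a/ν leaves savings of less than ρ a.
  set ρ := 1 - ν⁻¹
  have hνinv : ν⁻¹ < 1 := inv_lt_one_of_one_lt₀ hν1
  have hρ : 0 < ρ := by simp only [ρ]; linarith
  have hv'm : Measurable v' := measurable_of_finite _
  set y : ℕ → Shock N E F G → ℝ := fun k s =>
    (M.ret s * (ρ * a k) + M.income s) / v' s.1 + A
  set φ : ℕ → Shock N E F G → ℝ≥0∞ := fun k s => ENNReal.ofReal (M.discount s * M.ret s *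
    (marginal u (y k s) / marginal u (a k)))
  have hφm : ∀ k, Measurable (φ k) := fun k =>
    ((M.measurable_discount.mul M.measurable_ret).mul ((measurable_marginal.comp
      ((((M.measurable_ret.mul_const _).add M.measurable_income).div
        (hv'm.comp measurable_fst)).add_const A)).div_const _)).ennreal_ofReal
  have hφle : ∀ k, ∫⁻ s, φ k s ∂M.step z ≤
      ENNReal.ofReal (marginal u (a k / ν) / marginal u (a k)) := fun k => by
    obtain ⟨hak0, hak1⟩ := hak k
    have hfa := hu.marginal_pos _ hak0
    have hck : a k / ν < c (a k) z := by rw [div_lt_iff₀ hν0, mul_comm]; exact hak1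
    have h1 : ∫⁻ ω, M.nextMarginal u c (a k) z (ω 0) ∂M.law z ≤
        ENNReal.ofReal (marginal u (a k / ν)) :=
      (hc.lintegral_nextMarginal_le hu hM hak0 z).trans
        (ENNReal.ofReal_le_ofReal (hu.marginal_le (div_pos hak0 hν0) hck.le))
    rw [div_eq_inv_mul, ENNReal.ofReal_mul (inv_nonneg.2 hfa.le)]
    refine le_trans ?_ (mul_le_mul_right h1 _)
    rw [← M.lintegral_law_zero z (hφm k),
      ← lintegral_const_mul _ (hc.measurable_nextMarginal hak0 z)]
    refine lintegral_mono_ae ?_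
    filter_upwards [hM.income_pos hu z] with ω hY
    have hW0 := (hY 0).trans_le (hc.income_le_nextWealth hak0 z (ω 0))
    have hβR : 0 ≤ M.discount (ω 0) * M.ret (ω 0) :=
      mul_nonneg (M.discount_nonneg _) (M.ret_nonneg _)
    rw [nextMarginal, ← ENNReal.ofReal_mul (inv_nonneg.2 hfa.le)]
    refine ENNReal.ofReal_le_ofReal ?_
    have hWy : c (M.nextWealth c (a k) z (ω 0)) (ω 0).1 ≤ y k (ω 0) := by
      refine (hcA _ hW0 _).trans ?_
      simp only [y]
      have : M.nextWealth c (a k) z (ω 0) ≤ M.ret (ω 0) * (ρ * a k) + M.income (ω 0) := by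
        simp only [nextWealth]
        have h2 : a k - c (a k) z ≤ ρ * a k := by
          have h3 : ρ * a k = a k - a k / ν := by simp only [ρ]; ring
          linarith
        have h3 := mul_le_mul_of_nonneg_left h2 (M.ret_nonneg (ω 0))
        linarith
      have h4 := div_le_div_of_nonneg_right this (hv'0 (ω 0).1).le
      linarith
    have h5 := hu.marginal_le (hc.pos hu hM hW0 _) hWy
    calc _ = (marginal u (a k))⁻¹ * (M.discount (ω 0) * M.ret (ω 0) *
          marginal u (y k (ω 0))) := by ring
      _ ≤ _ := by gcongr
  have hlimr : Tendsto (fun k => ENNReal.ofReal (marginal u (a k / ν) / marginal u (a k))) atTop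
      (𝓝 (ENNReal.ofReal (ν⁻¹ ^ (-γ)))) := by
    refine ENNReal.tendsto_ofReal (hRV.tendsto_div hu (inv_pos.2 hν0) ha ?_)
    refine tendsto_const_nhds.congr' ?_
    filter_upwards with k
    have := (hak k).1
    field_simp
  have hX := M.lintegral_step_weight z (X := fun z e f => M.β z e * M.R z f * M.R z f ^ (-γ))
    measurable_K_prod K_prod_nonneg (hM.integrable_K_prod hR hγ.le)
    (w := fun z => ρ ^ (-γ) * v' z ^ γ)
    fun z => mul_nonneg (Real.rpow_nonneg hρ.le _) (Real.rpow_nonneg (hv'0 z).le _)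
  have hfatou : ∫⁻ s, shockFun (fun z e f => M.β z e * M.R z f * M.R z f ^ (-γ)) s *
      ENNReal.ofReal (ρ ^ (-γ) * v' s.1 ^ γ) ∂M.step z ≤ ENNReal.ofReal (ν⁻¹ ^ (-γ)) := by
    calc _ ≤ ∫⁻ s, liminf (fun k => φ k s) atTop ∂M.step z := by
          refine lintegral_mono fun s => ?_
          rcases (M.ret_nonneg s).eq_or_lt with hR0 | hR0
          · have : shockFun (fun z e f => M.β z e * M.R z f * M.R z f ^ (-γ)) s = 0 := by
              change ENNReal.ofReal (M.discount s * M.ret s * M.ret s ^ (-γ)) = 0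
              simp [← hR0]
            rw [this, zero_mul]; exact zero_le
          have hb : 0 < M.ret s * ρ / v' s.1 := div_pos (mul_pos hR0 hρ) (hv'0 _)
          have hy : Tendsto (fun k => y k s / a k) atTop (𝓝 (M.ret s * ρ / v' s.1)) := by
            have h1 : Tendsto (fun k => M.ret s * ρ / v' s.1 +
                (M.income s / v' s.1 + A) / a k) atTop (𝓝 (M.ret s * ρ / v' s.1 + 0)) :=
              tendsto_const_nhds.add (tendsto_const_nhds.div_atTop ha)
            rw [add_zero] at h1
            refine h1.congr fun k => ?_
            have := (hak k).1
            have := hv'0 s.1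
            simp only [y]
            field_simp
            ring
          have hlim : Tendsto (fun k => φ k s) atTop (𝓝 (ENNReal.ofReal
              (M.discount s * M.ret s * (M.ret s * ρ / v' s.1) ^ (-γ)))) :=
            ENNReal.tendsto_ofReal ((hRV.tendsto_div hu hb ha hy).const_mul _)
          rw [hlim.liminf_eq]
          change ENNReal.ofReal (M.discount s * M.ret s * M.ret s ^ (-γ)) * _ ≤ _
          rw [← ENNReal.ofReal_mul (mul_nonneg (mul_nonneg (M.discount_nonneg s) hR0.le)
            (Real.rpow_nonneg hR0.le _)), Real.div_rpow (mul_pos hR0 hρ).le (hv'0 _).le,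
            Real.mul_rpow hR0.le hρ.le, Real.rpow_neg (hv'0 s.1).le, div_inv_eq_mul]
          refine le_of_eq ?_
          congr 1
          ring
      _ ≤ liminf (fun k => ∫⁻ s, φ k s ∂M.step z) atTop := lintegral_liminf_le hφm
      _ ≤ liminf (fun k => ENNReal.ofReal (marginal u (a k / ν) / marginal u (a k))) atTop :=
          liminf_le_liminf (Eventually.of_forall hφle)
      _ = _ := hlimr.liminf_eq
  rw [hX] at hfatou
  have hνγ : 0 ≤ ν⁻¹ ^ (-γ) := Real.rpow_nonneg (inv_nonneg.2 hν0.le) _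
  have h1 := (ENNReal.ofReal_le_ofReal_iff hνγ).1 hfatou
  have h2 : (M.PD fun z e f => M.β z e * M.R z f * M.R z f ^ (-γ)).mulVec
      (fun z => ρ ^ (-γ) * v' z ^ γ) z = ρ ^ (-γ) * (M.K γ).mulVec (fun z => v' z ^ γ) z := by
    change (M.K γ).mulVec (ρ ^ (-γ) • fun z => v' z ^ γ) z = _
    rw [Matrix.mulVec_smul]; rfl
  rw [h2, Real.rpow_neg hρ.le, inv_mul_le_iff₀ (Real.rpow_pos_of_pos hρ _), Real.inv_rpow hν0.le,
    Real.rpow_neg hν0.le, inv_inv, ← Real.mul_rpow hρ.le hν0.le] at h1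
  -- The limit inequality reads K v'^γ ≤ (ρ ν)^γ = (ν - 1)^γ, that is, `rootMap` v' ≤ ν, contrary to
  -- the choice of v'.
  have h3 : ρ * ν = ν - 1 := by simp only [ρ]; field_simp
  rw [h3] at h1
  have h4 := Real.rpow_le_rpow (mulVec_rpow_nonneg K_nonneg (fun z => (hv'0 z).le) z) h1
    (by positivity : 0 ≤ 1 / γ)
  rw [← Real.rpow_mul (by linarith), mul_one_div_cancel hγ.ne', Real.rpow_one] at h4
  simp only [rootMap] at hroot
  linarith

/-- The lower bounds `c(a, z) ≥ a / ν` for `ν > v(z)` and large `a` improve under `rootMap`. -/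
lemma eventually_le_mul (hu : IsInada u) (hM : M.IsSpectral u) (hγ : 0 < γ)
    (hRV : IsRegularlyVarying (marginal u) (-γ)) (hR : M.ReturnGap) {D : ℝ}
    (hD : ∀ x, 0 < x → marginal u (x / 2) ≤ D * marginal u x) {v : Fin N → ℝ}
    (hv : ∀ z, 1 ≤ v z) (h : ∀ z ν, v z < ν → ∀ᶠ a in atTop, a ≤ ν * c a z)
    (z : Fin N) {ν : ℝ} (hν : rootMap (M.K γ) γ v z < ν) :
    ∀ᶠ a in atTop, a ≤ ν * c a z := by
  have hv0 : ∀ z, 0 ≤ v z := fun z => zero_le_one.trans (hv z)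
  have hν1 : 1 < ν := (one_le_rootMap K_nonneg hv0 z).trans_lt hν
  have hν0 : 0 < ν := zero_lt_one.trans hν1
  by_contra hcon
  have hfr : ∃ᶠ a in atTop, 0 < a ∧ ν * c a z < a := by
    have h1 : ∃ᶠ a in atTop, ¬a ≤ ν * c a z := not_eventually.1 hcon
    refine (h1.and_eventually (eventually_gt_atTop 0)).mono fun a ha => ⟨ha.2, not_le.1 ha.1⟩
  obtain ⟨a, ha, hak⟩ := exists_seq_forall_of_frequently hfr
  -- Enlarging v slightly keeps its image below ν and makes the hypothesis available at v' > v.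
  obtain ⟨t, ht1, ht⟩ : ∃ t : ℝ, 1 < t ∧ 1 + t * (rootMap (M.K γ) γ v z - 1) < ν := by
    have hlim : Tendsto (fun t : ℝ => 1 + t * (rootMap (M.K γ) γ v z - 1)) (𝓝[>] 1)
        (𝓝 (1 + 1 * (rootMap (M.K γ) γ v z - 1))) :=
      (Continuous.tendsto (by fun_prop) _).mono_left nhdsWithin_le_nhds
    have hev := hlim.eventually_lt_const (by linarith : _ < ν)
    obtain ⟨t, h1, h3⟩ := (hev.and self_mem_nhdsWithin).exists
    exact ⟨t, h3, h1⟩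
  have ht0 : 0 < t := zero_lt_one.trans ht1
  set v' : Fin N → ℝ := fun z => t * v z
  have hv'0 : ∀ z, 0 < v' z := fun z => mul_pos ht0 (zero_lt_one.trans_le (hv z))
  have hroot : rootMap (M.K γ) γ v' z < ν := by
    rwa [rootMap_smul K_nonneg hγ hv0 ht0.le]
  obtain ⟨A, hA⟩ : ∃ A : ℝ, ∀ a, A ≤ a → ∀ z, a ≤ v' z * c a z := by
    have : ∀ᶠ a in atTop, ∀ z, a ≤ v' z * c a z := eventually_all.2 fun z =>
      h z (v' z) (lt_mul_of_one_lt_left (zero_lt_one.trans_le (hv z)) ht1)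
    exact eventually_atTop.1 this
  obtain ⟨δ, hδ, hgap⟩ := hR.ae_law
  obtain ⟨δ', hδ', -, hgap'⟩ := hR.exists_ae_step
  set vm := ∑ z, v' z
  have hvm : ∀ z, v' z ≤ vm := fun z =>
    Finset.single_le_sum (f := v') (fun z _ => (hv'0 z).le) (Finset.mem_univ z)
  have hvm0 : 0 < vm := (hv'0 z).trans_le (hvm z)
  set ρ := 1 - ν⁻¹
  have hνinv : ν⁻¹ < 1 := inv_lt_one_of_one_lt₀ hν1
  have hρ : 0 < ρ := by simp only [ρ]; linarith
  have hv'm : Measurable v' := measurable_of_finite _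
  set y : ℕ → Shock N E F G → ℝ := fun k s => M.ret s * (ρ * a k) / v' s.1
  set φ : ℕ → Shock N E F G → ℝ≥0∞ := fun k s => ENNReal.ofReal (M.discount s * M.ret s *
    (marginal u (y k s) / marginal u (a k)))
  have hφm : ∀ k, Measurable (φ k) := fun k =>
    ((M.measurable_discount.mul M.measurable_ret).mul ((measurable_marginal.comp
      ((M.measurable_ret.mul_const _).div (hv'm.comp measurable_fst))).div_const _)).ennreal_ofReal
  -- Where R ≥ δ, next period's wealth is at least δ ρ a k, which exceeds the threshold A; where R =
  -- 0 both integrands vanish. Thus the assumed lower bound applies to next period's consumption.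
  have hlarge : ∀ᶠ k in atTop, A ≤ δ * (ρ * a k) :=
    ((ha.const_mul_atTop hρ).const_mul_atTop hδ).eventually_ge_atTop A
  have hφle : ∀ᶠ k in atTop, ENNReal.ofReal (marginal u (a k / ν) / marginal u (a k)) ≤
      ∫⁻ s, φ k s ∂M.step z := by
    filter_upwards [hlarge] with k hkA
    obtain ⟨hak0, hak1⟩ := hak k
    have hfa := hu.marginal_pos _ hak0
    have hc0 := hc.pos hu hM hak0 z
    have hck : c (a k) z < a k / ν := by rw [lt_div_iff₀ hν0, mul_comm]; exact hak1
    have hcka : c (a k) z < a k := hck.trans_le (div_le_self hak0.le hν1.le)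
    have h1 : ENNReal.ofReal (marginal u (a k / ν)) ≤
        ∫⁻ ω, M.nextMarginal u c (a k) z (ω 0) ∂M.law z :=
      (ENNReal.ofReal_le_ofReal (hu.marginal_le hc0 hck.le)).trans
        (hc.le_lintegral_nextMarginal hu hM hD hak0 z hcka)
    rw [div_eq_inv_mul, ENNReal.ofReal_mul (inv_nonneg.2 hfa.le)]
    refine le_trans (mul_le_mul_right h1 _) ?_
    rw [← M.lintegral_law_zero z (hφm k),
      ← lintegral_const_mul _ (hc.measurable_nextMarginal hak0 z)]
    refine lintegral_mono_ae ?_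
    filter_upwards [hgap z] with ω hω
    rcases hω with hω | hω
    · simp [nextMarginal, hω]
    have hR0 : 0 < M.ret (ω 0) := hδ.trans_le hω
    have hβR : 0 ≤ M.discount (ω 0) * M.ret (ω 0) :=
      mul_nonneg (M.discount_nonneg _) (M.ret_nonneg _)
    have hρa : 0 < ρ * a k := mul_pos hρ hak0
    have hW : M.ret (ω 0) * (ρ * a k) ≤ M.nextWealth c (a k) z (ω 0) := by
      have h2 : ρ * a k ≤ a k - c (a k) z := by
        have h3 : ρ * a k = a k - a k / ν := by simp only [ρ]; ring
        linarith
      exact (mul_le_mul_of_nonneg_left h2 hR0.le).trans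
        (le_add_of_nonneg_right (M.income_nonneg _))
    have hAW : A ≤ M.nextWealth c (a k) z (ω 0) :=
      hkA.trans ((mul_le_mul_of_nonneg_right hω hρa.le).trans hW)
    have hy0 : 0 < y k (ω 0) := div_pos (mul_pos hR0 hρa) (hv'0 _)
    have hyc : y k (ω 0) ≤ c (M.nextWealth c (a k) z (ω 0)) (ω 0).1 := by
      simp only [y]
      rw [div_le_iff₀ (hv'0 _), mul_comm (c _ _)]
      exact hW.trans (hA _ hAW _)
    rw [nextMarginal, ← ENNReal.ofReal_mul (inv_nonneg.2 hfa.le)]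
    refine ENNReal.ofReal_le_ofReal ?_
    have h5 := hu.marginal_le hy0 hyc
    calc _ ≤ (marginal u (a k))⁻¹ * (M.discount (ω 0) * M.ret (ω 0) *
          marginal u (y k (ω 0))) := by gcongr
      _ = _ := by ring
  have hliml : Tendsto (fun k => ENNReal.ofReal (marginal u (a k / ν) / marginal u (a k))) atTop
      (𝓝 (ENNReal.ofReal (ν⁻¹ ^ (-γ)))) := by
    refine ENNReal.tendsto_ofReal (hRV.tendsto_div hu (inv_pos.2 hν0) ha ?_)
    refine tendsto_const_nhds.congr' ?_
    filter_upwards with k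
    have := (hak k).1
    field_simp
  have hX := M.lintegral_step_weight z (X := fun z e f => M.β z e * M.R z f * M.R z f ^ (-γ))
    measurable_K_prod K_prod_nonneg (hM.integrable_K_prod hR hγ.le)
    (w := fun z => ρ ^ (-γ) * v' z ^ γ)
    fun z => mul_nonneg (Real.rpow_nonneg hρ.le _) (Real.rpow_nonneg (hv'0 z).le _)
  have hlim : ∀ s, Tendsto (fun k => φ k s) atTop (𝓝 (shockFun
      (fun z e f => M.β z e * M.R z f * M.R z f ^ (-γ)) s *
        ENNReal.ofReal (ρ ^ (-γ) * v' s.1 ^ γ))) := by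
    intro s
    change Tendsto _ _ (𝓝 (ENNReal.ofReal (M.discount s * M.ret s * M.ret s ^ (-γ)) * _))
    rcases (M.ret_nonneg s).eq_or_lt with hR0 | hR0
    · simp [φ, ← hR0]
    have hb : 0 < M.ret s * ρ / v' s.1 := div_pos (mul_pos hR0 hρ) (hv'0 _)
    have hy : Tendsto (fun k => y k s / a k) atTop (𝓝 (M.ret s * ρ / v' s.1)) := by
      refine tendsto_const_nhds.congr fun k => ?_
      have := (hak k).1
      have := hv'0 s.1
      simp only [y]
      field_simp
    have hlim : Tendsto (fun k => φ k s) atTop (𝓝 (ENNReal.ofReal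
        (M.discount s * M.ret s * (M.ret s * ρ / v' s.1) ^ (-γ)))) :=
      ENNReal.tendsto_ofReal ((hRV.tendsto_div hu hb ha hy).const_mul _)
    convert hlim using 2
    rw [← ENNReal.ofReal_mul (mul_nonneg (mul_nonneg (M.discount_nonneg s) hR0.le)
      (Real.rpow_nonneg hR0.le _)), Real.div_rpow (mul_pos hR0 hρ).le (hv'0 _).le,
      Real.mul_rpow hR0.le hρ.le, Real.rpow_neg (hv'0 s.1).le, div_inv_eq_mul]
    congr 1
    ring
  -- The gap and v' ≤ vm give y k s ≥ (δ' ρ / vm) a k, so the ratio of marginal utilities is bounded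
  -- by one that converges to (δ' ρ / vm)^(-γ). Adding 1 gives a bound for large k, and β R times L
  -- dominates.
  set L := (δ' * ρ / vm) ^ (-γ) + 1
  have hLlim : ∀ᶠ k in atTop, marginal u (δ' * ρ / vm * a k) / marginal u (a k) ≤ L := by
    have hb : 0 < δ' * ρ / vm := by positivity
    have := (hRV.2.2 _ hb).comp ha
    exact this.eventually_le_const (lt_add_one _)
  have hdom : ∀ᶠ k in atTop, ∀ᵐ s ∂M.step z, φ k s ≤
      shockFun (fun z e f => M.β z e * M.R z f) s * ENNReal.ofReal L := by
    filter_upwards [hLlim] with k hk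
    obtain ⟨hak0, -⟩ := hak k
    filter_upwards [hgap' z] with s hs
    rcases hs with hs | hs
    · simp [φ, hs]
    have hβR : 0 ≤ M.discount s * M.ret s := mul_nonneg (M.discount_nonneg _) (M.ret_nonneg _)
    change _ ≤ ENNReal.ofReal (M.discount s * M.ret s) * _
    rw [← ENNReal.ofReal_mul hβR]
    refine ENNReal.ofReal_le_ofReal (mul_le_mul_of_nonneg_left (le_trans ?_ hk) hβR)
    refine div_le_div_of_nonneg_right (hu.marginal_le (by positivity) ?_)
      (hu.marginal_pos _ hak0).le
    simp only [y]
    calc δ' * ρ / vm * a k = δ' * (ρ * a k) / vm := by ring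
      _ ≤ M.ret s * (ρ * a k) / v' s.1 := by
        have h1 := hv'0 s.1
        have h2 : 0 ≤ M.ret s * (ρ * a k) := mul_nonneg (M.ret_nonneg s) (mul_pos hρ hak0).le
        have h3 := hvm s.1
        gcongr
  have hDCT := tendsto_lintegral_filter_of_dominated_convergence (μ := M.step z) (l := atTop)
    (fun s => shockFun (fun z e f => M.β z e * M.R z f) s * ENNReal.ofReal L)
    (Eventually.of_forall hφm) hdom
    (M.lintegral_step_mul_lt_top z (X := fun z e f => M.β z e * M.R z f) M.measurable_βR_prod
      hM.integrable_βR (g := fun _ _ => ENNReal.ofReal L) (fun _ => measurable_const)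
      (fun _ => by simp)).ne (ae_of_all _ hlim)
  have hle := le_of_tendsto_of_tendsto hliml hDCT hφle
  rw [hX] at hle
  have h2 : (M.PD fun z e f => M.β z e * M.R z f * M.R z f ^ (-γ)).mulVec
      (fun z => ρ ^ (-γ) * v' z ^ γ) z = ρ ^ (-γ) * (M.K γ).mulVec (fun z => v' z ^ γ) z := by
    change (M.K γ).mulVec (ρ ^ (-γ) • fun z => v' z ^ γ) z = _
    rw [Matrix.mulVec_smul]; rfl
  have hK := mulVec_rpow_nonneg (γ := γ) (A := M.K γ) K_nonneg (fun z => (hv'0 z).le) z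
  rw [h2] at hle
  have h1 := (ENNReal.ofReal_le_ofReal_iff (mul_nonneg (Real.rpow_nonneg hρ.le _) hK)).1 hle
  rw [Real.rpow_neg hρ.le, le_inv_mul_iff₀ (Real.rpow_pos_of_pos hρ _), Real.inv_rpow hν0.le,
    Real.rpow_neg hν0.le, inv_inv, ← Real.mul_rpow hρ.le hν0.le] at h1
  have h3 : ρ * ν = ν - 1 := by simp only [ρ]; field_simp
  rw [h3] at h1
  have h4 := Real.rpow_le_rpow (Real.rpow_nonneg (by linarith) _) h1
    (by positivity : 0 ≤ 1 / γ)
  rw [← Real.rpow_mul (by linarith), mul_one_div_cancel hγ.ne', Real.rpow_one] at h4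
  simp only [rootMap] at hroot
  linarith

end IsConsumptionFunction

end Environment

end IncomeFluctuation

/-! ### Relative risk aversion as power bounds on marginal utility -/

namespace IncomeFluctuation

variable {N : ℕ} {E F G : Type*} [MeasurableSpace E] [MeasurableSpace F] [MeasurableSpace G]

section PowerBounds

variable {u : ℝ → EReal} (hu : IsInada u)
include hu

/-- If relative risk aversion is at most `g`, then `x ^ g u'(x)` is nondecreasing. -/
lemma monotoneOn_rpow_mul_marginal {g : ℝ}
    (hg : ∀ x, 0 < x → -(x * deriv (marginal u) x / marginal u x) ≤ g) :
    MonotoneOn (fun x => x ^ g * marginal u x) (Set.Ioi 0) := by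
  have hder : ∀ x, 0 < x → HasDerivAt (fun x => x ^ g * marginal u x)
      (g * x ^ (g - 1) * marginal u x + x ^ g * deriv (marginal u) x) x := fun x hx =>
    (Real.hasDerivAt_rpow_const (Or.inl hx.ne')).mul (hu.differentiableAt_marginal hx).hasDerivAt
  refine monotoneOn_of_deriv_nonneg (convex_Ioi 0)
    (fun x hx => (hder x hx).continuousAt.continuousWithinAt)
    (fun x hx => (hder x (interior_subset hx)).differentiableAt.differentiableWithinAt)
    fun x hx => ?_
  have hx : 0 < x := interior_subset hx
  have hf := hu.marginal_pos x hx
  rw [(hder x hx).deriv]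
  have h1 := hg x hx
  rw [← neg_div, div_le_iff₀ hf] at h1
  have h2 : x ^ g = x ^ (g - 1) * x := by
    rw [← Real.rpow_add_one hx.ne']; simp
  rw [h2]
  have h3 : 0 < x ^ (g - 1) := Real.rpow_pos_of_pos hx _
  nlinarith

/-- If relative risk aversion is at least `g`, then `x ^ g u'(x)` is nonincreasing. -/
lemma antitoneOn_rpow_mul_marginal {g : ℝ}
    (hg : ∀ x, 0 < x → g ≤ -(x * deriv (marginal u) x / marginal u x)) :
    AntitoneOn (fun x => x ^ g * marginal u x) (Set.Ioi 0) := by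
  have hder : ∀ x, 0 < x → HasDerivAt (fun x => x ^ g * marginal u x)
      (g * x ^ (g - 1) * marginal u x + x ^ g * deriv (marginal u) x) x := fun x hx =>
    (Real.hasDerivAt_rpow_const (Or.inl hx.ne')).mul (hu.differentiableAt_marginal hx).hasDerivAt
  refine antitoneOn_of_deriv_nonpos (convex_Ioi 0)
    (fun x hx => (hder x hx).continuousAt.continuousWithinAt)
    (fun x hx => (hder x (interior_subset hx)).differentiableAt.differentiableWithinAt)
    fun x hx => ?_
  have hx : 0 < x := interior_subset hx
  have hf := hu.marginal_pos x hx
  rw [(hder x hx).deriv]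
  have h1 := hg x hx
  rw [← neg_div, le_div_iff₀ hf] at h1
  have h2 : x ^ g = x ^ (g - 1) * x := by
    rw [← Real.rpow_add_one hx.ne']; simp
  rw [h2]
  have h3 : 0 < x ^ (g - 1) := Real.rpow_pos_of_pos hx _
  nlinarith

variable {glo ghi : ℝ}

lemma rpow_neg_mul_le_marginal
    (hg : ∀ x, 0 < x → -(x * deriv (marginal u) x / marginal u x) ≤ ghi) {l x : ℝ} (hl : 1 ≤ l)
    (hx : 0 < x) : l ^ (-ghi) * marginal u x ≤ marginal u (l * x) := by
  have hl0 : 0 < l := zero_lt_one.trans_le hl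
  have h := monotoneOn_rpow_mul_marginal hu hg hx (mul_pos hl0 hx) (le_mul_of_one_le_left hx.le hl)
  simp only [Real.mul_rpow hl0.le hx.le] at h
  rw [mul_comm (l ^ ghi), mul_assoc] at h
  have h' := le_of_mul_le_mul_left h (Real.rpow_pos_of_pos hx _)
  rwa [Real.rpow_neg hl0.le, inv_mul_le_iff₀ (Real.rpow_pos_of_pos hl0 _)]

lemma marginal_mul_le_of_le_one
    (hg : ∀ x, 0 < x → -(x * deriv (marginal u) x / marginal u x) ≤ ghi) {l x : ℝ} (hl0 : 0 < l)
    (hl : l ≤ 1) (hx : 0 < x) : marginal u (l * x) ≤ l ^ (-ghi) * marginal u x := by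
  have h := monotoneOn_rpow_mul_marginal hu hg (mul_pos hl0 hx) hx (mul_le_of_le_one_left hx.le hl)
  simp only [Real.mul_rpow hl0.le hx.le] at h
  rw [mul_comm (l ^ ghi), mul_assoc] at h
  have h' := le_of_mul_le_mul_left h (Real.rpow_pos_of_pos hx _)
  rwa [Real.rpow_neg hl0.le, le_inv_mul_iff₀ (Real.rpow_pos_of_pos hl0 _)]

lemma marginal_mul_le_of_one_le
    (hg : ∀ x, 0 < x → glo ≤ -(x * deriv (marginal u) x / marginal u x)) {l x : ℝ} (hl : 1 ≤ l)
    (hx : 0 < x) : marginal u (l * x) ≤ l ^ (-glo) * marginal u x := by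
  have hl0 : 0 < l := zero_lt_one.trans_le hl
  have h := antitoneOn_rpow_mul_marginal hu hg hx (mul_pos hl0 hx) (le_mul_of_one_le_left hx.le hl)
  simp only [Real.mul_rpow hl0.le hx.le] at h
  rw [mul_comm (l ^ glo), mul_assoc] at h
  have h' := le_of_mul_le_mul_left h (Real.rpow_pos_of_pos hx _)
  rwa [Real.rpow_neg hl0.le, le_inv_mul_iff₀ (Real.rpow_pos_of_pos hl0 _)]

/-- Shrinking the argument is controlled by the upper bound for risk aversion, enlarging it by the
lower one. Hence the maximum of two powers in the moment condition. -/
lemma marginal_mul_le_max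
    (hg : ∀ x, 0 < x → glo ≤ -(x * deriv (marginal u) x / marginal u x) ∧
      -(x * deriv (marginal u) x / marginal u x) ≤ ghi) {l x : ℝ} (hl : 0 < l) (hx : 0 < x) :
    marginal u (l * x) ≤ max (l ^ (-glo)) (l ^ (-ghi)) * marginal u x := by
  have hf := (hu.marginal_pos x hx).le
  rcases le_total l 1 with h | h
  · exact (marginal_mul_le_of_le_one hu (fun x hx => (hg x hx).2) hl h hx).trans
      (mul_le_mul_of_nonneg_right (le_max_right _ _) hf)
  · exact (marginal_mul_le_of_one_le hu (fun x hx => (hg x hx).1) h hx).trans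
      (mul_le_mul_of_nonneg_right (le_max_left _ _) hf)

/-- The index of regular variation lies between the bounds for relative risk aversion. -/
lemma IsRegularlyVarying.mem_Icc {γ : ℝ} (hRV : IsRegularlyVarying (marginal u) (-γ))
    (hg : ∀ x, 0 < x → glo ≤ -(x * deriv (marginal u) x / marginal u x) ∧
      -(x * deriv (marginal u) x / marginal u x) ≤ ghi) : glo ≤ γ ∧ γ ≤ ghi := by
  have hlim := hRV.2.2 2 two_pos
  have h1 : (2 : ℝ) ^ (-γ) ≤ 2 ^ (-glo) := by
    refine le_of_tendsto hlim ?_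
    filter_upwards [eventually_gt_atTop 0] with x hx
    rw [div_le_iff₀ (hu.marginal_pos x hx)]
    exact marginal_mul_le_of_one_le hu (fun x hx => (hg x hx).1) one_le_two hx
  have h2 : (2 : ℝ) ^ (-ghi) ≤ 2 ^ (-γ) := by
    refine ge_of_tendsto hlim ?_
    filter_upwards [eventually_gt_atTop 0] with x hx
    rw [le_div_iff₀ (hu.marginal_pos x hx)]
    exact rpow_neg_mul_le_marginal hu (fun x hx => (hg x hx).2) one_le_two hx
  rw [Real.rpow_le_rpow_left_iff one_lt_two] at h1 h2
  exact ⟨by linarith, by linarith⟩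

end PowerBounds

/-- If `x ≤ ν c(x)` for `ν > v` and `ν c(x) ≤ x` for `ν < v`, for large `x`, then
`c(x) / x → 1 / v`. -/
lemma tendsto_div_of_eventually {f : ℝ → ℝ} {v : ℝ} (hv : 1 ≤ v)
    (hupper : ∀ ν, 0 < ν → ν < v → ∀ᶠ a in atTop, ν * f a ≤ a)
    (hlower : ∀ ν, v < ν → ∀ᶠ a in atTop, a ≤ ν * f a) :
    Tendsto (fun a => f a / a) atTop (𝓝 v⁻¹) := by
  have hv0 : 0 < v := zero_lt_one.trans_le hv
  have hcont : Tendsto (fun ν : ℝ => ν⁻¹) (𝓝 v) (𝓝 v⁻¹) := (continuousAt_inv₀ hv0.ne').tendsto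
  refine tendsto_order.2 ⟨fun b hb => ?_, fun b hb => ?_⟩
  · obtain ⟨ν, h1, h2⟩ := (((hcont.mono_left nhdsWithin_le_nhds).eventually_const_lt hb).and
      (self_mem_nhdsWithin : Set.Ioi v ∈ 𝓝[>] v)).exists
    have hν0 : 0 < ν := hv0.trans h2
    filter_upwards [hlower ν h2, eventually_gt_atTop 0] with a h3 ha
    refine h1.trans_le ?_
    rw [le_div_iff₀ ha, inv_mul_le_iff₀ hν0]
    exact h3
  · obtain ⟨ν, ⟨h1, h0⟩, h2⟩ := ((((hcont.mono_left nhdsWithin_le_nhds).eventually_lt_const hb).and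
      (nhdsWithin_le_nhds (lt_mem_nhds hv0))).and
      (self_mem_nhdsWithin : Set.Iio v ∈ 𝓝[<] v)).exists
    filter_upwards [hupper ν h0 h2, eventually_gt_atTop 0] with a h3 ha
    refine lt_of_le_of_lt ?_ h1
    rw [div_le_iff₀ ha, le_inv_mul_iff₀ h0]
    exact h3

/-! ### Initial lower bounds, the squeeze and the fixed point -/

namespace Environment

variable {M : Environment N E F G} {u : ℝ → EReal} {c : ℝ → Fin N → ℝ} {γ : ℝ}

/-- Asymptotic linearity from a proportional lower bound for consumption. -/
lemma IsConsumptionFunction.tendsto_div (hc : M.IsConsumptionFunction u c) (hu : IsInada u)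
    (hM : M.IsSpectral u) (hγ : 0 < γ) (hRV : IsRegularlyVarying (marginal u) (-γ))
    (hR : M.ReturnGap) {D : ℝ} (hD : ∀ x, 0 < x → marginal u (x / 2) ≤ D * marginal u x)
    {m : Fin N → ℝ} (hm0 : ∀ z, 0 < m z) (hm1 : ∀ z, m z < 1)
    (hm : ∀ a, 0 < a → ∀ z, m z * a ≤ c a z) {v : Fin N → ℝ} (hv : ∀ z, 1 ≤ v z)
    (hfix : rootMap (M.K γ) γ v = v)
    (hlim : Tendsto (fun n => (rootMap (M.K γ) γ)^[n] fun _ => 1) atTop (𝓝 v)) (z : Fin N) :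
    Tendsto (fun a => c a z / a) atTop (𝓝 (v z)⁻¹) := by
  -- The bound c ≤ a corresponds to the vector 1 and c ≥ m a to 1/m. The iterates of both converge
  -- to v.
  set y : Fin N → ℝ := fun z => (m z)⁻¹
  have hy : ∀ z, 1 ≤ y z := fun z => (one_le_inv₀ (hm0 z)).2 (hm1 z).le
  have hone : ∀ (n : ℕ) {y : Fin N → ℝ}, (∀ z, 1 ≤ y z) →
      ∀ z, 1 ≤ (rootMap (M.K γ) γ)^[n] y z := by
    intro n
    induction n with
    | zero => exact fun hy => hy
    | succ n ih =>
      intro y hy z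
      rw [Function.iterate_succ_apply']
      exact one_le_rootMap K_nonneg (fun j => zero_le_one.trans (ih hy j)) z
  have hup : ∀ n z ν, 0 < ν → ν < (rootMap (M.K γ) γ)^[n] (fun _ => 1) z →
      ∀ᶠ a in atTop, ν * c a z ≤ a := by
    intro n
    induction n with
    | zero =>
      intro z ν hν0 hν1
      filter_upwards [eventually_gt_atTop 0] with a ha
      have h1 := hc.bounds ha z
      have h2 : ν < 1 := hν1
      nlinarith
    | succ n ih =>
      intro z ν hν0 hν
      rw [Function.iterate_succ_apply'] at hν
      exact hc.eventually_mul_le hu hM hγ hRV hR (hone n fun _ => le_rfl) ih z hν0 hν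
  have hlo : ∀ n z ν, (rootMap (M.K γ) γ)^[n] y z < ν → ∀ᶠ a in atTop, a ≤ ν * c a z := by
    intro n
    induction n with
    | zero =>
      intro z ν hν
      filter_upwards [eventually_gt_atTop 0] with a ha
      have h1 : (m z)⁻¹ < ν := hν
      have h2 := hc.pos hu hM ha z
      calc a = (m z)⁻¹ * (m z * a) := by rw [inv_mul_cancel_left₀ (hm0 z).ne']
        _ ≤ (m z)⁻¹ * c a z := mul_le_mul_of_nonneg_left (hm a ha z) (inv_nonneg.2 (hm0 z).le)
        _ ≤ ν * c a z := mul_le_mul_of_nonneg_right h1.le h2.le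
    | succ n ih =>
      intro z ν hν
      rw [Function.iterate_succ_apply'] at hν
      exact hc.eventually_le_mul hu hM hγ hRV hR hD (hone n hy) ih z hν
  have hlimy := tendsto_iterate_rootMap K_nonneg hγ hv hfix hlim hy
  refine tendsto_div_of_eventually (hv z) (fun ν hν0 hν => ?_) fun ν hν => ?_
  · obtain ⟨n, hn⟩ := ((tendsto_pi_nhds.1 hlim z).eventually_const_lt hν).exists
    exact hup n z ν hν0 hn
  · obtain ⟨n, hn⟩ := ((tendsto_pi_nhds.1 hlimy z).eventually_lt_const hν).exists
    exact hlo n z ν hn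

/-- With constant relative risk aversion, consumption has a proportional lower bound. -/
lemma exists_proportional_of_rpow (hM : M.IsSpectral u) (hγ : 0 < γ) (hR : M.ReturnGap)
    (hf : ∀ x, 0 < x → marginal u x = x ^ (-γ)) {w : Fin N → ℝ} {θ : ℝ} (hw : ∀ z, 1 ≤ w z)
    (hθ1 : θ < 1) (hle : ∀ z, (M.K γ).mulVec w z ≤ θ * w z) :
    ∃ m : Fin N → ℝ, (∀ z, 0 < m z) ∧ (∀ z, m z < 1) ∧
      ∀ a, 0 < a → ∀ z, ∫⁻ s, ENNReal.ofReal (M.discount s * M.ret s *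
        marginal u (m s.1 * (M.ret s * ((1 - m z) * a)))) ∂M.step z ≤
          ENNReal.ofReal (marginal u (m z * a)) := by
  have hw0 : ∀ z, 0 < w z := fun z => zero_lt_one.trans_le (hw z)
  -- Saving only the share 1 - m of wealth costs a factor of at most (1 - τ)^(-γ), which the slack
  -- in θ < 1 absorbs. With m = τ w^(-1/γ) one has m^(-γ) = τ^(-γ) w, so the supersolution condition
  -- reduces to (1 - m)^(-γ) K w ≤ w.
  obtain ⟨τ, hτ0, hτ1, hτ⟩ : ∃ τ : ℝ, 0 < τ ∧ τ < 1 ∧ θ * (1 - τ) ^ (-γ) < 1 := by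
    have hcont : ContinuousAt (fun τ : ℝ => θ * (1 - τ) ^ (-γ)) 0 :=
      continuousAt_const.mul ((by fun_prop : ContinuousAt (fun τ : ℝ => 1 - τ) 0).rpow_const
        (Or.inl (by norm_num)))
    have hlim : Tendsto (fun τ : ℝ => θ * (1 - τ) ^ (-γ)) (𝓝[>] 0) (𝓝 θ) := by
      have := hcont.tendsto
      simp only [sub_zero, Real.one_rpow, mul_one] at this
      exact this.mono_left nhdsWithin_le_nhds
    obtain ⟨τ, ⟨h1, h2⟩, h3⟩ := (((hlim.eventually_lt_const hθ1).and
      (nhdsWithin_le_nhds (gt_mem_nhds one_pos))).and self_mem_nhdsWithin).exists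
    exact ⟨τ, h3, h2, h1⟩
  have hwinv : ∀ z, w z ^ (-(1 / γ)) ≤ 1 := fun z =>
    Real.rpow_le_one_of_one_le_of_nonpos (hw z) (by simp [hγ.le])
  have hwpos : ∀ z, 0 < w z ^ (-(1 / γ)) := fun z => Real.rpow_pos_of_pos (hw0 z) _
  have hmτ : ∀ z, τ * w z ^ (-(1 / γ)) ≤ τ := fun z =>
    mul_le_of_le_one_right hτ0.le (hwinv z)
  have hmpow : ∀ z, (τ * w z ^ (-(1 / γ))) ^ (-γ) = τ ^ (-γ) * w z := fun z => by
    rw [Real.mul_rpow hτ0.le (hwpos z).le, ← Real.rpow_mul (hw0 z).le]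
    congr 1
    rw [neg_mul_neg, one_div_mul_cancel hγ.ne', Real.rpow_one]
  refine ⟨fun z => τ * w z ^ (-(1 / γ)), fun z => mul_pos hτ0 (hwpos z),
    fun z => (hmτ z).trans_lt hτ1, fun a ha z => ?_⟩
  set m : Fin N → ℝ := fun z => τ * w z ^ (-(1 / γ))
  have hm0 : ∀ z, 0 < m z := fun z => mul_pos hτ0 (hwpos z)
  set κ := (1 - m z) * a
  have hκ : 0 < κ := mul_pos (by linarith [hmτ z]) ha
  have hX := M.lintegral_step_weight z (X := fun z e f => M.β z e * M.R z f * M.R z f ^ (-γ))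
    measurable_K_prod K_prod_nonneg (hM.integrable_K_prod hR hγ.le)
    (w := fun z => τ ^ (-γ) * κ ^ (-γ) * w z)
    fun z => mul_nonneg (mul_nonneg (Real.rpow_nonneg hτ0.le _) (Real.rpow_nonneg hκ.le _))
      (hw0 z).le
  calc _ = ∫⁻ s, shockFun (fun z e f => M.β z e * M.R z f * M.R z f ^ (-γ)) s *
        ENNReal.ofReal (τ ^ (-γ) * κ ^ (-γ) * w s.1) ∂M.step z := by
        refine lintegral_congr fun s => ?_
        change _ = ENNReal.ofReal (M.discount s * M.ret s * M.ret s ^ (-γ)) * _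
        rcases (M.ret_nonneg s).eq_or_lt with hR0 | hR0
        · simp [← hR0]
        rw [← ENNReal.ofReal_mul (mul_nonneg (mul_nonneg (M.discount_nonneg s) hR0.le)
          (Real.rpow_nonneg hR0.le _)), hf _ (mul_pos (hm0 _) (mul_pos hR0 hκ)),
          Real.mul_rpow (hm0 _).le (mul_pos hR0 hκ).le, Real.mul_rpow hR0.le hκ.le, hmpow]
        congr 1
        ring
    _ = ENNReal.ofReal (τ ^ (-γ) * κ ^ (-γ) * (M.K γ).mulVec w z) := by
        rw [hX]
        congr 1
        change (M.K γ).mulVec ((τ ^ (-γ) * κ ^ (-γ)) • w) z = _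
        rw [Matrix.mulVec_smul]; rfl
    _ ≤ _ := by
        refine ENNReal.ofReal_le_ofReal ?_
        rw [hf _ (mul_pos (hm0 z) ha), Real.mul_rpow (hm0 z).le ha.le, hmpow,
          Real.mul_rpow (by linarith [hmτ z]) ha.le]
        have h1 : (1 - m z) ^ (-γ) ≤ (1 - τ) ^ (-γ) :=
          Real.rpow_le_rpow_of_nonpos (by linarith) (by linarith [hmτ z]) (by linarith)
        have hKw := mulVec_nonneg (A := M.K γ) K_nonneg (fun z => (hw0 z).le) z
        have hτγ : 0 < τ ^ (-γ) := Real.rpow_pos_of_pos hτ0 _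
        have haγ : 0 < a ^ (-γ) := Real.rpow_pos_of_pos ha _
        have h2 : (1 - m z) ^ (-γ) * (M.K γ).mulVec w z ≤ w z := by
          calc _ ≤ (1 - τ) ^ (-γ) * (θ * w z) := by
                have := Real.rpow_nonneg (by linarith : 0 ≤ 1 - τ) (-γ)
                gcongr
                exact hle z
            _ = θ * (1 - τ) ^ (-γ) * w z := by ring
            _ ≤ 1 * w z := by gcongr; exact (hw0 z).le
            _ = w z := one_mul _
        calc _ = τ ^ (-γ) * a ^ (-γ) * ((1 - m z) ^ (-γ) * (M.K γ).mulVec w z) := by ring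
          _ ≤ τ ^ (-γ) * a ^ (-γ) * w z := by gcongr
          _ = _ := by ring

section BoundedRiskAversion

variable {glo ghi : ℝ}

lemma measurable_max_prod (z : Fin N) : Measurable fun p : E × F =>
    M.β z p.1 * M.R z p.2 * max (M.R z p.2 ^ (-glo)) (M.R z p.2 ^ (-ghi)) := by
  have hRm : Measurable fun p : E × F => M.R z p.2 := (M.measurable_R z).comp measurable_snd
  exact (M.measurable_βR_prod z).mul ((hRm.pow_const _).max (hRm.pow_const _))

lemma max_prod_nonneg (z : Fin N) (e : E) (f : F) :
    0 ≤ M.β z e * M.R z f * max (M.R z f ^ (-glo)) (M.R z f ^ (-ghi)) :=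
  mul_nonneg (mul_nonneg (M.β_nonneg z e) (M.R_nonneg z f))
    (le_max_of_le_left (Real.rpow_nonneg (M.R_nonneg z f) _))

lemma IsSpectral.integrable_max_prod (hM : M.IsSpectral u) (hR : M.ReturnGap) (hlo : 0 ≤ glo)
    (hhi : 0 ≤ ghi) (z : Fin N) : Integrable (fun p : E × F =>
      M.β z p.1 * M.R z p.2 * max (M.R z p.2 ^ (-glo)) (M.R z p.2 ^ (-ghi)))
      (M.lawε.prod M.lawζ) :=
  hM.integrable_βR_mul hR (g := fun x => max (x ^ (-glo)) (x ^ (-ghi)))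
    ((measurable_id.pow_const _).max (measurable_id.pow_const _))
    (fun _ hx => le_max_of_le_left (Real.rpow_nonneg hx _))
    (fun δ hδ => ⟨max (δ ^ (-glo)) (δ ^ (-ghi)), fun _ hx =>
      max_le_max (rpow_neg_le_of_le hlo hδ hx) (rpow_neg_le_of_le hhi hδ hx)⟩) z

lemma nextMean_eq_mulVec (X : Fin N → E → F → ℝ) (z : Fin N) :
    M.nextMean X z = (M.PD X).mulVec (fun _ => 1) z := by
  simp [nextMean, PD, Matrix.mulVec, dotProduct, Matrix.mul_diagonal]

/-- With bounded relative risk aversion, the constant `1` is a weight for `K`. -/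
lemma exists_K_mulVec_one_le (hM : M.IsSpectral u) (hR : M.ReturnGap) (hγ : 0 < γ)
    (hlo : 0 ≤ glo) (hγlo : glo ≤ γ) (hγhi : γ ≤ ghi)
    (hmean : ∀ z, M.nextMean (fun z' e f =>
      M.β z' e * M.R z' f * max (M.R z' f ^ (-glo)) (M.R z' f ^ (-ghi))) z < 1) :
    ∃ θ : ℝ, 0 < θ ∧ θ < 1 ∧ ∀ z, (M.K γ).mulVec (fun _ => 1) z ≤ θ * 1 := by
  have hev : ∀ᶠ θ in 𝓝[<] (1 : ℝ), ∀ z, M.nextMean (fun z' e f =>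
      M.β z' e * M.R z' f * max (M.R z' f ^ (-glo)) (M.R z' f ^ (-ghi))) z < θ :=
    eventually_all.2 fun z => nhdsWithin_le_nhds (lt_mem_nhds (hmean z))
  obtain ⟨θ, ⟨h1, h0⟩, h2⟩ := ((hev.and (nhdsWithin_le_nhds (lt_mem_nhds one_pos))).and
    self_mem_nhdsWithin).exists
  refine ⟨θ, h0, h2, fun z => ?_⟩
  rw [mul_one]
  refine le_trans ?_ (h1 z).le
  rw [K, ← nextMean_eq_mulVec]
  refine Finset.sum_le_sum fun z' _ => mul_le_mul_of_nonneg_left ?_ (M.P_nonneg z z')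
  refine integral_mono (hM.integrable_K_prod hR hγ.le z')
    (hM.integrable_max_prod hR hlo (hγ.le.trans hγhi) z') fun p => ?_
  rcases (M.R_nonneg z' p.2).eq_or_lt with hR0 | hR0
  · simp [← hR0]
  refine mul_le_mul_of_nonneg_left ?_ (mul_nonneg (M.β_nonneg _ _) hR0.le)
  -- Since γ lies between the two bounds, R^(-γ) is at most R^(-ghi) for R ≤ 1 and at most R^(-glo)
  -- for R ≥ 1.
  rcases le_total (M.R z' p.2) 1 with h | h
  · exact le_max_of_le_right (Real.rpow_le_rpow_of_exponent_ge hR0 h (by linarith))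
  · exact le_max_of_le_left (Real.rpow_le_rpow_of_exponent_le h (by linarith))

/-- With bounded relative risk aversion, consumption has a proportional lower bound. -/
lemma exists_proportional_of_bounded (hu : IsInada u) (hM : M.IsSpectral u) (hR : M.ReturnGap)
    (hlo : 0 ≤ glo) (hhi : 0 ≤ ghi)
    (hg : ∀ x, 0 < x → glo ≤ -(x * deriv (marginal u) x / marginal u x) ∧
      -(x * deriv (marginal u) x / marginal u x) ≤ ghi)
    (hmean : ∀ z, M.nextMean (fun z' e f =>
      M.β z' e * M.R z' f * max (M.R z' f ^ (-glo)) (M.R z' f ^ (-ghi))) z < 1) :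
    ∃ m : Fin N → ℝ, (∀ z, 0 < m z) ∧ (∀ z, m z < 1) ∧
      ∀ a, 0 < a → ∀ z, ∫⁻ s, ENNReal.ofReal (M.discount s * M.ret s *
        marginal u (m s.1 * (M.ret s * ((1 - m z) * a)))) ∂M.step z ≤
          ENNReal.ofReal (marginal u (m z * a)) := by
  set X : Fin N → E → F → ℝ := fun z' e f =>
    M.β z' e * M.R z' f * max (M.R z' f ^ (-glo)) (M.R z' f ^ (-ghi))
  -- The strict moment inequality leaves room for the factor (1 - τ)^(-ghi), uniformly over the
  -- finitely many states.
  obtain ⟨τ, hτ0, hτ1, hτ⟩ : ∃ τ : ℝ, 0 < τ ∧ τ < 1 ∧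
      ∀ z, M.nextMean X z * (1 - τ) ^ (-ghi) < 1 := by
    have hev : ∀ z, ∀ᶠ τ in 𝓝[>] (0 : ℝ), M.nextMean X z * (1 - τ) ^ (-ghi) < 1 := fun z => by
      have hcont : ContinuousAt (fun τ : ℝ => M.nextMean X z * (1 - τ) ^ (-ghi)) 0 :=
        continuousAt_const.mul ((by fun_prop : ContinuousAt (fun τ : ℝ => 1 - τ) 0).rpow_const
          (Or.inl (by norm_num)))
      have hlim := hcont.tendsto
      simp only [sub_zero, Real.one_rpow, mul_one] at hlim
      exact (hlim.mono_left nhdsWithin_le_nhds).eventually_lt_const (hmean z)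
    obtain ⟨τ, ⟨h1, h2⟩, h3⟩ := (((eventually_all.2 hev).and
      (nhdsWithin_le_nhds (gt_mem_nhds one_pos))).and self_mem_nhdsWithin).exists
    exact ⟨τ, h3, h2, h1⟩
  refine ⟨fun _ => τ, fun _ => hτ0, fun _ => hτ1, fun a ha z => ?_⟩
  have hτ' : 0 < 1 - τ := by linarith
  have hτa : 0 < τ * a := mul_pos hτ0 ha
  have hf := (hu.marginal_pos _ hτa).le
  have hpow : 0 ≤ (1 - τ) ^ (-ghi) := Real.rpow_nonneg hτ'.le _
  calc _ ≤ ∫⁻ s, shockFun X s * ENNReal.ofReal ((1 - τ) ^ (-ghi) * marginal u (τ * a))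
        ∂M.step z := by
        refine lintegral_mono fun s => ?_
        change _ ≤ ENNReal.ofReal (M.discount s * M.ret s *
          max (M.ret s ^ (-glo)) (M.ret s ^ (-ghi))) * _
        rcases (M.ret_nonneg s).eq_or_lt with hR0 | hR0
        · simp [← hR0]
        have hβR : 0 ≤ M.discount s * M.ret s := mul_nonneg (M.discount_nonneg _) hR0.le
        rw [← ENNReal.ofReal_mul (mul_nonneg hβR
          (le_max_of_le_left (Real.rpow_nonneg hR0.le _)))]
        refine ENNReal.ofReal_le_ofReal ?_
        rw [mul_assoc (M.discount s * M.ret s)]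
        refine mul_le_mul_of_nonneg_left ?_ hβR
        -- Regrouped so that 1 - τ ≤ 1 and R act one after the other on τ a, each at the price of
        -- its power bound.
        calc marginal u (τ * (M.ret s * ((1 - τ) * a)))
            = marginal u ((1 - τ) * (M.ret s * (τ * a))) := by congr 1; ring
          _ ≤ (1 - τ) ^ (-ghi) * marginal u (M.ret s * (τ * a)) :=
              marginal_mul_le_of_le_one hu (fun x hx => (hg x hx).2) hτ' (by linarith)
                (mul_pos hR0 hτa)
          _ ≤ (1 - τ) ^ (-ghi) *
                (max (M.ret s ^ (-glo)) (M.ret s ^ (-ghi)) * marginal u (τ * a)) := by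
              gcongr
              exact marginal_mul_le_max hu hg hR0 hτa
          _ = _ := by ring
    _ = ENNReal.ofReal ((1 - τ) ^ (-ghi) * marginal u (τ * a) * M.nextMean X z) := by
        rw [M.lintegral_step_weight z (X := X) measurable_max_prod max_prod_nonneg
          (hM.integrable_max_prod hR hlo hhi)
          (w := fun _ => (1 - τ) ^ (-ghi) * marginal u (τ * a)) fun _ => mul_nonneg hpow hf,
          nextMean_eq_mulVec, ← smul_eq_mul _ ((M.PD X).mulVec _ z), ← Pi.smul_apply,
          ← Matrix.mulVec_smul]
        congr 2
        ext
        simp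
    _ ≤ _ := by
        refine ENNReal.ofReal_le_ofReal ?_
        have := hτ z
        calc _ = M.nextMean X z * (1 - τ) ^ (-ghi) * marginal u (τ * a) := by ring
          _ ≤ 1 * marginal u (τ * a) := by gcongr
          _ = _ := one_mul _

end BoundedRiskAversion

/-- The fixed points of `fixMap` and of `rootMap` correspond by `x = v ^ γ`. -/
lemma fixMap_rpow {v : Fin N → ℝ}
    (hfix : rootMap (M.K γ) γ v = v) : M.fixMap γ (fun z => v z ^ γ) = fun z => v z ^ γ := by
  funext z
  have h := congrFun hfix z
  rw [rootMap] at h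
  rw [fixMap, h]

lemma rootMap_rpow (hγ : 0 < γ) {y : Fin N → ℝ} (hy : ∀ z, 0 ≤ y z)
    (hfix : M.fixMap γ y = y) :
    rootMap (M.K γ) γ (fun z => y z ^ (1 / γ)) = fun z => y z ^ (1 / γ) := by
  funext z
  have hpow : (fun z => (y z ^ (1 / γ)) ^ γ) = y := by
    funext z
    rw [← Real.rpow_mul (hy z), one_div_mul_cancel hγ.ne', Real.rpow_one]
  have h := congrFun hfix z
  rw [fixMap] at h
  rw [rootMap, hpow, ← h, ← Real.rpow_mul, mul_one_div_cancel hγ.ne', Real.rpow_one]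
  exact add_nonneg zero_le_one (Real.rpow_nonneg (mulVec_nonneg K_nonneg hy z) _)

/-- Existence and uniqueness of the fixed point and asymptotic linearity, given a weight for the
matrix `K` and a proportional supersolution of the Euler equation. -/
lemma IsConsumptionFunction.exists_fixMap_eq (hc : M.IsConsumptionFunction u c) (hu : IsInada u)
    (hM : M.IsSpectral u) (hγ : 0 < γ) (hRV : IsRegularlyVarying (marginal u) (-γ))
    (hR : M.ReturnGap) {D : ℝ} (hD : ∀ x, 0 < x → marginal u (x / 2) ≤ D * marginal u x)
    (hm : ∃ m : Fin N → ℝ, (∀ z, 0 < m z) ∧ (∀ z, m z < 1) ∧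
      ∀ a, 0 < a → ∀ z, ∫⁻ s, ENNReal.ofReal (M.discount s * M.ret s *
        marginal u (m s.1 * (M.ret s * ((1 - m z) * a)))) ∂M.step z ≤
          ENNReal.ofReal (marginal u (m z * a)))
    {w : Fin N → ℝ} {θ : ℝ} (hw : ∀ z, 1 ≤ w z) (hθ0 : 0 < θ) (hθ1 : θ < 1)
    (hle : ∀ z, (M.K γ).mulVec w z ≤ θ * w z) :
    ∃ x : Fin N → ℝ, ((∀ z, 0 ≤ x z) ∧ M.fixMap γ x = x) ∧
      (∀ y : Fin N → ℝ, (∀ z, 0 ≤ y z) → M.fixMap γ y = y → y = x) ∧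
      ∀ z, Tendsto (fun a => c a z / a) atTop (𝓝 (x z ^ (-1 / γ))) ∧
        0 < x z ^ (-1 / γ) ∧ x z ^ (-1 / γ) ≤ 1 := by
  obtain ⟨m, hm0, hm1, hm⟩ := hm
  obtain ⟨v, hv, hfix, hlim⟩ := exists_rootMap_eq (A := M.K γ) K_nonneg hγ hw hθ0 hθ1 hle
  have hv0 : ∀ z, 0 < v z := fun z => zero_lt_one.trans_le (hv z)
  have hinv : ∀ z, (v z ^ γ) ^ (-1 / γ) = (v z)⁻¹ := fun z => by
    rw [← Real.rpow_mul (hv0 z).le, mul_div_cancel₀ _ hγ.ne', Real.rpow_neg_one]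
  refine ⟨fun z => v z ^ γ, ⟨fun z => Real.rpow_nonneg (hv0 z).le _,
    fixMap_rpow hfix⟩, fun y hy hyfix => ?_, fun z => ?_⟩
  -- A fixed point lies in the image of `rootMap`, hence above 1. Its iterates are constant and must
  -- converge to v.
  · have hroot := rootMap_rpow hγ hy hyfix
    set y' : Fin N → ℝ := fun z => y z ^ (1 / γ)
    have hy'0 : ∀ z, 0 ≤ y' z := fun z => Real.rpow_nonneg (hy z) _
    have hy'1 : ∀ z, 1 ≤ y' z := fun z => by
      rw [← hroot]; exact one_le_rootMap K_nonneg hy'0 z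
    have h1 := tendsto_iterate_rootMap K_nonneg hγ hv hfix hlim hy'1
    have h2 : ∀ n, (rootMap (M.K γ) γ)^[n] y' = y' := fun n => Function.iterate_fixed hroot n
    simp_rw [h2] at h1
    have h3 : y' = v := tendsto_nhds_unique tendsto_const_nhds h1
    funext z
    rw [← h3, ← Real.rpow_mul (hy z), one_div_mul_cancel hγ.ne', Real.rpow_one]
  · simp only [hinv]
    exact ⟨hc.tendsto_div hu hM hγ hRV hR hD hm0 hm1
      (fun a ha z => hc.mul_le hu hM hD hm0 hm1 hm ha z) hv hfix hlim z,
      inv_pos.2 (hv0 z), inv_le_one_of_one_le₀ (hv z)⟩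

end Environment

end IncomeFluctuation

end

theorem proposition3p3 {N : ℕ} {E F G : Type*}
    [MeasurableSpace E] [MeasurableSpace F] [MeasurableSpace G]
    (M : IncomeFluctuation.Environment N E F G) (u : ℝ → EReal) (γ : ℝ)
    (hu : IncomeFluctuation.IsInada u)
    (hM : M.IsSpectral u)
    (hγ : 0 < γ)
    (hRV : IncomeFluctuation.IsRegularlyVarying (IncomeFluctuation.marginal u) (-γ))
    (hR : M.ReturnGap)
    (c : ℝ → Fin N → ℝ)
    (hc : M.IsConsumptionFunction u c)
    (hcase :
      (IncomeFluctuation.specRad (M.K γ) < 1 ∧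
        ∀ x, 0 < x → IncomeFluctuation.marginal u x = x ^ (-γ)) ∨
      (∃ γlo γhi : ℝ, 0 ≤ γlo ∧
        (∀ x, 0 < x →
          γlo ≤ -(x * deriv (IncomeFluctuation.marginal u) x / IncomeFluctuation.marginal u x) ∧
          -(x * deriv (IncomeFluctuation.marginal u) x / IncomeFluctuation.marginal u x) ≤ γhi) ∧
        ∀ z, M.nextMean (fun z' e f =>
          M.β z' e * M.R z' f * max (M.R z' f ^ (-γlo)) (M.R z' f ^ (-γhi))) z < 1)) :
    ∃ x : Fin N → ℝ,
      ((∀ z, 0 ≤ x z) ∧ M.fixMap γ x = x) ∧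
      (∀ y : Fin N → ℝ, (∀ z, 0 ≤ y z) → M.fixMap γ y = y → y = x) ∧
      ∀ z, Tendsto (fun a => c a z / a) atTop (𝓝 (x z ^ (-1 / γ))) ∧
        0 < x z ^ (-1 / γ) ∧ x z ^ (-1 / γ) ≤ 1 := by
  -- The cases differ only in the doubling constant, the supersolution and the weight: the spectral
  -- radius provides w in the first, while the constant 1 serves in the second.
  rcases hcase with ⟨hr, hf⟩ | ⟨γlo, γhi, hlo, hg, hmean⟩
  · obtain ⟨w, θ, hw, hθ0, hθ1, hle⟩ :=
      IncomeFluctuation.exists_weight IncomeFluctuation.Environment.K_nonneg hr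
    refine hc.exists_fixMap_eq hu hM hγ hRV hR (D := (1 / 2) ^ (-γ)) (fun x hx => ?_)
      (IncomeFluctuation.Environment.exists_proportional_of_rpow hM hγ hR hf hw hθ1 hle)
      hw hθ0 hθ1 hle
    rw [hf x hx, hf _ (half_pos hx), ← Real.mul_rpow (by norm_num) hx.le]
    exact le_of_eq (by congr 1; ring)
  · obtain ⟨hγlo, hγhi⟩ := hRV.mem_Icc hu hg
    obtain ⟨θ, hθ0, hθ1, hle⟩ := IncomeFluctuation.Environment.exists_K_mulVec_one_le hM hR hγ hlo
      hγlo hγhi hmean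
    refine hc.exists_fixMap_eq hu hM hγ hRV hR (D := (1 / 2) ^ (-γhi)) (fun x hx => ?_)
      (IncomeFluctuation.Environment.exists_proportional_of_bounded hu hM hR hlo
        (hγ.le.trans hγhi) hg hmean) (fun _ => le_rfl) hθ0 hθ1 hle
    have := IncomeFluctuation.marginal_mul_le_of_le_one hu (fun x hx => (hg x hx).2)
      (l := 1 / 2) (by norm_num) (by norm_num) hx
    rwa [one_div_mul_eq_div] at this
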